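/- \textbf{Setting.} Let $n,m\ge 1$ be integers. $Q(x_0,r)\subset\mathbb R^n$ is the cube with centre $x_0$, side length $r>0$ and sides parallel to the axes; for $Q=Q(x_0,r)$ and $\delta>0$ put $\delta Q=Q(x_0,\delta r)$. $M$ is the uncentered Hardy--Littlewood maximal operator over cubes, and $M^q(a):=(M a)^q$. Let $\Phi$ be the fundamental solution of $\Delta^m$ on $\mathbb R^n$: $\Phi(x)=C_1|x|^{2m-n}\ln|x|$ if $n$ is even and $2m\ge n$, and $\Phi(x)=C_2|x|^{2m-n}$ otherwise, the constants being those for which $\Delta^m\Phi=\delta$. For a multiindex $\alpha$ with $|\alpha|=2m$ put $$T^*_\alpha(a)(x)=\sup_{\epsilon>0}\Big|\int_{|x-y|>\epsilon}(\partial^\alpha\Phi)(x-y)\,a(y)\,dy\Big|.$$ A weight is a non-negative locally integrable function that is positive and finite almost everywhere; $w(E)=\int_E w$. Let $w\in\mathcal A_\infty=\bigcup_{1\le s<\infty}\mathcal A_s$ (Muckenhoupt classes), with critical indices $q_w=\inf\{s>1:w\in\mathcal A_s\}$ and $r_w=\sup\{s>1:w\in RH_s\}$ (reverse Hölder classes).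 For $0<p\le 1$, $\max\{1,p\,\frac{r_w}{r_w-1}\}<p_0\le\infty$ (the quotient being $1$ if $r_w=\infty$) and an integer $d\ge\lfloor n(\frac{q_w}{p}-1)\rfloor$, a $w$-$(p,p_0,d)$ atom on $Q=Q(x_0,r)$ is a function $a\in L^{p_0}(\mathbb R^n)$ supported in $Q$ with $\|a\|_{L^{p_0}}\le|Q|^{1/p_0}w(Q)^{-1/p}$ and $\int x^\alpha a(x)\,dx=0$ for all $|\alpha|\le d$. Its potential is $b(x)=\int\Phi(x-y)a(y)\,dy$. For $1<q<\infty$ and an integer $k\ge0$, $E^q_k$ is the quotient of $L^q_{loc}(\mathbb R^n)$ by the polynomials of degree at most $k$. For $G\in E^q_{2m-1}$, $$N_{q,2m}(G;x)=\inf_{g\in G}\ \sup_{\rho>0}\ \rho^{-2m}\Big(\frac1{|Q(x,\rho)|}\int_{Q(x,\rho)}|g(y)|^q\,dy\Big)^{1/q}.$$ \textbf{Proposition.} Let $q>1$ and $0<\mu<2m$, let $a$ be a $w$-$(p,p_0,d)$ atom on $Q$ with $d\ge\max\{\lfloor n(\frac{q_w}{p}-1)\rfloor,2m-1\}$, and let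 $b$ be its potential. Consider, for all $x\in\mathbb R^n$, the inequality $$N_{q,2m}(B;x)\le C\Big(w(Q)^{-1/p}\,[M(\chi_Q)(x)]^{\frac{2m+n/q-\mu}{n}}+\chi_{4\sqrt nQ}(x)\Big[M(a)(x)+[M(M^q(a))(x)]^{1/q}+\sum_{|\alpha|=2m}T^*_\alpha(a)(x)\Big]\Big),\qquad(*)$$ where $B$ is the class of $b$ in $E^q_{2m-1}$. (i) If $\frac1{p_0}<\frac1q+\frac{2m}{n}$ (in particular if $p_0\ge q$, or if $n\le 2m$), then $b\in L^q_{loc}(\mathbb R^n)$, so that $B$ is defined, and $(*)$ holds for all $x\in\mathbb R^n$ with a constant $C$ that depends only on $n,m,q,\mu,p_0$, and not on $w$, $p$, $d$, $Q$, $a$ or $x$. (ii) For every admissible $p_0$, whenever $b\in L^q_{loc}(\mathbb R^n)$ (that is, whenever $B$ is defined), $(*)$ holds for all $x\in\mathbb R^n$ with a constant $C$ that may depend on the atom $a$, but not on $x$. -/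

import Mathlib

open MeasureTheory Filter Topology
open scoped ENNReal NNReal

noncomputable section

namespace CalderonHardy

/-- Euclidean space `ℝⁿ`. -/
abbrev Rn (n : ℕ) : Type := EuclideanSpace ℝ (Fin n)

/-- The (closed) cube `Q(x₀, r)` with sides parallel to the axes, centre `x₀` and side length `r`. -/
def cube {n : ℕ} (x₀ : Rn n) (r : ℝ) : Set (Rn n) := {y | ∀ i, |y i - x₀ i| ≤ r / 2}

/-- The average `|Q|⁻¹ ∫_Q f` of a non-negative function. -/
def avg {n : ℕ} (Q : Set (Rn n)) (f : Rn n → ℝ≥0∞) : ℝ≥0∞ := (volume Q)⁻¹ * ∫⁻ y in Q, f y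

/-- The uncentered Hardy-Littlewood maximal function of a non-negative function:
the supremum of the averages over all cubes that contain `x`. -/
def maximal {n : ℕ} (f : Rn n → ℝ≥0∞) (x : Rn n) : ℝ≥0∞ :=
  ⨆ (z : Rn n) (r : ℝ) (_ : 0 < r) (_ : x ∈ cube z r), avg (cube z r) f

/-! ### Weights -/

/-- A weight: a non-negative locally integrable function with values in `(0, ∞)` almost everywhere
(finiteness almost everywhere follows from local integrability). -/
structure IsWeight {n : ℕ} (w : Rn n → ℝ≥0∞) : Prop where
  aemeasurable : AEMeasurable w volume
  locallyIntegrable : ∀ K : Set (Rn n), IsCompact K → ∫⁻ x in K, w x < ∞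
  pos : ∀ᵐ x : Rn n, 0 < w x

/-- The weighted measure `w(E) = ∫_E w`. -/
def wMeas {n : ℕ} (w : Rn n → ℝ≥0∞) (E : Set (Rn n)) : ℝ≥0∞ := ∫⁻ x in E, w x

/-- The Muckenhoupt class `A_p`, `1 ≤ p < ∞`. -/
def MuckenhouptA {n : ℕ} (p : ℝ) (w : Rn n → ℝ≥0∞) : Prop :=
  IsWeight w ∧
    ((p = 1 ∧ ∃ C : ℝ≥0, ∀ᵐ x : Rn n, maximal w x ≤ C * w x) ∨
      (1 < p ∧ ∃ C : ℝ≥0, ∀ (z : Rn n) (r : ℝ), 0 < r →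
        avg (cube z r) w * (avg (cube z r) fun y => w y ^ (-(1 / (p - 1)))) ^ (p - 1) ≤ C))

/-- `A_∞` is the union of the classes `A_p`, `1 ≤ p < ∞`. -/
def MuckenhouptAInfty {n : ℕ} (w : Rn n → ℝ≥0∞) : Prop := ∃ p : ℝ, 1 ≤ p ∧ MuckenhouptA p w

/-- The critical index `q_w = inf {q > 1 : w ∈ A_q}`. -/
def critIndex {n : ℕ} (w : Rn n → ℝ≥0∞) : ℝ := sInf {q : ℝ | 1 < q ∧ MuckenhouptA q w}

/-- The reverse Hölder inequality with exponent `s > 1`. -/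
def ReverseHolder {n : ℕ} (s : ℝ) (w : Rn n → ℝ≥0∞) : Prop :=
  ∃ C : ℝ≥0, ∀ (z : Rn n) (r : ℝ), 0 < r →
    (avg (cube z r) fun y => w y ^ s) ^ (1 / s) ≤ C * avg (cube z r) w

/-- The critical index `r_w = sup {r > 1 : w ∈ RH_r}`, an element of `(1, ∞]` when `w ∈ A_∞`. -/
def rhIndex {n : ℕ} (w : Rn n → ℝ≥0∞) : ℝ≥0∞ :=
  ⨆ (s : ℝ) (_ : 1 < s ∧ ReverseHolder s w), ENNReal.ofReal s

open Classical in
/-- The ratio `r_w / (r_w - 1)`, read as `1` when `r_w = ∞`. -/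
def rhRatio {n : ℕ} (w : Rn n → ℝ≥0∞) : ℝ≥0∞ :=
  if rhIndex w = ∞ then 1 else rhIndex w / (rhIndex w - 1)

/-! ### Atoms -/

/-- `a` is a `w-(p, p₀, d)` atom, with `Q = Q(x₀, r)` the cube of its definition. -/
structure IsAtom {n : ℕ} {𝕜 : Type*} [RCLike 𝕜] (w : Rn n → ℝ≥0∞) (p : ℝ) (p₀ : ℝ≥0∞) (d : ℤ)
    (x₀ : Rn n) (r : ℝ) (a : Rn n → 𝕜) : Prop where
  weight : MuckenhouptAInfty w
  p_pos : 0 < p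
  p_le_one : p ≤ 1
  lt_p₀ : max 1 (ENNReal.ofReal p * rhRatio w) < p₀
  le_d : ⌊(n : ℝ) * (critIndex w / p - 1)⌋ ≤ d
  r_pos : 0 < r
  memLp : MemLp a p₀ volume
  support : ∀ᵐ y : Rn n, y ∉ cube x₀ r → a y = 0
  size : eLpNorm a p₀ volume ≤
    volume (cube x₀ r) ^ (1 / p₀).toReal * wMeas w (cube x₀ r) ^ (-(1 / p))
  moments : ∀ α : Fin n → ℕ, ((∑ i, α i : ℕ) : ℤ) ≤ d →
    ∫ y : Rn n, (∏ i, ((y i : ℝ) : 𝕜) ^ α i) * a y = 0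

/-! ### The fundamental solution of the iterated Laplacian and potentials -/

/-- The normalizing constant of the fundamental solution of `Δ^m` on `ℝⁿ`, namely the inverse of
`ω · 2^(m-1) (m-1)! · ∏ (2k - n)`, where `ω = 2 π^(n/2) / Γ(n/2)` is the surface measure of the unit
sphere and the product runs over `1 ≤ k ≤ m` with `2k ≠ n`. For `n = 3`, `m = 1` it is
`-1 / (4π)`; for `n = 2`, `m = 1` it is `1 / (2π)`; for `n = 4`, `m = 2` it is `-1 / (8π²)`. -/
def fundConst (n m : ℕ) : ℝ :=
  (2 * Real.pi ^ ((n : ℝ) / 2) / Real.Gamma ((n : ℝ) / 2) * (2 ^ (m - 1) * ((m - 1).factorial : ℝ)) *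
    ∏ k ∈ (Finset.Icc 1 m).filter (fun k => 2 * k ≠ n), (2 * (k : ℝ) - (n : ℝ)))⁻¹

/-- The fundamental solution `Φ` of `Δ^m` on `ℝⁿ`: `C₁ |x|^(2m-n) ln |x|` if `n` is even and
`2m - n ≥ 0`, and `C₂ |x|^(2m-n)` otherwise. -/
def fundSol (n m : ℕ) (x : Rn n) : ℝ :=
  if Even n ∧ n ≤ 2 * m then fundConst n m * ‖x‖ ^ (2 * (m : ℤ) - (n : ℤ)) * Real.log ‖x‖
  else fundConst n m * ‖x‖ ^ (2 * (m : ℤ) - (n : ℤ))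

/-- The partial derivative `∂f/∂xᵢ`. -/
def partialD {n : ℕ} (i : Fin n) (f : Rn n → ℝ) (x : Rn n) : ℝ :=
  lineDeriv ℝ f x (EuclideanSpace.single i 1)

/-- The iterated partial derivative `∂^α f` for a multiindex `α`. -/
def multiD {n : ℕ} (α : Fin n → ℕ) (f : Rn n → ℝ) : Rn n → ℝ :=
  (List.finRange n).foldr (fun i g => (partialD i)^[α i] g) f

section Potential

variable {n : ℕ} {𝕜 : Type*} [RCLike 𝕜]

/-- The potential `b(x) = ∫ Φ(x - y) a(y) dy`. -/
def potential (m : ℕ) (a : Rn n → 𝕜) (x : Rn n) : 𝕜 :=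
  ∫ y : Rn n, ((fundSol n m (x - y) : ℝ) : 𝕜) * a y

/-- The maximal singular integral
`T*_α a (x) = sup_{ε > 0} |∫_{|x - y| > ε} (∂^α Φ)(x - y) a(y) dy|`. -/
def maxSingular (m : ℕ) (α : Fin n → ℕ) (a : Rn n → 𝕜) (x : Rn n) : ℝ≥0∞ :=
  ⨆ (ε : ℝ) (_ : 0 < ε),
    ‖∫ y in {y : Rn n | ε < ‖x - y‖}, ((multiD α (fundSol n m) (x - y) : ℝ) : 𝕜) * a y‖ₑ

end Potential

/-! ### The spaces `L^q_loc`, `E^q_k` and Calderón's maximal functions -/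

section Spaces

variable (n : ℕ) (𝕜 : Type*) [RCLike 𝕜]

/-- The space `L^q_loc(ℝⁿ)` (functions, not yet identified when equal almost everywhere). -/
def LqLoc (q : ℝ) : Submodule 𝕜 (Rn n → 𝕜) where
  carrier := {g | ∀ K : Set (Rn n), IsCompact K → MemLp g (ENNReal.ofReal q) (volume.restrict K)}
  add_mem' := fun hf hg K hK => (hf K hK).add (hg K hK)
  zero_mem' := fun _ _ => MemLp.zero
  smul_mem' := fun c _ hf K hK => (hf K hK).const_smul c

/-- The functions in `L^q_loc(ℝⁿ)` that agree almost everywhere with a polynomial of degree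
at most `k`. -/
def polySub (q : ℝ) (k : ℕ) : Submodule 𝕜 (LqLoc n 𝕜 q) where
  carrier := {g | ∃ P : MvPolynomial (Fin n) 𝕜, P.totalDegree ≤ k ∧
    ∀ᵐ x : Rn n, (g : Rn n → 𝕜) x = MvPolynomial.eval (fun i => ((x i : ℝ) : 𝕜)) P}
  add_mem' := by
    rintro f g ⟨P, hP, hf⟩ ⟨R, hR, hg⟩
    refine ⟨P + R, (MvPolynomial.totalDegree_add P R).trans (max_le hP hR), ?_⟩
    filter_upwards [hf, hg] with x h1 h2
    simp [h1, h2]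
  zero_mem' := ⟨0, by simp, by simp⟩
  smul_mem' := by
    rintro c g ⟨P, hP, hg⟩
    refine ⟨c • P, (MvPolynomial.totalDegree_smul_le c P).trans hP, ?_⟩
    filter_upwards [hg] with x h
    simp [h, MvPolynomial.smul_eval]

/-- The quotient space `E^q_k` of `L^q_loc(ℝⁿ)` by the polynomials of degree at most `k`. -/
abbrev Eqk (q : ℝ) (k : ℕ) : Type _ := LqLoc n 𝕜 q ⧸ polySub n 𝕜 q k

variable {n 𝕜}

/-- The class in `E^q_k` of a function `g ∈ L^q_loc(ℝⁿ)`. -/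
def toEqk (q : ℝ) (k : ℕ) (g : Rn n → 𝕜) (hg : g ∈ LqLoc n 𝕜 q) : Eqk n 𝕜 q k :=
  Submodule.Quotient.mk ⟨g, hg⟩

/-- `η_{q,γ}(g; x) = sup_{r > 0} r^{-γ} (|Q(x,r)|⁻¹ ∫_{Q(x,r)} |g|^q)^{1/q}`. -/
def eta (q γ : ℝ) (g : Rn n → 𝕜) (x : Rn n) : ℝ≥0∞ :=
  ⨆ (r : ℝ) (_ : 0 < r),
    ENNReal.ofReal (r ^ (-γ)) * (avg (cube x r) fun y => ‖g y‖ₑ ^ q) ^ (1 / q)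

/-- Calderón's maximal function `N_{q,γ}(G; x) = inf {η_{q,γ}(g; x) : g ∈ G}` of a class
`G ∈ E^q_k`. -/
def calderonN (q γ : ℝ) (k : ℕ) (G : Eqk n 𝕜 q k) (x : Rn n) : ℝ≥0∞ :=
  ⨅ (g : LqLoc n 𝕜 q) (_ : (Submodule.Quotient.mk g : Eqk n 𝕜 q k) = G),
    eta q γ (g : Rn n → 𝕜) x

/-- The sum on the right-hand side of the pointwise inequality:
`w(Q)^{-1/p} (M χ_Q)(x)^{(2m + n/q - μ)/n} + χ_{4√n Q}(x) M a (x)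
+ χ_{4√n Q}(x) (M ((M a)^q))(x)^{1/q} + χ_{4√n Q}(x) ∑_{|α| = 2m} T*_α a (x)`, with `Q = Q(x₀, r)`. -/
def rhs (m : ℕ) (q μ p : ℝ) (w : Rn n → ℝ≥0∞) (x₀ : Rn n) (r : ℝ) (a : Rn n → 𝕜) (x : Rn n) :
    ℝ≥0∞ :=
  let χ : ℝ≥0∞ := (cube x₀ (4 * Real.sqrt n * r)).indicator 1 x
  wMeas w (cube x₀ r) ^ (-(1 / p)) *
      maximal ((cube x₀ r).indicator 1) x ^ ((2 * (m : ℝ) + n / q - μ) / n)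
    + χ * maximal (fun y => ‖a y‖ₑ) x
    + χ * maximal (fun y => maximal (fun z => ‖a z‖ₑ) y ^ q) x ^ (1 / q)
    + χ * ∑ α ∈ Finset.piAntidiag (Finset.univ : Finset (Fin n)) (2 * m), maxSingular m α a x

end Spaces

end CalderonHardy

end

open CalderonHardy

/-! Put N = 2m and s = √n r / 2, so that Q lies in the ball of radius s about x₀. The infimum in
`calderonN` is tested with b - P_x, where P_x is the Taylor polynomial of b at x of degree below N,
obtained by differentiating Φ under the integral (`potentialPoly`). Then b(y) - P_x(y) is the
integral of a(z) against the Taylor remainder of Φ from x - z to y - z. The kernel Φ is homogeneous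
of degree N - n up to a logarithm times a polynomial of degree below N (`LogHomogeneous`). That
polynomial is killed by derivatives of order N, by Taylor remainders of order N and by the moments
of a, so every estimate scales as if no logarithm were present.

Near Q, the integral is split at |z - x| = 2|y - x|. The close part is at most a constant times |y -
x|^N (Ma(x) + Ma(y)), since the remainder has an integrable singularity. In the distant part, the
terms of order N are truncated singular integrals bounded by `maxSingular`, and the remainder of
order N + 1 is integrable at infinity and costs Ma(x). This is `exists_pointwise_bound`; averaging
q-th powers over cubes about x produces M(M^q(a)). The argument works at every x, with no
exceptional null set.

Away from Q, let D = |x - x₀|. If 4|y - x| ≤ D, the moments allow a second expansion about x₀, and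
the mixed remainder of order 2N decays like D^(-n-N). If 4|y - x| > D, then b and P_x are estimated
separately. Here b is controlled only through its L^q norm; a cube about x that contains such y has
side at least a multiple of D, which gives D^(-N-n/q) ‖b‖_q (`exists_eta_outside_le`). Finally
Mχ_Q(x) ≥ (r/3D)^n turns decay in D into a power of Mχ_Q.

Thus everything rests on ‖b‖_q ≤ β w(Q)^(-1/p) r^(N+n/q) (`exists_calderonN_le_rhs`). Off the ball
of radius 2s, b decays like |y - x₀|^(-n), which is in L^q because q > 1. On that ball, Young's
inequality gives a uniform β when 1/p₀ < 1/q + 2m/n, which is case (i). In case (ii) local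
integrability and the tail make ‖b‖_q finite, and β is the resulting ratio, which depends on the
atom. -/

noncomputable section

namespace CalderonHardy

/-! ### Iterated directional derivatives along lists of vectors. -/

section DirectionalDerivatives

open scoped ContDiff

variable {E : Type*} [NormedAddCommGroup E] [NormedSpace ℝ E]

/-- The iterated directional derivative along the vectors of a list. -/
def dirD (l : List E) (f : E → ℝ) : E → ℝ := l.foldr (fun v g u => fderiv ℝ g u v) f

@[simp] lemma dirD_nil (f : E → ℝ) : dirD [] f = f := rfl

lemma dirD_cons (v : E) (l : List E) (f : E → ℝ) :
    dirD (v :: l) f = fun u => fderiv ℝ (dirD l f) u v := rfl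

lemma dirD_append (l l' : List E) (f : E → ℝ) : dirD (l ++ l') f = dirD l (dirD l' f) := by
  simp [dirD, List.foldr_append]

lemma dirD_contDiffOn {U : Set E} (hU : IsOpen U) {f : E → ℝ} (hf : ContDiffOn ℝ ∞ f U)
    (l : List E) : ContDiffOn ℝ ∞ (dirD l f) U := by
  induction l with
  | nil => exact hf
  | cons v l ih =>
    rw [dirD_cons]
    exact (ih.fderiv_of_isOpen hU (by simp)).clm_apply contDiffOn_const

lemma dirD_congr {U : Set E} (hU : IsOpen U) {f g : E → ℝ} (h : Set.EqOn f g U) (l : List E) :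
    Set.EqOn (dirD l f) (dirD l g) U := by
  induction l with
  | nil => exact h
  | cons v l ih =>
    intro u hu
    have : dirD l f =ᶠ[𝓝 u] dirD l g := ih.eventuallyEq_of_mem (hU.mem_nhds hu)
    simp only [dirD_cons, this.fderiv_eq]

lemma dirD_swap {U : Set E} (hU : IsOpen U) {f : E → ℝ} (hf : ContDiffOn ℝ ∞ f U) (v w : E) :
    Set.EqOn (dirD [v, w] f) (dirD [w, v] f) U := by
  intro u hu
  have hfu : ContDiffAt ℝ ∞ f u := hf.contDiffAt (hU.mem_nhds hu)
  have hd : DifferentiableAt ℝ (fderiv ℝ f) u :=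
    ((hfu.fderiv_right (m := ∞) (by simp)).differentiableAt (by simp))
  have hs : IsSymmSndFDerivAt ℝ f u := hfu.isSymmSndFDerivAt (by
    simp only [minSmoothness_of_isRCLikeNormedField]; exact WithTop.coe_le_coe.2 (le_top : (2 : ℕ∞) ≤ ⊤))
  simp only [dirD_cons, dirD_nil]
  rw [fderiv_clm_apply hd (by fun_prop), fderiv_clm_apply hd (by fun_prop)]
  simpa using hs.eq v w

/-- Second derivatives of a smooth function are symmetric, and adjacent transpositions generate all
permutations. -/
lemma dirD_perm {U : Set E} (hU : IsOpen U) {f : E → ℝ} (hf : ContDiffOn ℝ ∞ f U) {l l' : List E}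
    (h : l.Perm l') : Set.EqOn (dirD l f) (dirD l' f) U := by
  induction h with
  | nil => exact fun _ _ => rfl
  | cons v _ ih => exact dirD_congr hU ih [v]
  | swap v w l => exact dirD_swap hU (dirD_contDiffOn hU hf l) w v
  | trans _ _ ih₁ ih₂ => exact ih₁.trans ih₂

lemma dirD_comp_add (f : E → ℝ) (a : E) (l : List E) (u : E) :
    dirD l (fun x => f (x + a)) u = dirD l f (u + a) := by
  induction l generalizing u with
  | nil => rfl
  | cons v l ih =>
    simp only [dirD_cons]
    rw [show dirD l (fun x => f (x + a)) = fun x => dirD l f (x + a) from funext ih,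
      fderiv_comp_add_right]

lemma dirD_comp_smul (f : E → ℝ) (t : ℝ) (l : List E) (u : E) :
    dirD l (fun x => f (t • x)) u = t ^ l.length * dirD l f (t • u) := by
  induction l generalizing u with
  | nil => simp
  | cons v l ih =>
    simp only [dirD_cons]
    rw [show dirD l (fun x => f (t • x)) = t ^ l.length • fun x => dirD l f (t • x) from funext ih,
      fderiv_const_smul_field, Pi.smul_apply, fderiv_comp_smul (f := dirD l f)]
    simp [pow_succ, mul_assoc]

lemma dirD_add {U : Set E} (hU : IsOpen U) {f g : E → ℝ} (hf : ContDiffOn ℝ ∞ f U)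
    (hg : ContDiffOn ℝ ∞ g U) (l : List E) :
    Set.EqOn (dirD l (fun u => f u + g u)) (fun u => dirD l f u + dirD l g u) U := by
  induction l with
  | nil => exact fun _ _ => rfl
  | cons v l ih =>
    intro u hu
    have h1 := (ih.eventuallyEq_of_mem (hU.mem_nhds hu)).fderiv_eq (𝕜 := ℝ)
    simp only [dirD_cons, h1]
    rw [fderiv_fun_add]
    · simp
    · exact ((dirD_contDiffOn hU hf l).contDiffAt (hU.mem_nhds hu)).differentiableAt (by simp)
    · exact ((dirD_contDiffOn hU hg l).contDiffAt (hU.mem_nhds hu)).differentiableAt (by simp)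

lemma dirD_const_mul (c : ℝ) (f : E → ℝ) (l : List E) :
    dirD l (fun u => c * f u) = fun u => c * dirD l f u := by
  induction l with
  | nil => rfl
  | cons v l ih =>
    simp only [dirD_cons, ih]
    ext u
    rw [show (fun u => c * dirD l f u) = c • dirD l f from rfl, fderiv_const_smul_field]
    simp

lemma dirD_sum {U : Set E} (hU : IsOpen U) {ι : Type*} (s : Finset ι) {f : ι → E → ℝ}
    (hf : ∀ i ∈ s, ContDiffOn ℝ ∞ (f i) U) (l : List E) :
    Set.EqOn (dirD l (fun u => ∑ i ∈ s, f i u)) (fun u => ∑ i ∈ s, dirD l (f i) u) U := by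
  classical
  induction s using Finset.induction_on with
  | empty =>
    intro u _
    simp only [Finset.sum_empty]
    have := congrFun (dirD_const_mul 0 (fun _ : E => (0 : ℝ)) l) u
    simpa using this
  | insert i s hi ih =>
    intro u hu
    simp only [Finset.sum_insert hi]
    have h2 : ContDiffOn ℝ ∞ (fun u => ∑ j ∈ s, f j u) U :=
      ContDiffOn.sum fun j hj => hf j (Finset.mem_insert_of_mem hj)
    rw [dirD_add hU (hf i (Finset.mem_insert_self _ _)) h2 l hu]
    simp only
    rw [ih (fun j hj => hf j (Finset.mem_insert_of_mem hj)) hu]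

/-- Gives access to multilinearity in the directions and to the operator norm of the k-th
derivative. -/
lemma dirD_ofFn_eq_iteratedFDeriv {U : Set E} (hU : IsOpen U) {f : E → ℝ}
    (hf : ContDiffOn ℝ ∞ f U) {k : ℕ} (v : Fin k → E) {u : E} (hu : u ∈ U) :
    dirD (List.ofFn v) f u = iteratedFDeriv ℝ k f u v := by
  induction k generalizing u with
  | zero => simp
  | succ k ih =>
    have hfu : ContDiffAt ℝ ∞ f u := hf.contDiffAt (hU.mem_nhds hu)
    have hd : DifferentiableAt ℝ (iteratedFDeriv ℝ k f) u :=
      hfu.differentiableAt_iteratedFDeriv (by exact_mod_cast ENat.natCast_lt_top k)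
    rw [List.ofFn_succ, dirD_cons, hd.iteratedFDeriv_succ_apply_left']
    have : dirD (List.ofFn (Fin.tail v)) f =ᶠ[𝓝 u] fun x => iteratedFDeriv ℝ k f x (Fin.tail v) :=
      eventually_of_mem (hU.mem_nhds hu) fun x hx => ih (Fin.tail v) hx
    exact congrArg (fun L : E →L[ℝ] ℝ => L (v 0)) this.fderiv_eq

lemma abs_dirD_le {U : Set E} (hU : IsOpen U) {f : E → ℝ}
    (hf : ContDiffOn ℝ ∞ f U) (l : List E) {u : E} (hu : u ∈ U) :
    |dirD l f u| ≤ ‖iteratedFDeriv ℝ l.length f u‖ * (l.map norm).prod := by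
  have h := dirD_ofFn_eq_iteratedFDeriv hU hf l.get hu
  rw [List.ofFn_get] at h
  rw [h]
  refine ((iteratedFDeriv ℝ l.length f u).le_opNorm l.get).trans_eq ?_
  congr 1
  rw [← List.prod_ofFn]
  congr 1
  conv_rhs => rw [← List.ofFn_get l, List.map_ofFn]
  rfl

end DirectionalDerivatives

/-! ### Taylor polynomials and remainders in a fixed direction. -/

section Taylor

open scoped ContDiff

variable {E : Type*} [NormedAddCommGroup E] [NormedSpace ℝ E]

/-- The Taylor polynomial of order `< N` of `f` at `u` in the direction `h`. -/
def taylorPoly (N : ℕ) (h : E) (f : E → ℝ) (u : E) : ℝ :=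
  ∑ k ∈ Finset.range N, ((k.factorial : ℝ))⁻¹ * dirD (List.replicate k h) f u

/-- The Taylor remainder of order `N`. -/
def taylorRem (N : ℕ) (h : E) (f : E → ℝ) (u : E) : ℝ := f (u + h) - taylorPoly N h f u

lemma taylorRem_eq_add (N : ℕ) (h : E) (f : E → ℝ) (u : E) :
    taylorRem N h f u =
      ((N.factorial : ℝ))⁻¹ * dirD (List.replicate N h) f u + taylorRem (N + 1) h f u := by
  simp only [taylorRem, taylorPoly, Finset.sum_range_succ]
  ring

lemma iteratedDerivWithin_segment {U : Set E} (hU : IsOpen U) {f : E → ℝ}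
    (hf : ContDiffOn ℝ ∞ f U) {u h : E} (hs : ∀ t ∈ Set.Icc (0 : ℝ) 1, u + t • h ∈ U) (k : ℕ) :
    ∀ t ∈ Set.Icc (0 : ℝ) 1, iteratedDerivWithin k (fun t : ℝ => f (u + t • h)) (Set.Icc 0 1) t =
      dirD (List.replicate k h) f (u + t • h) := by
  induction k with
  | zero => intro t _; simp
  | succ k ih =>
    intro t ht
    rw [iteratedDerivWithin_succ, derivWithin_congr ih (ih t ht), List.replicate_succ, dirD_cons]
    have hd : DifferentiableAt ℝ (dirD (List.replicate k h) f) (u + t • h) :=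
      ((dirD_contDiffOn hU hf _).contDiffAt (hU.mem_nhds (hs t ht))).differentiableAt (by simp)
    have h1 : HasDerivAt (fun t : ℝ => u + t • h) h t := by
      simpa using ((hasDerivAt_id t).smul_const h).const_add u
    have h2 := hd.hasFDerivAt.comp_hasDerivAt t h1
    exact h2.hasDerivWithinAt.derivWithin (uniqueDiffOn_Icc_zero_one t ht)

/-- One-variable Taylor along t ↦ u + t h on [0, 1]; the size of h is contained in the directional
derivative, and the factor 1/(N-1)! is discarded. -/
lemma abs_taylorRem_le {U : Set E} (hU : IsOpen U) {f : E → ℝ}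
    (hf : ContDiffOn ℝ ∞ f U) {u h : E} (hs : ∀ t ∈ Set.Icc (0 : ℝ) 1, u + t • h ∈ U) {N : ℕ}
    (hN : 1 ≤ N) {A : ℝ}
    (hA : ∀ t ∈ Set.Icc (0 : ℝ) 1, |dirD (List.replicate N h) f (u + t • h)| ≤ A) :
    |taylorRem N h f u| ≤ A := by
  obtain ⟨M, rfl⟩ : ∃ M, N = M + 1 := ⟨N - 1, by omega⟩
  have key := iteratedDerivWithin_segment hU hf hs
  have hA0 : 0 ≤ A := (abs_nonneg _).trans (hA 0 (by simp))
  have hc : ContDiffOn ℝ (M + 1 : ℕ) (fun t : ℝ => f (u + t • h)) (Set.Icc 0 1) := by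
    refine (hf.of_le (by exact_mod_cast le_top)).comp ?_ hs
    fun_prop
  have h1 := taylor_mean_remainder_bound (f := fun t : ℝ => f (u + t • h)) (a := 0) (b := 1)
    (C := A) (x := 1) (n := M) zero_le_one (by exact_mod_cast hc) (by simp) (by
      intro y hy
      rw [key _ y hy]
      exact hA y hy)
  rw [taylor_within_apply] at h1
  have h2 : ∑ k ∈ Finset.range (M + 1), (((k.factorial : ℝ))⁻¹ * (1 - 0 : ℝ) ^ k) •
      iteratedDerivWithin k (fun t : ℝ => f (u + t • h)) (Set.Icc 0 1) 0
      = taylorPoly (M + 1) h f u := by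
    refine Finset.sum_congr rfl fun k _ => ?_
    rw [key k 0 (by simp)]
    simp
  rw [h2] at h1
  simp only [one_smul, Real.norm_eq_abs, sub_zero, one_pow, mul_one] at h1
  refine h1.trans (div_le_self hA0 ?_)
  exact_mod_cast Nat.one_le_iff_ne_zero.mpr (Nat.factorial_ne_zero M)

lemma taylorPoly_contDiffOn {U : Set E} (hU : IsOpen U) {f : E → ℝ} (hf : ContDiffOn ℝ ∞ f U)
    (N : ℕ) (h : E) : ContDiffOn ℝ ∞ (taylorPoly N h f) U :=
  ContDiffOn.sum fun _ _ => contDiffOn_const.mul (dirD_contDiffOn hU hf _)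

lemma taylorRem_contDiffOn {U V : Set E} (hU : IsOpen U) {f : E → ℝ} (hf : ContDiffOn ℝ ∞ f U)
    (N : ℕ) {h : E} (hVU : V ⊆ U) (hV : ∀ u ∈ V, u + h ∈ U) :
    ContDiffOn ℝ ∞ (taylorRem N h f) V :=
  (hf.comp (contDiffOn_id.add contDiffOn_const) hV).sub
    ((taylorPoly_contDiffOn hU hf N h).mono hVU)

/-- Taking Taylor remainders commutes with directional derivatives. -/
lemma dirD_taylorRem {U V : Set E} (hU : IsOpen U) (hVo : IsOpen V) {f : E → ℝ}
    (hf : ContDiffOn ℝ ∞ f U) (N : ℕ) {h : E} (hVU : V ⊆ U) (hV : ∀ u ∈ V, u + h ∈ U)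
    (l : List E) {u : E} (hu : u ∈ V) :
    dirD l (taylorRem N h f) u = taylorRem N h (dirD l f) u := by
  have e1 : taylorRem N h f = fun u => f (u + h) + ∑ k ∈ Finset.range N,
      (-((k.factorial : ℝ))⁻¹) * dirD (List.replicate k h) f u := by
    ext u
    simp [taylorRem, taylorPoly, sub_eq_add_neg]
  have c1 : ContDiffOn ℝ ∞ (fun u => f (u + h)) V := hf.comp (contDiffOn_id.add contDiffOn_const) hV
  have c2 : ∀ k ∈ Finset.range N, ContDiffOn ℝ ∞
      (fun u => (-((k.factorial : ℝ))⁻¹) * dirD (List.replicate k h) f u) V := fun k _ =>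
    contDiffOn_const.mul ((dirD_contDiffOn hU hf _).mono hVU)
  rw [e1, dirD_add hVo c1 (ContDiffOn.sum c2) l hu]
  simp only
  rw [dirD_sum hVo _ c2 l hu, dirD_comp_add]
  simp only [dirD_const_mul, taylorRem, taylorPoly, sub_eq_add_neg]
  congr 1
  rw [← Finset.sum_neg_distrib]
  refine Finset.sum_congr rfl fun k _ => ?_
  rw [← dirD_append, ← dirD_append, dirD_perm hU hf List.perm_append_comm (hVU hu)]
  ring

end Taylor

/-! ### Estimates for kernels that are homogeneous up to a logarithm. -/

section Kernels

open scoped ContDiff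

/-- Kernels on `ℝⁿ` that are smooth off the origin and homogeneous of degree `N - n` up to a
logarithmic multiple of a smooth function whose derivatives of order at least `N` vanish. -/
structure LogHomogeneous {n : ℕ} (N : ℕ) (Φ P : Rn n → ℝ) : Prop where
  smooth : ContDiffOn ℝ ∞ Φ {0}ᶜ
  smooth_log : ContDiff ℝ ∞ P
  scale : ∀ t : ℝ, 0 < t → ∀ u : Rn n, u ≠ 0 →
    Φ (t • u) = t ^ ((N : ℤ) - n) * (Φ u + Real.log t * P u)
  vanish : ∀ (l : List (Rn n)) (u : Rn n), N ≤ l.length → dirD l P u = 0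

lemma isOpen_ne_zero {n : ℕ} : IsOpen ({0}ᶜ : Set (Rn n)) := isOpen_compl_singleton

lemma dirD_replicate_smul {E : Type*} [NormedAddCommGroup E] [NormedSpace ℝ E] (f : E → ℝ) (t : ℝ)
    (h : E) (k : ℕ) :
    dirD (List.replicate k (t • h)) f = fun u => t ^ k * dirD (List.replicate k h) f u := by
  induction k with
  | zero => simp
  | succ k ih =>
    simp only [List.replicate_succ, dirD_cons, ih]
    ext u
    rw [show (fun u => t ^ k * dirD (List.replicate k h) f u) =
      t ^ k • dirD (List.replicate k h) f from rfl, fderiv_const_smul_field]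
    simp [pow_succ, mul_assoc, mul_left_comm]

lemma exists_bound_iteratedFDeriv_sphere {n : ℕ} {f : Rn n → ℝ} (hf : ContDiffOn ℝ ∞ f {0}ᶜ)
    (k : ℕ) : ∃ C : ℝ, 0 ≤ C ∧ ∀ l : List (Rn n), l.length = k → ∀ u : Rn n, ‖u‖ = 1 →
      |dirD l f u| ≤ C * (l.map norm).prod := by
  have hc : ContinuousOn (iteratedFDeriv ℝ k f) {0}ᶜ := by
    have h1 := hf.continuousOn_iteratedFDerivWithin (m := k) (by exact_mod_cast le_top)
      isOpen_ne_zero.uniqueDiffOn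
    exact h1.congr fun u hu => (iteratedFDerivWithin_of_isOpen k isOpen_ne_zero hu).symm
  have hs : Metric.sphere (0 : Rn n) 1 ⊆ {0}ᶜ := by
    intro u hu h0
    simp only [Set.mem_singleton_iff] at h0
    simp [h0] at hu
  obtain ⟨C, hC⟩ := (isCompact_sphere (0 : Rn n) 1).exists_bound_of_continuousOn (hc.mono hs)
  refine ⟨max C 0, le_max_right _ _, fun l hl u hu => ?_⟩
  have hu' : u ∈ Metric.sphere (0 : Rn n) 1 := by simpa using hu
  refine (abs_dirD_le isOpen_ne_zero hf l (hs hu')).trans ?_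
  rw [hl]
  refine mul_le_mul_of_nonneg_right ((hC u hu').trans (le_max_left _ _)) ?_
  exact List.prod_nonneg (by simp)

lemma prod_map_norm_nonneg {E : Type*} [NormedAddCommGroup E] (l : List E) :
    0 ≤ (l.map norm).prod := List.prod_nonneg (by simp)

/-- A positive power absorbs the logarithm at 0, where t^ε |log t| < 1/ε for t ≤ 1; for 1 ≤ t ≤ L
the logarithm is at most L. -/
lemma rpow_mul_one_add_abs_log_le {ε L t : ℝ} (hε : 0 < ε) (hL : 0 < L)
    (ht : 0 < t) (htL : t ≤ L) :
    t ^ ε * (1 + |Real.log t|) ≤ L ^ ε * (1 + L) + 1 / ε := by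
  have h1 : t ^ ε ≤ L ^ ε := Real.rpow_le_rpow ht.le htL hε.le
  have h1' : 0 < t ^ ε := Real.rpow_pos_of_pos ht ε
  have h4 : 0 < 1 / ε := by positivity
  rcases le_total t 1 with h | h
  · have h2 := Real.abs_log_mul_self_rpow_lt t ε ht h hε
    rw [abs_mul, abs_of_pos h1'] at h2
    have h3 : 0 < L ^ ε * L := by positivity
    nlinarith
  · have h2 : |Real.log t| ≤ L := by
      rw [abs_of_nonneg (Real.log_nonneg h)]
      have := Real.log_le_sub_one_of_pos ht
      linarith
    have h3 : t ^ ε * (1 + |Real.log t|) ≤ L ^ ε * (1 + L) := by gcongr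
    linarith

namespace LogHomogeneous

variable {n N : ℕ} {Φ P : Rn n → ℝ}

lemma scale_dirD (H : LogHomogeneous N Φ P) {t : ℝ} (ht : 0 < t) {u : Rn n} (hu : u ≠ 0)
    (l : List (Rn n)) :
    t ^ l.length * dirD l Φ (t • u) =
      t ^ ((N : ℤ) - n) * (dirD l Φ u + Real.log t * dirD l P u) := by
  rw [← dirD_comp_smul]
  have h1 : Set.EqOn (fun u => Φ (t • u))
      (fun u => t ^ ((N : ℤ) - n) * (Φ u + Real.log t * P u)) {0}ᶜ := fun u hu => H.scale t ht u hu
  have hP : ContDiffOn ℝ ∞ (fun u => Real.log t * P u) {0}ᶜ :=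
    contDiffOn_const.mul H.smooth_log.contDiffOn
  rw [dirD_congr isOpen_ne_zero h1 l hu, dirD_const_mul]
  simp only
  rw [dirD_add isOpen_ne_zero H.smooth hP l hu, dirD_const_mul]

lemma dirD_eq (H : LogHomogeneous N Φ P) {u : Rn n} (hu : u ≠ 0) (l : List (Rn n)) :
    ‖u‖ ^ l.length * dirD l Φ u = ‖u‖ ^ ((N : ℤ) - n) *
      (dirD l Φ (‖u‖⁻¹ • u) + Real.log ‖u‖ * dirD l P (‖u‖⁻¹ • u)) := by
  have h0 : ‖u‖ ≠ 0 := norm_ne_zero_iff.2 hu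
  have := H.scale_dirD (norm_pos_iff.2 hu) (u := ‖u‖⁻¹ • u) (by simp [hu]) l
  rwa [smul_smul, mul_inv_cancel₀ h0, one_smul] at this

/-- Derivatives of order N + j do not see the logarithmic part, so they are exactly homogeneous of
degree -(n + j), and compactness of the unit sphere bounds them. -/
lemma exists_bound_of_le_length (H : LogHomogeneous N Φ P) (j : ℕ) :
    ∃ C : ℝ, 0 ≤ C ∧ ∀ l : List (Rn n), l.length = N + j → ∀ u : Rn n, u ≠ 0 →
      |dirD l Φ u| ≤ C * (l.map norm).prod / ‖u‖ ^ (n + j) := by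
  obtain ⟨C, hC0, hC⟩ := exists_bound_iteratedFDeriv_sphere H.smooth (N + j)
  refine ⟨C, hC0, fun l hl u hu => ?_⟩
  have h0 : 0 < ‖u‖ := norm_pos_iff.2 hu
  have h1 := H.dirD_eq hu l
  rw [H.vanish l _ (by omega), mul_zero, add_zero, hl] at h1
  have h2 : dirD l Φ u = dirD l Φ (‖u‖⁻¹ • u) / ‖u‖ ^ (n + j) := by
    rw [eq_div_iff (by positivity)]
    have e : ‖u‖ ^ ((N : ℤ) - n) = ‖u‖ ^ N / ‖u‖ ^ n := by
      rw [zpow_sub₀ h0.ne']; simp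
    rw [e] at h1
    field_simp at h1
    rw [one_div] at h1
    rw [pow_add] at h1 ⊢
    have : ‖u‖ ^ N ≠ 0 := by positivity
    apply mul_left_cancel₀ this
    linarith
  rw [h2, abs_div, abs_of_pos (by positivity : 0 < ‖u‖ ^ (n + j))]
  gcongr
  exact hC l hl _ (by simp [norm_smul, h0.ne'])

lemma exists_bound_near (H : LogHomogeneous N Φ P) (k : ℕ) {β L : ℝ} (hβ : (n : ℝ) + k - N < β)
    (hL : 0 < L) :
    ∃ C : ℝ, 0 ≤ C ∧ ∀ l : List (Rn n), l.length = k → ∀ u : Rn n, u ≠ 0 → ‖u‖ ≤ L →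
      |dirD l Φ u| ≤ C * (l.map norm).prod * ‖u‖ ^ (-β) := by
  obtain ⟨C, hC0, hC⟩ := exists_bound_iteratedFDeriv_sphere H.smooth k
  obtain ⟨C', hC0', hC'⟩ := exists_bound_iteratedFDeriv_sphere
    (H.smooth_log.contDiffOn (s := {0}ᶜ)) k
  -- The surplus of β over the order of singularity n + k - N pays for the logarithm.
  set ε : ℝ := N - n - k + β with hεdef
  have hε : 0 < ε := by rw [hεdef]; linarith
  refine ⟨(C + C') * (L ^ ε * (1 + L) + 1 / ε), by positivity, fun l hl u hu huL => ?_⟩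
  have h0 : 0 < ‖u‖ := norm_pos_iff.2 hu
  have h1 := H.dirD_eq hu l
  have hs : ‖‖u‖⁻¹ • u‖ = 1 := by simp [norm_smul, h0.ne']
  have b1 := hC l hl _ hs
  have b2 := hC' l hl _ hs
  have hp := prod_map_norm_nonneg l
  have b3 : |dirD l Φ (‖u‖⁻¹ • u) + Real.log ‖u‖ * dirD l P (‖u‖⁻¹ • u)| ≤
      (C + C') * (l.map norm).prod * (1 + |Real.log ‖u‖|) := by
    refine (abs_add_le _ _).trans ?_
    rw [abs_mul]
    have : |Real.log ‖u‖| * |dirD l P (‖u‖⁻¹ • u)| ≤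
      |Real.log ‖u‖| * (C' * (l.map norm).prod) := by gcongr
    have h5 : 0 ≤ C * (l.map norm).prod * |Real.log ‖u‖| := by positivity
    have h6 : 0 ≤ C' * (l.map norm).prod := by positivity
    nlinarith
  have h2 : dirD l Φ u = ‖u‖ ^ (-β) * (‖u‖ ^ ε *
      (dirD l Φ (‖u‖⁻¹ • u) + Real.log ‖u‖ * dirD l P (‖u‖⁻¹ • u))) := by
    have h3 : ‖u‖ ^ (l.length) ≠ 0 := by positivity
    apply mul_left_cancel₀ h3
    rw [h1, ← mul_assoc, ← mul_assoc]
    congr 1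
    rw [← Real.rpow_natCast, ← Real.rpow_intCast, ← Real.rpow_add h0, ← Real.rpow_add h0]
    congr 1
    push_cast
    rw [hl, hεdef]
    ring
  rw [h2, abs_mul, abs_mul, abs_of_pos (Real.rpow_pos_of_pos h0 _),
    abs_of_pos (Real.rpow_pos_of_pos h0 _), mul_comm]
  refine mul_le_mul_of_nonneg_right ?_ (Real.rpow_pos_of_pos h0 _).le
  calc ‖u‖ ^ ε * |dirD l Φ (‖u‖⁻¹ • u) + Real.log ‖u‖ * dirD l P (‖u‖⁻¹ • u)|
      ≤ ‖u‖ ^ ε * ((C + C') * (l.map norm).prod * (1 + |Real.log ‖u‖|)) := by gcongr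
    _ = (C + C') * (l.map norm).prod * (‖u‖ ^ ε * (1 + |Real.log ‖u‖|)) := by ring
    _ ≤ (C + C') * (l.map norm).prod * (L ^ ε * (1 + L) + 1 / ε) := by
        gcongr
        exact rpow_mul_one_add_abs_log_le hε hL h0 huL
    _ = _ := by ring

/-- `P` behaves like a polynomial of degree below N: its Taylor expansion of order N is exact. -/
lemma taylorRem_log_eq_zero (H : LogHomogeneous N Φ P) (hN : 1 ≤ N) (u h : Rn n) :
    taylorRem N h P u = 0 := by
  have := abs_taylorRem_le isOpen_univ H.smooth_log.contDiffOn (u := u) (h := h)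
    (fun _ _ => Set.mem_univ _) hN (A := 0) (fun t _ => by rw [H.vanish _ _ (by simp)]; simp)
  exact abs_nonpos_iff.1 this

/-- The log t contributions of Φ(u + h) and of its Taylor polynomial cancel because the expansion of
`P` is exact; the remainder is therefore truly homogeneous in (u, h). -/
lemma taylorRem_smul (H : LogHomogeneous N Φ P) (hN : 1 ≤ N) {t : ℝ} (ht : 0 < t) {u h : Rn n}
    (hu : u ≠ 0) (huh : u + h ≠ 0) :
    taylorRem N (t • h) Φ (t • u) = t ^ ((N : ℤ) - n) * taylorRem N h Φ u := by
  have e1 : taylorPoly N (t • h) Φ (t • u) =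
      t ^ ((N : ℤ) - n) * (taylorPoly N h Φ u + Real.log t * taylorPoly N h P u) := by
    simp only [taylorPoly, mul_add, Finset.mul_sum]
    rw [← Finset.sum_add_distrib]
    refine Finset.sum_congr rfl fun k _ => ?_
    rw [dirD_replicate_smul]
    have := H.scale_dirD ht hu (List.replicate k h)
    rw [List.length_replicate] at this
    simp only
    rw [this]
    ring
  have e2 := H.taylorRem_log_eq_zero hN u h
  simp only [taylorRem] at e2 ⊢
  rw [← smul_add, H.scale t ht _ huh, e1, show P (u + h) = taylorPoly N h P u by linarith]
  ring

/-- By homogeneity it suffices to take |h| = 1. There is then no cancellation to exploit: Φ(u + h)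
and each Taylor term are bounded separately. -/
lemma exists_taylorRem_near_bound (H : LogHomogeneous N Φ P) (hN : 1 ≤ N) :
    ∃ C : ℝ, 0 ≤ C ∧ ∀ u h : Rn n, u ≠ 0 → u + h ≠ 0 → h ≠ 0 → ‖u‖ ≤ 2 * ‖h‖ →
      |taylorRem N h Φ u| ≤ C * ‖h‖ ^ ((N : ℝ) - 1 / 2) *
        (‖u‖ ^ (-((n : ℝ) - 1 / 2)) + ‖u + h‖ ^ (-((n : ℝ) - 1 / 2))) := by
  have hb : ∀ k : Fin N, ∃ C : ℝ, 0 ≤ C ∧ ∀ l : List (Rn n), l.length = k → ∀ u : Rn n, u ≠ 0 →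
      ‖u‖ ≤ 3 → |dirD l Φ u| ≤ C * (l.map norm).prod * ‖u‖ ^ (-((n : ℝ) - 1 / 2)) := by
    intro k
    -- Derivatives of order k < N have singularity of order at most n - 1 up to a logarithm, so the
    -- exponent n - 1/2 dominates them and is still locally integrable. The radius 3 accommodates u
    -- and u + h when |u| ≤ 2 and |h| = 1.
    refine H.exists_bound_near k ?_ (by norm_num)
    have : ((k : ℕ) : ℝ) + 1 ≤ N := by exact_mod_cast k.2
    linarith
  choose C hC0 hC using hb
  have hNpos : 0 < N := hN
  set K : ℝ := C ⟨0, hNpos⟩ + ∑ k, C k with hK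
  have hK0 : 0 ≤ ∑ k, C k := Finset.sum_nonneg fun k _ => hC0 k
  have hKp : 0 ≤ K := add_nonneg (hC0 _) hK0
  have unit : ∀ u h : Rn n, u ≠ 0 → u + h ≠ 0 → ‖h‖ = 1 → ‖u‖ ≤ 2 →
      |taylorRem N h Φ u| ≤ K *
        (‖u‖ ^ (-((n : ℝ) - 1 / 2)) + ‖u + h‖ ^ (-((n : ℝ) - 1 / 2))) := by
    intro u h hu huh hh hu2
    have p1 : 0 ≤ ‖u‖ ^ (-((n : ℝ) - 1 / 2)) := Real.rpow_nonneg (norm_nonneg _) _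
    have p2 : 0 ≤ ‖u + h‖ ^ (-((n : ℝ) - 1 / 2)) := Real.rpow_nonneg (norm_nonneg _) _
    have b1 : |Φ (u + h)| ≤ C ⟨0, hNpos⟩ * ‖u + h‖ ^ (-((n : ℝ) - 1 / 2)) := by
      have := hC ⟨0, hNpos⟩ [] rfl (u + h) huh ((norm_add_le _ _).trans (by linarith))
      simpa using this
    have b2 : |taylorPoly N h Φ u| ≤ (∑ k, C k) * ‖u‖ ^ (-((n : ℝ) - 1 / 2)) := by
      rw [taylorPoly, Finset.sum_range, Finset.sum_mul]
      refine (Finset.abs_sum_le_sum_abs _ _).trans (Finset.sum_le_sum fun k _ => ?_)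
      have := hC k (List.replicate k h) (by simp) u hu (by linarith)
      rw [List.map_replicate, hh, List.prod_replicate, one_pow, mul_one] at this
      rw [abs_mul, abs_of_pos (by positivity)]
      refine (mul_le_of_le_one_left (abs_nonneg _) ?_).trans this
      exact inv_le_one_of_one_le₀ (Nat.one_le_cast.2 (Nat.factorial_pos _))
    calc |taylorRem N h Φ u| ≤ |Φ (u + h)| + |taylorPoly N h Φ u| := abs_sub _ _
      _ ≤ _ := add_le_add b1 b2
      _ ≤ _ := by
        have q1 := mul_nonneg (hC0 ⟨0, hNpos⟩) p1
        have q2 := mul_nonneg hK0 p2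
        rw [hK]
        nlinarith
  refine ⟨K, hKp, fun u h hu huh hh hu2 => ?_⟩
  have h0 : 0 < ‖h‖ := norm_pos_iff.2 hh
  have hi : 0 < ‖h‖⁻¹ := by positivity
  have key := unit (‖h‖⁻¹ • u) (‖h‖⁻¹ • h) (by simp [hu, hh])
    (by rw [← smul_add]; exact smul_ne_zero hi.ne' huh) (by simp [norm_smul, h0.ne']) (by
      rw [norm_smul, norm_inv, norm_norm, inv_mul_le_iff₀ h0]; linarith)
  have e1 := H.taylorRem_smul hN h0 (u := ‖h‖⁻¹ • u) (h := ‖h‖⁻¹ • h) (by simp [hu, hh])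
    (by rw [← smul_add]; exact smul_ne_zero hi.ne' huh)
  rw [smul_smul, smul_smul, mul_inv_cancel₀ h0.ne', one_smul, one_smul] at e1
  rw [e1, abs_mul, abs_of_pos (zpow_pos h0 _)]
  rw [← smul_add, norm_smul, norm_smul, norm_inv, norm_norm,
    Real.mul_rpow hi.le (norm_nonneg _), Real.mul_rpow hi.le (norm_nonneg _), ← mul_add] at key
  calc _ ≤ ‖h‖ ^ ((N : ℤ) - n) * (K * (‖h‖⁻¹ ^ (-((n : ℝ) - 1 / 2)) *
        (‖u‖ ^ (-((n : ℝ) - 1 / 2)) + ‖u + h‖ ^ (-((n : ℝ) - 1 / 2))))) := by gcongr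
    _ = K * (‖h‖ ^ ((N : ℤ) - n) * ‖h‖⁻¹ ^ (-((n : ℝ) - 1 / 2))) *
        (‖u‖ ^ (-((n : ℝ) - 1 / 2)) + ‖u + h‖ ^ (-((n : ℝ) - 1 / 2))) := by ring
    _ = _ := by
      congr 2
      rw [Real.inv_rpow h0.le, ← Real.rpow_neg h0.le, ← Real.rpow_intCast, ← Real.rpow_add h0]
      congr 1
      push_cast
      ring

/-- When 2|h| ≤ |u|, the segment from u to u + h stays at distance |u|/2 from the origin, where the
derivatives of total order M + k = N + j are controlled. -/
lemma exists_taylorRem_far_bound (H : LogHomogeneous N Φ P) {M k j : ℕ} (hM : 1 ≤ M)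
    (hj : M + k = N + j) :
    ∃ C : ℝ, 0 ≤ C ∧ ∀ (l : List (Rn n)) (u h : Rn n), l.length = k → u ≠ 0 → 2 * ‖h‖ ≤ ‖u‖ →
      |taylorRem M h (dirD l Φ) u| ≤ C * (l.map norm).prod * ‖h‖ ^ M / ‖u‖ ^ (n + j) := by
  obtain ⟨C, hC0, hC⟩ := H.exists_bound_of_le_length j
  refine ⟨C * 2 ^ (n + j), by positivity, fun l u h hl hu hh => ?_⟩
  have h0 : 0 < ‖u‖ := norm_pos_iff.2 hu
  have hp := prod_map_norm_nonneg l
  have hseg : ∀ t ∈ Set.Icc (0 : ℝ) 1, ‖u‖ / 2 ≤ ‖u + t • h‖ := by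
    intro t ht
    have h1 : ‖t • h‖ ≤ ‖h‖ := by
      rw [norm_smul, Real.norm_eq_abs, abs_of_nonneg ht.1]
      exact mul_le_of_le_one_left (norm_nonneg _) ht.2
    have h2 : ‖u‖ ≤ ‖u + t • h‖ + ‖t • h‖ := by
      simpa using norm_sub_le (u + t • h) (t • h)
    linarith
  have hne : ∀ t ∈ Set.Icc (0 : ℝ) 1, u + t • h ∈ ({0}ᶜ : Set (Rn n)) := by
    intro t ht h3
    have := hseg t ht
    rw [Set.mem_singleton_iff.1 h3, norm_zero] at this
    linarith
  refine abs_taylorRem_le isOpen_ne_zero (dirD_contDiffOn isOpen_ne_zero H.smooth l) hne hM ?_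
  intro t ht
  rw [← dirD_append]
  refine (hC _ (by simp; omega) _ (hne t ht)).trans ?_
  have e : ((List.replicate M h ++ l).map norm).prod = (l.map norm).prod * ‖h‖ ^ M := by
    simp [mul_comm]
  rw [e, ← mul_assoc]
  calc _ ≤ C * (l.map norm).prod * ‖h‖ ^ M / (‖u‖ / 2) ^ (n + j) := by
        gcongr
        exact hseg t ht
    _ = _ := by
        rw [div_pow]
        field_simp

/-- Directional derivatives commute with taking remainders, so N derivatives along w of the
remainder in h form a remainder of an N-th derivative of Φ; in all 2N derivatives are spent. -/
lemma exists_taylorRem_taylorRem_bound (H : LogHomogeneous N Φ P) (hN : 1 ≤ N) :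
    ∃ C : ℝ, 0 ≤ C ∧ ∀ u h w : Rn n, u ≠ 0 → 4 * ‖h‖ ≤ ‖u‖ → 4 * ‖w‖ ≤ ‖u‖ →
      |taylorRem N w (taylorRem N h Φ) u| ≤ C * ‖h‖ ^ N * ‖w‖ ^ N / ‖u‖ ^ (n + N) := by
  obtain ⟨C, hC0, hC⟩ := H.exists_taylorRem_far_bound (M := N) (k := N) (j := N) hN rfl
  refine ⟨C * 2 ^ (n + N), by positivity, fun u h w hu hh hw => ?_⟩
  have h0 : 0 < ‖u‖ := norm_pos_iff.2 hu
  -- On this ball |v| ≥ 5/8 |u| ≥ 2|h|, so the inner remainder is smooth and the previous bound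
  -- applies; the segment to u + w lies in it because |w| ≤ |u|/4.
  set V : Set (Rn n) := Metric.ball u (3 / 8 * ‖u‖) with hV
  have hVn : ∀ v ∈ V, 5 / 8 * ‖u‖ ≤ ‖v‖ := by
    intro v hv
    rw [hV, mem_ball_iff_norm'] at hv
    have : ‖u‖ ≤ ‖u - v‖ + ‖v‖ := by simpa using norm_add_le (u - v) v
    linarith
  have hVU : V ⊆ {0}ᶜ := by
    intro v hv h3
    have := hVn v hv
    rw [Set.mem_singleton_iff.1 h3, norm_zero] at this
    linarith
  have hVh : ∀ v ∈ V, v + h ∈ ({0}ᶜ : Set (Rn n)) := by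
    intro v hv h3
    have h1 := hVn v hv
    rw [Set.mem_singleton_iff, add_eq_zero_iff_eq_neg] at h3
    rw [h3, norm_neg] at h1
    linarith
  have hseg : ∀ t ∈ Set.Icc (0 : ℝ) 1, u + t • w ∈ V := by
    intro t ht
    have h1 : ‖t • w‖ ≤ ‖w‖ := by
      rw [norm_smul, Real.norm_eq_abs, abs_of_nonneg ht.1]
      exact mul_le_of_le_one_left (norm_nonneg _) ht.2
    rw [hV, mem_ball_iff_norm, add_sub_cancel_left]
    linarith
  refine abs_taylorRem_le Metric.isOpen_ball
    (taylorRem_contDiffOn isOpen_ne_zero H.smooth N hVU hVh) hseg hN ?_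
  intro t ht
  have hv := hVn _ (hseg t ht)
  rw [dirD_taylorRem isOpen_ne_zero Metric.isOpen_ball H.smooth N hVU hVh _ (hseg t ht)]
  refine (hC _ _ _ (by simp) (hVU (hseg t ht)) (by linarith)).trans ?_
  rw [List.map_replicate, List.prod_replicate]
  calc _ ≤ C * ‖w‖ ^ N * ‖h‖ ^ N / (‖u‖ / 2) ^ (n + N) := by
        gcongr
        linarith
    _ = _ := by
        rw [div_pow]
        field_simp

end LogHomogeneous

end Kernels

/-! ### The fundamental solution of Δ^m as a kernel of this type. -/

section FundamentalSolution

open scoped ContDiff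

/-- The standard basis vectors of `ℝⁿ`. -/
def stdVec {n : ℕ} (i : Fin n) : Rn n := EuclideanSpace.single i 1

lemma sum_smul_stdVec {n : ℕ} (h : Rn n) : ∑ i, h i • stdVec i = h := by
  ext j
  simp [stdVec, Pi.single_apply]

/-- Multilinear expansion in the standard basis. Summing over sequences of indices instead of
multiindices avoids multinomial coefficients. -/
lemma dirD_replicate_eq_sum {n : ℕ} {U : Set (Rn n)} (hU : IsOpen U) {f : Rn n → ℝ}
    (hf : ContDiffOn ℝ ∞ f U) (k : ℕ) (h : Rn n) {u : Rn n} (hu : u ∈ U) :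
    dirD (List.replicate k h) f u =
      ∑ I : Fin k → Fin n, (∏ j, h (I j)) * dirD (List.ofFn fun j => stdVec (I j)) f u := by
  rw [← List.ofFn_const, dirD_ofFn_eq_iteratedFDeriv hU hf _ hu]
  conv_lhs => rw [← sum_smul_stdVec h]
  rw [ContinuousMultilinearMap.map_sum]
  refine Finset.sum_congr rfl fun I _ => ?_
  rw [dirD_ofFn_eq_iteratedFDeriv hU hf _ hu, ContinuousMultilinearMap.map_smul_univ, smul_eq_mul]

lemma foldr_partialD_eqOn {n : ℕ} {U : Set (Rn n)} (hU : IsOpen U) {f : Rn n → ℝ}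
    (hf : ContDiffOn ℝ ∞ f U) (α : Fin n → ℕ) (L : List (Fin n)) :
    Set.EqOn (L.foldr (fun i g => (partialD i)^[α i] g) f)
      (dirD (L.flatMap fun i => List.replicate (α i) (stdVec i)) f) U := by
  have step : ∀ (i : Fin n) (g : Rn n → ℝ) (l : List (Rn n)), Set.EqOn g (dirD l f) U →
      Set.EqOn (partialD i g) (dirD (stdVec i :: l) f) U := by
    intro i g l h u hu
    have he : g =ᶠ[𝓝 u] dirD l f := h.eventuallyEq_of_mem (hU.mem_nhds hu)
    have hd : DifferentiableAt ℝ (dirD l f) u :=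
      ((dirD_contDiffOn hU hf l).contDiffAt (hU.mem_nhds hu)).differentiableAt (by simp)
    rw [partialD, (he.differentiableAt_iff.2 hd).lineDeriv_eq_fderiv, he.fderiv_eq]
    rfl
  have steps : ∀ (i : Fin n) (k : ℕ) (g : Rn n → ℝ) (l : List (Rn n)), Set.EqOn g (dirD l f) U →
      Set.EqOn ((partialD i)^[k] g) (dirD (List.replicate k (stdVec i) ++ l) f) U := by
    intro i k g l h
    induction k with
    | zero => exact h
    | succ k ih =>
      rw [Function.iterate_succ_apply', List.replicate_succ, List.cons_append]
      exact step _ _ _ ih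
  induction L with
  | nil => exact fun _ _ => rfl
  | cons i L ih =>
    rw [List.foldr_cons, List.flatMap_cons]
    exact steps _ _ _ _ ih

/-- The multiindex of a sequence of indices. -/
def multiIndex {n k : ℕ} (I : Fin k → Fin n) (i : Fin n) : ℕ := (List.ofFn I).count i

lemma multiIndex_mem_piAntidiag {n k : ℕ} (I : Fin k → Fin n) :
    multiIndex I ∈ Finset.piAntidiag (Finset.univ : Finset (Fin n)) k := by
  rw [Finset.mem_piAntidiag]
  refine ⟨?_, fun i _ => Finset.mem_univ i⟩
  have := Multiset.sum_count_eq_card (s := Finset.univ) (m := (List.ofFn I : Multiset (Fin n)))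
    (fun a _ => Finset.mem_univ a)
  change ∑ i, (List.ofFn I).count i = k
  simpa using this

/-- Both sides differentiate along the same basis vectors in a different order; this links sequences
of indices to the derivatives ∂^α in `maxSingular`. -/
lemma multiD_multiIndex {n k : ℕ} {U : Set (Rn n)} (hU : IsOpen U) {f : Rn n → ℝ}
    (hf : ContDiffOn ℝ ∞ f U) (I : Fin k → Fin n) :
    Set.EqOn (multiD (multiIndex I) f) (dirD (List.ofFn fun j => stdVec (I j)) f) U := by
  have hp : ((List.finRange n).flatMap fun i => List.replicate (multiIndex I i) i).Perm
      (List.ofFn I) := by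
    rw [List.perm_iff_count]
    intro i
    rw [List.count_flatMap]
    have : (List.count i ∘ fun j => List.replicate (multiIndex I j) j) =
        fun j => if j = i then multiIndex I i else 0 := by
      ext j
      simp only [Function.comp, List.count_replicate]
      by_cases h : j = i <;> simp [h]
    rw [this, ← List.ofFn_eq_map, List.sum_ofFn]
    simp [multiIndex]
  have hp' := hp.map (stdVec (n := n))
  rw [List.map_flatMap, List.map_ofFn] at hp'
  simp only [List.map_replicate] at hp'
  exact (foldr_partialD_eqOn hU hf _ _).trans (dirD_perm hU hf hp')

/-- The logarithmic part of the fundamental solution. -/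
def fundLog (n m : ℕ) (x : Rn n) : ℝ :=
  if Even n ∧ n ≤ 2 * m then fundConst n m * (‖x‖ ^ 2) ^ (m - n / 2) else 0

/-- A derivative of order above d is homogeneous of negative degree, yet continuous at the origin;
letting t → 0 forces it to vanish. -/
lemma dirD_eq_zero_of_homogeneous {n d : ℕ} {f : Rn n → ℝ} (hf : ContDiff ℝ ∞ f)
    (hh : ∀ t : ℝ, 0 < t → ∀ u, f (t • u) = t ^ d * f u) (l : List (Rn n)) (u : Rn n)
    (hl : d < l.length) : dirD l f u = 0 := by
  have h1 : ∀ t : ℝ, 0 < t → t ^ (l.length - d) * dirD l f (t • u) = dirD l f u := by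
    intro t ht
    have e := dirD_comp_smul f t l u
    rw [show (fun x => f (t • x)) = fun x => t ^ d * f x from funext fun x => hh t ht x,
      dirD_const_mul] at e
    have : t ^ l.length = t ^ d * t ^ (l.length - d) := by rw [← pow_add]; congr 1; omega
    rw [this, mul_assoc] at e
    exact (mul_left_cancel₀ (pow_pos ht d).ne' e).symm
  have hc : Continuous (dirD l f) :=
    continuousOn_univ.1 (dirD_contDiffOn isOpen_univ hf.contDiffOn l).continuousOn
  have h2 : Tendsto (fun t : ℝ => t ^ (l.length - d) * dirD l f (t • u)) (𝓝[>] 0) (𝓝 0) := by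
    have : Continuous fun t : ℝ => t ^ (l.length - d) * dirD l f (t • u) := by fun_prop
    have h3 := this.tendsto 0
    rw [zero_pow (by omega), zero_mul] at h3
    exact h3.mono_left nhdsWithin_le_nhds
  have h4 : Tendsto (fun t : ℝ => t ^ (l.length - d) * dirD l f (t • u)) (𝓝[>] 0)
      (𝓝 (dirD l f u)) :=
    tendsto_const_nhds.congr' (eventually_of_mem self_mem_nhdsWithin fun t ht => (h1 t ht).symm)
  exact tendsto_nhds_unique h4 h2

lemma fundSol_logHomogeneous (n m : ℕ) (hn : 1 ≤ n) :
    LogHomogeneous (2 * m) (fundSol n m) (fundLog n m) := by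
  have hnorm : ContDiffOn ℝ ∞ (fun u : Rn n => ‖u‖) {0}ᶜ := fun u hu =>
    (contDiffAt_norm ℝ hu).contDiffWithinAt
  have hz : ContDiffOn ℝ ∞ (fun u : Rn n => ‖u‖ ^ (2 * (m : ℤ) - (n : ℤ))) {0}ᶜ := by
    have : ContDiffOn ℝ ∞ (fun u : Rn n => ‖u‖ ^ ((2 * (m : ℤ) - (n : ℤ) : ℤ) : ℝ)) {0}ᶜ :=
      hnorm.rpow_const_of_ne fun u hu => norm_ne_zero_iff.2 hu
    exact this.congr fun u _ => (Real.rpow_intCast _ _).symm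
  have hscale : ∀ t : ℝ, 0 < t → ∀ u : Rn n, ‖t • u‖ ^ (2 * (m : ℤ) - (n : ℤ)) =
      t ^ (2 * (m : ℤ) - (n : ℤ)) * ‖u‖ ^ (2 * (m : ℤ) - (n : ℤ)) := by
    intro t ht u
    rw [norm_smul, Real.norm_eq_abs, abs_of_pos ht, mul_zpow]
  by_cases hc : Even n ∧ n ≤ 2 * m
  · obtain ⟨⟨j, hj⟩, hnm⟩ := id hc
    have eS : fundSol n m = fun x =>
        fundConst n m * ‖x‖ ^ (2 * (m : ℤ) - (n : ℤ)) * Real.log ‖x‖ := by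
      ext x; rw [fundSol, if_pos hc]
    have eL : fundLog n m = fun x => fundConst n m * (‖x‖ ^ 2) ^ (m - n / 2) := by
      ext x; rw [fundLog, if_pos hc]
    have sL : ContDiff ℝ ∞ (fundLog n m) := by
      rw [eL]; exact contDiff_const.mul ((contDiff_norm_sq ℝ).pow _)
    refine ⟨?_, sL, ?_, ?_⟩
    · rw [eS]
      exact (contDiffOn_const.mul hz).mul (hnorm.log fun u hu => norm_ne_zero_iff.2 hu)
    · intro t ht u hu
      have e : (‖u‖ ^ 2) ^ (m - n / 2) = ‖u‖ ^ (2 * (m : ℤ) - (n : ℤ)) := by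
        rw [← pow_mul, ← zpow_natCast]
        congr 1
        push_cast [show n / 2 ≤ m by omega]
        omega
      simp only [eS, eL, e, hscale t ht u, Nat.cast_mul, Nat.cast_ofNat]
      rw [norm_smul, Real.norm_eq_abs, abs_of_pos ht, Real.log_mul ht.ne' (norm_ne_zero_iff.2 hu)]
      ring
    · intro l u hl
      -- For even n this degree is 2m - n, which is below 2m because n ≥ 1.
      refine dirD_eq_zero_of_homogeneous (d := 2 * (m - n / 2)) sL ?_ l u (by omega)
      intro t ht u
      rw [eL]
      simp only
      rw [norm_smul, Real.norm_eq_abs, abs_of_pos ht, mul_pow, mul_pow, ← pow_mul t]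
      ring
  · have eS : fundSol n m = fun x => fundConst n m * ‖x‖ ^ (2 * (m : ℤ) - (n : ℤ)) := by
      ext x; rw [fundSol, if_neg hc]
    have eL : fundLog n m = fun x => 0 := by
      ext x; rw [fundLog, if_neg hc]
    refine ⟨?_, ?_, ?_, ?_⟩
    · rw [eS]
      exact contDiffOn_const.mul hz
    · rw [eL]; exact contDiff_const
    · intro t ht u hu
      simp only [eS, eL, hscale t ht u, Nat.cast_mul, Nat.cast_ofNat]
      ring
    · intro l u _
      rw [eL]
      have := congrFun (dirD_const_mul 0 (fun _ : Rn n => (0 : ℝ)) l) u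
      simpa using this

end FundamentalSolution

/-! ### Cubes, and integrals of powers against the maximal function. -/

section MaximalFunction

variable {n : ℕ}

lemma cube_eq_preimage (z : Rn n) (r : ℝ) :
    cube z r = (WithLp.ofLp : Rn n → Fin n → ℝ) ⁻¹'
      Set.Icc (fun i => z i - r / 2) (fun i => z i + r / 2) := by
  ext y
  simp only [cube, Set.mem_ofPred_eq, Set.mem_preimage, Set.mem_Icc, Pi.le_def, abs_le,
    ← forall_and]
  refine forall_congr' fun i => ?_
  constructor <;> rintro ⟨h1, h2⟩ <;> constructor <;> linarith

lemma isClosed_cube (z : Rn n) (r : ℝ) : IsClosed (cube z r) := by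
  rw [cube_eq_preimage]
  exact isClosed_Icc.preimage (PiLp.continuous_ofLp 2 _)

lemma measurableSet_cube (z : Rn n) (r : ℝ) : MeasurableSet (cube z r) :=
  (isClosed_cube z r).measurableSet

lemma volume_cube (z : Rn n) {r : ℝ} (hr : 0 ≤ r) :
    volume (cube z r) = ENNReal.ofReal (r ^ n) := by
  rw [cube_eq_preimage, (PiLp.volume_preserving_ofLp (Fin n)).measure_preimage
    measurableSet_Icc.nullMeasurableSet, Real.volume_Icc_pi]
  simp [ENNReal.ofReal_pow hr]

lemma volume_cube_ne_zero (z : Rn n) {r : ℝ} (hr : 0 < r) : volume (cube z r) ≠ 0 := by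
  rw [volume_cube z hr.le]; simp only [ne_eq, ENNReal.ofReal_eq_zero, not_le]; positivity

lemma volume_cube_ne_top (z : Rn n) {r : ℝ} (hr : 0 < r) : volume (cube z r) ≠ ∞ := by
  rw [volume_cube z hr.le]; exact ENNReal.ofReal_ne_top

lemma abs_apply_le_norm (v : Rn n) (i : Fin n) : |v i| ≤ ‖v‖ := by
  simpa using PiLp.norm_apply_le v i

lemma mem_cube_of_norm_le {y z : Rn n} {R : ℝ} (h : ‖y - z‖ ≤ R) : y ∈ cube z (2 * R) := by
  intro i
  have := abs_apply_le_norm (y - z) i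
  simp only [PiLp.sub_apply] at this
  linarith

lemma norm_le_of_mem_cube {y z : Rn n} {r : ℝ} (hr : 0 ≤ r) (h : y ∈ cube z r) :
    ‖y - z‖ ≤ Real.sqrt n * r / 2 := by
  have h1 : ‖y - z‖ ^ 2 ≤ n * (r / 2) ^ 2 := by
    rw [EuclideanSpace.norm_sq_eq]
    calc ∑ i, ‖(y - z) i‖ ^ 2 ≤ ∑ _i : Fin n, (r / 2) ^ 2 := by
          refine Finset.sum_le_sum fun i _ => ?_
          have := h i
          rw [Real.norm_eq_abs]
          exact pow_le_pow_left₀ (abs_nonneg _) (by simpa using this) 2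
      _ = _ := by simp
  have h2 : (Real.sqrt n * r / 2) ^ 2 = n * (r / 2) ^ 2 := by
    rw [mul_div_assoc, mul_pow, Real.sq_sqrt (Nat.cast_nonneg n)]
  rw [← h2] at h1
  exact le_of_sq_le_sq h1 (by positivity)

lemma isCompact_cube (z : Rn n) {r : ℝ} (hr : 0 ≤ r) : IsCompact (cube z r) := by
  refine (isCompact_closedBall z (Real.sqrt n * r / 2)).of_isClosed_subset (isClosed_cube z r) ?_
  intro y hy
  rw [mem_closedBall_iff_norm]
  exact norm_le_of_mem_cube hr hy

lemma mem_cube_self (z : Rn n) {r : ℝ} (hr : 0 ≤ r) : z ∈ cube z r := by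
  intro i; simp; linarith

lemma avg_le_maximal (f : Rn n → ℝ≥0∞) {x z : Rn n} {r : ℝ} (hr : 0 < r) (hx : x ∈ cube z r) :
    avg (cube z r) f ≤ maximal f x :=
  le_iSup_of_le z (le_iSup_of_le r (le_iSup_of_le hr (le_iSup_of_le hx le_rfl)))

lemma lintegral_cube_eq (f : Rn n → ℝ≥0∞) (z : Rn n) {r : ℝ} (hr : 0 < r) :
    ∫⁻ y in cube z r, f y = ENNReal.ofReal (r ^ n) * avg (cube z r) f := by
  rw [avg, ← mul_assoc, ← volume_cube z hr.le,
    ENNReal.mul_inv_cancel (volume_cube_ne_zero z hr) (volume_cube_ne_top z hr), one_mul]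

lemma lintegral_closedBall_le (f : Rn n → ℝ≥0∞) (y : Rn n) {R : ℝ} (hR : 0 < R) :
    ∫⁻ z in Metric.closedBall y R, f z ≤ ENNReal.ofReal ((2 * R) ^ n) * maximal f y := by
  have h2R : 0 < 2 * R := by linarith
  calc ∫⁻ z in Metric.closedBall y R, f z ≤ ∫⁻ z in cube y (2 * R), f z :=
        lintegral_mono_set fun z hz => mem_cube_of_norm_le (mem_closedBall_iff_norm.1 hz)
    _ = ENNReal.ofReal ((2 * R) ^ n) * avg (cube y (2 * R)) f := lintegral_cube_eq f y h2R
    _ ≤ _ := by gcongr; exact avg_le_maximal f h2R (mem_cube_self y h2R.le)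

lemma avg_le_of_le (f : Rn n → ℝ≥0∞) (c : ℝ≥0∞) (z : Rn n) {r : ℝ} (hr : 0 < r)
    (h : ∀ y ∈ cube z r, f y ≤ c) : avg (cube z r) f ≤ c := by
  have h1 : ∫⁻ y in cube z r, f y ≤ c * volume (cube z r) := by
    rw [← setLIntegral_const]
    exact setLIntegral_mono' (measurableSet_cube z r) h
  calc avg (cube z r) f ≤ (volume (cube z r))⁻¹ * (c * volume (cube z r)) := by
        rw [avg]; gcongr
    _ = c * ((volume (cube z r))⁻¹ * volume (cube z r)) := by ring
    _ = c := by
        rw [ENNReal.inv_mul_cancel (volume_cube_ne_zero z hr) (volume_cube_ne_top z hr), mul_one]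

lemma maximal_le_of_le (f : Rn n → ℝ≥0∞) (c : ℝ≥0∞) (h : ∀ y, f y ≤ c) (x : Rn n) :
    maximal f x ≤ c :=
  iSup_le fun z => iSup_le fun _ => iSup_le fun hr => iSup_le fun _ =>
    avg_le_of_le f c z hr fun y _ => h y

/-- A kernel dominated by a sum of multiples of indicators of balls centred at y is controlled by
Mf(y), ball by ball. The two power kernels below use dyadic radii, for which the sum is geometric.
-/
lemma lintegral_kernel_mul_le {f : Rn n → ℝ≥0∞} (hf : AEMeasurable f volume) (y : Rn n)
    {K : Rn n → ℝ≥0∞} {c ρ : ℕ → ℝ} (hc : ∀ k, 0 ≤ c k) (hρ : ∀ k, 0 < ρ k)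
    (hK : ∀ z, K z ≤ ∑' k, (Metric.closedBall y (ρ k)).indicator
      (fun _ => ENNReal.ofReal (c k)) z) :
    ∫⁻ z, K z * f z ≤ (∑' k, ENNReal.ofReal (c k * (2 * ρ k) ^ n)) * maximal f y := by
  calc ∫⁻ z, K z * f z ≤ ∫⁻ z, ∑' k, (Metric.closedBall y (ρ k)).indicator
        (fun z => ENNReal.ofReal (c k) * f z) z := by
        refine lintegral_mono fun z => ?_
        refine (mul_le_mul_left (hK z) (f z)).trans ?_
        rw [← ENNReal.tsum_mul_right]
        refine ENNReal.tsum_le_tsum fun k => ?_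
        by_cases h : z ∈ Metric.closedBall y (ρ k) <;> simp [h]
    _ = ∑' k, ∫⁻ z in Metric.closedBall y (ρ k), ENNReal.ofReal (c k) * f z := by
        rw [lintegral_tsum fun k => (hf.const_mul _).indicator measurableSet_closedBall]
        exact tsum_congr fun k => lintegral_indicator measurableSet_closedBall _
    _ ≤ ∑' k, ENNReal.ofReal (c k * (2 * ρ k) ^ n) * maximal f y := by
        refine ENNReal.tsum_le_tsum fun k => ?_
        rw [lintegral_const_mul'' _ hf.restrict, ENNReal.ofReal_mul (hc k), mul_assoc]
        gcongr
        exact lintegral_closedBall_le f y (hρ k)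
    _ = _ := ENNReal.tsum_mul_right

lemma tsum_ofReal_geometric_le {A q : ℝ} (hA : 0 ≤ A) (hq0 : 0 ≤ q) (hq : q < 1) :
    ∑' k : ℕ, ENNReal.ofReal (A * q ^ k) = ENNReal.ofReal (A * (1 - q)⁻¹) := by
  rw [← ENNReal.ofReal_tsum_of_nonneg (fun k => by positivity)
    ((summable_geometric_of_lt_one hq0 hq).mul_left A), tsum_mul_left,
    tsum_geometric_of_lt_one hq0 hq]

/-- A locally integrable power is controlled on a ball by the maximal function. -/
lemma exists_lintegral_near_le {β : ℝ} (hβ0 : 0 < β) (hβ : β < n) :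
    ∃ C : ℝ, 0 ≤ C ∧ ∀ f : Rn n → ℝ≥0∞, AEMeasurable f volume → ∀ (y : Rn n) (R : ℝ), 0 < R →
      ∫⁻ z in Metric.closedBall y R, ENNReal.ofReal (‖z - y‖ ^ (-β)) * f z ≤
        ENNReal.ofReal (C * R ^ ((n : ℝ) - β)) * maximal f y := by
  set q : ℝ := (1 / 2) ^ ((n : ℝ) - β) with hq
  have hq0 : 0 ≤ q := by positivity
  have hq1 : q < 1 := Real.rpow_lt_one (by norm_num) (by norm_num) (by linarith)
  refine ⟨2 ^ β * 2 ^ n * (1 - q)⁻¹, mul_nonneg (by positivity) (inv_nonneg.2 (by linarith)),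
    fun f hf y R hR => ?_⟩
  have key := lintegral_kernel_mul_le hf y
    (K := (Metric.closedBall y R).indicator fun z => ENNReal.ofReal (‖z - y‖ ^ (-β)))
    (c := fun k => (R * (1 / 2) ^ (k + 1)) ^ (-β)) (ρ := fun k => R * (1 / 2) ^ k)
    (fun k => by positivity) (fun k => by positivity) (by
      intro z
      by_cases hz : z ∈ Metric.closedBall y R
      · rw [Set.indicator_of_mem hz]
        rcases eq_or_ne z y with rfl | hzy
        -- At the centre the real power 0^(-β) is 0 by convention.
        · simp [Real.zero_rpow (neg_ne_zero.2 hβ0.ne')]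
        have hv : 0 < ‖z - y‖ := norm_pos_iff.2 (sub_ne_zero.2 hzy)
        obtain ⟨k, hk1, hk2⟩ := exists_nat_pow_near_of_lt_one (x := ‖z - y‖ / R)
          (y := (1 / 2 : ℝ)) (by positivity)
          ((div_le_one hR).2 (mem_closedBall_iff_norm.1 hz)) (by norm_num) (by norm_num)
        rw [lt_div_iff₀ hR, mul_comm] at hk1
        rw [div_le_iff₀ hR, mul_comm] at hk2
        refine le_trans ?_ (ENNReal.le_tsum k)
        rw [Set.indicator_of_mem (mem_closedBall_iff_norm.2 hk2)]
        exact ENNReal.ofReal_le_ofReal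
          (Real.rpow_le_rpow_of_nonpos (by positivity) hk1.le (by linarith))
      · rw [Set.indicator_of_notMem hz]; exact zero_le)
  have e1 : ∫⁻ z in Metric.closedBall y R, ENNReal.ofReal (‖z - y‖ ^ (-β)) * f z =
      ∫⁻ z, (Metric.closedBall y R).indicator (fun z => ENNReal.ofReal (‖z - y‖ ^ (-β))) z
        * f z := by
    rw [← lintegral_indicator measurableSet_closedBall]
    refine lintegral_congr fun z => ?_
    by_cases h : z ∈ Metric.closedBall y R <;> simp [h]
  rw [e1]
  refine key.trans_eq ?_
  congr 1
  have e2 : ∀ k : ℕ, (R * (1 / 2) ^ (k + 1)) ^ (-β) * (2 * (R * (1 / 2) ^ k)) ^ n =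
      (2 ^ β * 2 ^ n * R ^ ((n : ℝ) - β)) * q ^ k := by
    intro k
    have h2 : (0 : ℝ) < (1 / 2) ^ k := by positivity
    have e3 : q ^ k = ((1 / 2 : ℝ) ^ k) ^ n * ((1 / 2 : ℝ) ^ k) ^ (-β) := by
      rw [hq, ← Real.rpow_natCast (((1 / 2 : ℝ)) ^ k) n, ← Real.rpow_add h2,
        ← Real.rpow_natCast _ k, ← Real.rpow_natCast _ k, ← Real.rpow_mul (by norm_num),
        ← Real.rpow_mul (by norm_num)]
      congr 1; ring
    have e4 : R ^ ((n : ℝ) - β) = R ^ n * R ^ (-β) := by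
      rw [sub_eq_add_neg, Real.rpow_add hR, Real.rpow_natCast]
    have e5 : (2 : ℝ) ^ β = (1 / 2 : ℝ) ^ (-β) := by
      rw [one_div, Real.inv_rpow (by norm_num), Real.rpow_neg (by norm_num), inv_inv]
    rw [pow_succ, Real.mul_rpow hR.le (by positivity), Real.mul_rpow h2.le (by norm_num),
      e3, e4, e5]
    ring
  simp only [e2]
  rw [tsum_ofReal_geometric_le (by positivity) hq0 hq1]
  congr 1; ring

/-- A power integrable at infinity is controlled off a ball by the maximal function. -/
lemma exists_lintegral_far_le {β : ℝ} (hβ : (n : ℝ) < β) :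
    ∃ C : ℝ, 0 ≤ C ∧ ∀ f : Rn n → ℝ≥0∞, AEMeasurable f volume → ∀ (y : Rn n) (R : ℝ), 0 < R →
      ∫⁻ z in {z | R ≤ ‖z - y‖}, ENNReal.ofReal (‖z - y‖ ^ (-β)) * f z ≤
        ENNReal.ofReal (C * R ^ ((n : ℝ) - β)) * maximal f y := by
  have hβ0 : 0 < β := lt_of_le_of_lt (Nat.cast_nonneg n) hβ
  set q : ℝ := 2 ^ ((n : ℝ) - β) with hq
  have hq0 : 0 ≤ q := by positivity
  have hq1 : q < 1 := Real.rpow_lt_one_of_one_lt_of_neg (by norm_num) (by linarith)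
  refine ⟨4 ^ n * (1 - q)⁻¹, mul_nonneg (by positivity) (inv_nonneg.2 (by linarith)),
    fun f hf y R hR => ?_⟩
  have hms : MeasurableSet {z : Rn n | R ≤ ‖z - y‖} :=
    measurableSet_le measurable_const (by fun_prop)
  have key := lintegral_kernel_mul_le hf y
    (K := {z : Rn n | R ≤ ‖z - y‖}.indicator fun z => ENNReal.ofReal (‖z - y‖ ^ (-β)))
    (c := fun k => (R * 2 ^ k) ^ (-β)) (ρ := fun k => R * 2 ^ (k + 1))
    (fun k => by positivity) (fun k => by positivity) (by
      intro z
      by_cases hz : R ≤ ‖z - y‖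
      · rw [Set.indicator_of_mem (show z ∈ {z : Rn n | R ≤ ‖z - y‖} from hz)]
        obtain ⟨k, hk1, hk2⟩ := exists_nat_pow_near (x := ‖z - y‖ / R)
          (y := (2 : ℝ)) ((one_le_div hR).2 hz) (by norm_num)
        rw [le_div_iff₀ hR, mul_comm] at hk1
        rw [div_lt_iff₀ hR, mul_comm] at hk2
        refine le_trans ?_ (ENNReal.le_tsum k)
        rw [Set.indicator_of_mem (mem_closedBall_iff_norm.2 hk2.le)]
        exact ENNReal.ofReal_le_ofReal
          (Real.rpow_le_rpow_of_nonpos (by positivity) hk1 (by linarith))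
      · rw [Set.indicator_of_notMem (show z ∉ {z : Rn n | R ≤ ‖z - y‖} from hz)]
        exact zero_le)
  have e1 : ∫⁻ z in {z | R ≤ ‖z - y‖}, ENNReal.ofReal (‖z - y‖ ^ (-β)) * f z =
      ∫⁻ z, {z : Rn n | R ≤ ‖z - y‖}.indicator (fun z => ENNReal.ofReal (‖z - y‖ ^ (-β))) z
        * f z := by
    rw [← lintegral_indicator hms]
    refine lintegral_congr fun z => ?_
    by_cases h : z ∈ {z : Rn n | R ≤ ‖z - y‖}
    · rw [Set.indicator_of_mem h, Set.indicator_of_mem h]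
    · rw [Set.indicator_of_notMem h, Set.indicator_of_notMem h, zero_mul]
  rw [e1]
  refine key.trans_eq ?_
  congr 1
  have e2 : ∀ k : ℕ, (R * 2 ^ k) ^ (-β) * (2 * (R * 2 ^ (k + 1))) ^ n =
      (4 ^ n * R ^ ((n : ℝ) - β)) * q ^ k := by
    intro k
    have h2 : (0 : ℝ) < 2 ^ k := by positivity
    have e3 : q ^ k = ((2 : ℝ) ^ k) ^ n * ((2 : ℝ) ^ k) ^ (-β) := by
      rw [hq, ← Real.rpow_natCast ((2 : ℝ) ^ k) n, ← Real.rpow_add h2,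
        ← Real.rpow_natCast _ k, ← Real.rpow_natCast _ k, ← Real.rpow_mul (by norm_num),
        ← Real.rpow_mul (by norm_num)]
      congr 1; ring
    have e4 : R ^ ((n : ℝ) - β) = R ^ n * R ^ (-β) := by
      rw [sub_eq_add_neg, Real.rpow_add hR, Real.rpow_natCast]
    have e5 : (2 * (R * 2 ^ (k + 1))) ^ n = 4 ^ n * R ^ n * ((2 : ℝ) ^ k) ^ n := by
      rw [← mul_pow, ← mul_pow]; congr 1; ring
    rw [Real.mul_rpow hR.le (by positivity), e3, e4, e5]
    generalize (4 : ℝ) ^ n = c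
    ring
  simp only [e2]
  rw [tsum_ofReal_geometric_le (by positivity) hq0 hq1]
  congr 1; ring

lemma maximal_indicator_le_one (s : Set (Rn n)) (x : Rn n) :
    maximal (s.indicator 1) x ≤ 1 :=
  maximal_le_of_le _ _ (fun y => Set.indicator_le_self' (by simp) y) x

/-- The cube about x₀ of side 3|x - x₀| contains both x and Q; the average of χ_Q over it is the
ratio of the volumes. -/
lemma le_maximal_indicator_cube {x x₀ : Rn n} {r : ℝ} (hr : 0 < r) (h : r ≤ ‖x - x₀‖) :
    ENNReal.ofReal ((r / (3 * ‖x - x₀‖)) ^ n) ≤ maximal ((cube x₀ r).indicator 1) x := by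
  set D := ‖x - x₀‖ with hD
  have hD0 : 0 < D := hr.trans_le h
  have hx : x ∈ cube x₀ (3 * D) := by
    intro i
    have := abs_apply_le_norm (x - x₀) i
    rw [PiLp.sub_apply, ← hD] at this
    linarith
  have hsub : cube x₀ r ⊆ cube x₀ (3 * D) := by
    intro y hy i
    have := hy i
    linarith
  refine le_trans (le_of_eq ?_) (avg_le_maximal _ (by positivity) hx)
  rw [avg, lintegral_indicator (measurableSet_cube _ _), Measure.restrict_restrict
    (measurableSet_cube _ _), Set.inter_eq_self_of_subset_left hsub]
  simp only [Pi.one_apply, lintegral_const, one_mul, Measure.restrict_apply_univ]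
  rw [volume_cube _ hr.le, volume_cube _ (by positivity), div_pow, div_eq_mul_inv, mul_comm,
    ENNReal.ofReal_mul (by positivity), ENNReal.ofReal_inv_of_pos (by positivity)]

end MaximalFunction

/-! ### Convergence of the potential and of its Taylor polynomial at a point. -/

section KernelIntegrals

open scoped ContDiff

variable {n : ℕ} {𝕜 : Type*} [RCLike 𝕜]

lemma measurable_of_contDiffOn_compl_zero {K : Rn n → ℝ} (hK : ContDiffOn ℝ ∞ K {0}ᶜ) :
    Measurable K := measurable_of_continuousOn_compl_singleton 0 hK.continuousOn

lemma ae_ne [NeZero n] (x : Rn n) : ∀ᵐ z : Rn n, z ≠ x := by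
  have : Nontrivial (Rn n) := by
    refine ⟨⟨0, stdVec 0, fun h => ?_⟩⟩
    have := congrArg (fun v : Rn n => v 0) h
    simp [stdVec] at this
  simp [ae_iff]

/-- The integral `∫ |z - x|^(1/2 - n) |a(z)| dz`. -/
def rieszInt (a : Rn n → 𝕜) (x : Rn n) : ℝ≥0∞ :=
  ∫⁻ z, ENNReal.ofReal (‖z - x‖ ^ (-((n : ℝ) - 1 / 2))) * ‖a z‖ₑ

/-- The unit ball about x is controlled by Ma(x), its complement by the L¹ norm. Finiteness of Ma at
the single point x thus suffices for the Taylor polynomial there. -/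
lemma rieszInt_ne_top_of_maximal [NeZero n] {a : Rn n → 𝕜} (ha : Integrable a volume) {x : Rn n}
    (hx : maximal (fun z => ‖a z‖ₑ) x ≠ ⊤) : rieszInt a x ≠ ⊤ := by
  have hn : (1 : ℝ) ≤ n := by exact_mod_cast NeZero.one_le
  obtain ⟨C, -, hC⟩ := exists_lintegral_near_le (n := n) (β := (n : ℝ) - 1 / 2)
    (by linarith) (by linarith)
  have h1 := hC _ ha.aestronglyMeasurable.enorm x 1 one_pos
  have h2 : ∫⁻ z in (Metric.closedBall x 1)ᶜ,
      ENNReal.ofReal (‖z - x‖ ^ (-((n : ℝ) - 1 / 2))) * ‖a z‖ₑ ≤ ∫⁻ z, ‖a z‖ₑ := by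
    refine (setLIntegral_mono' measurableSet_closedBall.compl fun z hz => ?_).trans
      (setLIntegral_le_lintegral _ _)
    have hz' : 1 ≤ ‖z - x‖ := by
      rw [Set.mem_compl_iff, mem_closedBall_iff_norm, not_le] at hz
      exact hz.le
    refine mul_le_of_le_one_left' ?_
    rw [ENNReal.ofReal_le_one]
    exact Real.rpow_le_one_of_one_le_of_nonpos hz' (by linarith)
  rw [rieszInt, ← lintegral_add_compl _ (measurableSet_closedBall (x := x) (ε := 1))]
  refine ENNReal.add_ne_top.2 ⟨?_, ?_⟩
  · exact ne_top_of_le_ne_top (ENNReal.mul_ne_top ENNReal.ofReal_ne_top hx) h1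
  · exact ne_top_of_le_ne_top ha.2.ne h2

lemma rieszInt_ne_top_of_support [NeZero n] {a : Rn n → 𝕜} (ha : Integrable a volume) {x : Rn n}
    {c : ℝ} (hc : 0 < c) (hs : ∀ᵐ z, ‖z - x‖ < c → a z = 0) : rieszInt a x ≠ ⊤ := by
  have hn : (1 : ℝ) ≤ n := by exact_mod_cast NeZero.one_le
  have : rieszInt a x ≤ ∫⁻ z, ENNReal.ofReal (c ^ (-((n : ℝ) - 1 / 2))) * ‖a z‖ₑ := by
    refine lintegral_mono_ae ?_
    filter_upwards [hs] with z hz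
    by_cases h : ‖z - x‖ < c
    · simp [hz h]
    · refine mul_le_mul_left (ENNReal.ofReal_le_ofReal ?_) _
      exact Real.rpow_le_rpow_of_nonpos hc (not_lt.1 h) (by linarith)
  refine ne_top_of_le_ne_top ?_ this
  rw [lintegral_const_mul' _ _ ENNReal.ofReal_ne_top]
  exact ENNReal.mul_ne_top ENNReal.ofReal_ne_top ha.2.ne

lemma enorm_real_smul (c : ℝ) (z : 𝕜) : ‖c • z‖ₑ = ENNReal.ofReal |c| * ‖z‖ₑ := by
  rw [enorm_smul, Real.enorm_eq_ofReal_abs]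

variable {N : ℕ} {Φ P : Rn n → ℝ}

lemma LogHomogeneous.measurable_dirD (H : LogHomogeneous N Φ P) (l : List (Rn n)) :
    Measurable (dirD l Φ) :=
  measurable_of_contDiffOn_compl_zero (dirD_contDiffOn isOpen_ne_zero H.smooth l)

lemma LogHomogeneous.aestronglyMeasurable_dirD (H : LogHomogeneous N Φ P) (l : List (Rn n))
    (x : Rn n) {a : Rn n → 𝕜} (ha : Integrable a volume) :
    AEStronglyMeasurable (fun z => dirD l Φ (x - z) • a z) volume :=
  (((H.measurable_dirD l).comp (measurable_const.sub measurable_id)).aestronglyMeasurable).smul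
    ha.aestronglyMeasurable

/-- On the bounded set of differences x - z, with z in the cube, every derivative of order below N
is dominated by the kernel of `rieszInt`. -/
lemma LogHomogeneous.integrable_dirD_smul [NeZero n] (H : LogHomogeneous N Φ P) {a : Rn n → 𝕜}
    (ha : Integrable a volume) {x₀ : Rn n} {r : ℝ} (hr : 0 < r)
    (hs : ∀ᵐ y : Rn n, y ∉ cube x₀ r → a y = 0) {x : Rn n} (hx : rieszInt a x ≠ ⊤)
    (l : List (Rn n)) (hl : l.length < N) :
    Integrable (fun z => dirD l Φ (x - z) • a z) volume := by
  set L : ℝ := ‖x - x₀‖ + Real.sqrt n * r / 2 + 1 with hL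
  have hL0 : 0 < L := by positivity
  obtain ⟨C, hC0, hC⟩ := H.exists_bound_near l.length (β := (n : ℝ) - 1 / 2) (L := L) (by
    have : ((l.length : ℕ) : ℝ) + 1 ≤ N := by exact_mod_cast hl
    linarith) hL0
  refine ⟨H.aestronglyMeasurable_dirD l x ha, ?_⟩
  rw [hasFiniteIntegral_iff_enorm]
  set A : ℝ := C * (l.map norm).prod with hA
  have hA0 : 0 ≤ A := mul_nonneg hC0 (prod_map_norm_nonneg l)
  have : ∫⁻ z, ‖dirD l Φ (x - z) • a z‖ₑ ≤ ∫⁻ z, ENNReal.ofReal A *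
      (ENNReal.ofReal (‖z - x‖ ^ (-((n : ℝ) - 1 / 2))) * ‖a z‖ₑ) := by
    refine lintegral_mono_ae ?_
    filter_upwards [hs, ae_ne x] with z hz hzx
    by_cases h : z ∈ cube x₀ r
    · rw [enorm_real_smul, ← mul_assoc, ← ENNReal.ofReal_mul hA0]
      gcongr
      rw [norm_sub_rev z x]
      refine hC l rfl _ (sub_ne_zero.2 hzx.symm) ?_
      have h1 := norm_le_of_mem_cube hr.le h
      have h2 : ‖x - z‖ ≤ ‖x - x₀‖ + ‖z - x₀‖ := by
        rw [norm_sub_rev z x₀]; simpa using norm_add_le (x - x₀) (x₀ - z)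
      linarith
    · simp [hz h]
  refine this.trans_lt ?_
  rw [lintegral_const_mul' _ _ ENNReal.ofReal_ne_top]
  exact ENNReal.mul_lt_top ENNReal.ofReal_lt_top hx.lt_top

/-- The Taylor polynomial of order `< N` at `x` of the potential with kernel `Φ`. -/
def potentialPoly (N : ℕ) (Φ : Rn n → ℝ) (a : Rn n → 𝕜) (x : Rn n) : MvPolynomial (Fin n) 𝕜 :=
  ∑ k ∈ Finset.range N, ∑ I : Fin k → Fin n,
    MvPolynomial.C (((k.factorial : ℝ))⁻¹ •
      ∫ z, dirD (List.ofFn fun j => stdVec (I j)) Φ (x - z) • a z) *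
    ∏ j, (MvPolynomial.X (I j) - MvPolynomial.C ((x (I j) : ℝ) : 𝕜))

lemma totalDegree_prod_X_sub_C_le {k : ℕ} (I : Fin k → Fin n) (c : Fin n → 𝕜) :
    (∏ j, (MvPolynomial.X (I j) - MvPolynomial.C (c (I j)) :
      MvPolynomial (Fin n) 𝕜)).totalDegree ≤ k := by
  refine (MvPolynomial.totalDegree_finsetProd _ _).trans ?_
  calc _ ≤ ∑ _j : Fin k, 1 := by
        refine Finset.sum_le_sum fun j _ => ?_
        refine (MvPolynomial.totalDegree_sub_C_le _ _).trans ?_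
        simp
    _ = k := by simp

lemma totalDegree_potentialPoly_le (N : ℕ) (Φ : Rn n → ℝ) (a : Rn n → 𝕜) (x : Rn n) :
    (potentialPoly N Φ a x).totalDegree ≤ N - 1 := by
  refine MvPolynomial.totalDegree_finsetSum_le fun k hk => ?_
  refine MvPolynomial.totalDegree_finsetSum_le fun I _ => ?_
  refine (MvPolynomial.totalDegree_mul _ _).trans ?_
  have := totalDegree_prod_X_sub_C_le I (fun i => ((x i : ℝ) : 𝕜))
  have hk' := Finset.mem_range.1 hk
  rw [MvPolynomial.totalDegree_C]
  omega

lemma taylorPoly_eq_sum {K : Rn n → ℝ} (hK : ContDiffOn ℝ ∞ K {0}ᶜ) (N : ℕ) (h : Rn n) {u : Rn n}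
    (hu : u ≠ 0) :
    taylorPoly N h K u = ∑ k ∈ Finset.range N, ∑ I : Fin k → Fin n,
      ((k.factorial : ℝ)⁻¹ * ∏ j, h (I j)) * dirD (List.ofFn fun j => stdVec (I j)) K u := by
  refine Finset.sum_congr rfl fun k _ => ?_
  rw [dirD_replicate_eq_sum isOpen_ne_zero hK k h hu, Finset.mul_sum]
  simp only [mul_assoc]

/-- Expanding the Taylor polynomial of the kernel in coordinates and integrating term by term; the
null set z = x, where the kernel is singular, is irrelevant. -/
lemma eval_potentialPoly [NeZero n] {Φ : Rn n → ℝ} (hΦ : ContDiffOn ℝ ∞ Φ {0}ᶜ) {a : Rn n → 𝕜}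
    {x : Rn n} (hint : ∀ l : List (Rn n), l.length < N →
      Integrable (fun z => dirD l Φ (x - z) • a z) volume) (y : Rn n) :
    Integrable (fun z => taylorPoly N (y - x) Φ (x - z) • a z) volume ∧
    MvPolynomial.eval (fun i => ((y i : ℝ) : 𝕜)) (potentialPoly N Φ a x) =
      ∫ z, taylorPoly N (y - x) Φ (x - z) • a z := by
  have hae : (fun z => taylorPoly N (y - x) Φ (x - z) • a z) =ᵐ[volume] fun z =>
      ∑ k ∈ Finset.range N, ∑ I : Fin k → Fin n,
        ((k.factorial : ℝ)⁻¹ * ∏ j, (y - x) (I j)) •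
          (dirD (List.ofFn fun j => stdVec (I j)) Φ (x - z) • a z) := by
    filter_upwards [ae_ne x] with z hz
    rw [taylorPoly_eq_sum hΦ N _ (sub_ne_zero.2 hz.symm)]
    simp only [Finset.sum_smul, smul_smul]
  have hi : ∀ k ∈ Finset.range N, ∀ I ∈ (Finset.univ : Finset (Fin k → Fin n)),
      Integrable (fun z => ((k.factorial : ℝ)⁻¹ * ∏ j, (y - x) (I j)) •
          (dirD (List.ofFn fun j => stdVec (I j)) Φ (x - z) • a z)) volume := fun k hk I _ =>
    (hint (List.ofFn fun j => stdVec (I j)) (by rw [List.length_ofFn]; exact Finset.mem_range.1 hk)).smul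
      ((k.factorial : ℝ)⁻¹ * ∏ j, (y - x) (I j))
  constructor
  · exact (integrable_finsetSum _ fun k hk => integrable_finsetSum _ (hi k hk)).congr hae.symm
  · rw [integral_congr_ae hae,
      integral_finsetSum _ fun k hk => integrable_finsetSum _ (hi k hk)]
    simp only [potentialPoly, map_sum, map_mul, MvPolynomial.eval_C, map_prod, map_sub,
      MvPolynomial.eval_X]
    refine Finset.sum_congr rfl fun k hk => ?_
    rw [integral_finsetSum _ (hi k hk)]
    refine Finset.sum_congr rfl fun I _ => ?_
    rw [integral_smul, RCLike.real_smul_eq_coe_mul, RCLike.real_smul_eq_coe_mul]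
    push_cast
    simp only [PiLp.sub_apply, RCLike.ofReal_sub]
    ring

lemma potential_eq (m : ℕ) (a : Rn n → 𝕜) (x : Rn n) :
    potential m a x = ∫ z, fundSol n m (x - z) • a z := by
  simp only [potential, RCLike.real_smul_eq_coe_mul]

/-- The potential minus its Taylor polynomial is the integral against the Taylor remainder of the
kernel. -/
lemma LogHomogeneous.integral_sub_eval_potentialPoly [NeZero n] (H : LogHomogeneous N Φ P)
    (hN : 1 ≤ N) {a : Rn n → 𝕜}
    (ha : Integrable a volume) {x₀ : Rn n} {r : ℝ} (hr : 0 < r)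
    (hs : ∀ᵐ y : Rn n, y ∉ cube x₀ r → a y = 0) {x y : Rn n} (hx : rieszInt a x ≠ ⊤)
    (hy : rieszInt a y ≠ ⊤) :
    Integrable (fun z => taylorRem N (y - x) Φ (x - z) • a z) volume ∧
    (∫ z, Φ (y - z) • a z) - MvPolynomial.eval (fun i => ((y i : ℝ) : 𝕜)) (potentialPoly N Φ a x) =
      ∫ z, taylorRem N (y - x) Φ (x - z) • a z := by
  have h1 := H.integrable_dirD_smul ha hr hs hy [] (by rw [List.length_nil]; omega)
  obtain ⟨h2, h3⟩ := eval_potentialPoly H.smooth (a := a) (x := x)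
    (fun l hl => H.integrable_dirD_smul ha hr hs hx l hl) y
  have e : (fun z => taylorRem N (y - x) Φ (x - z) • a z) = fun z =>
      dirD [] Φ (y - z) • a z - taylorPoly N (y - x) Φ (x - z) • a z := by
    ext z
    rw [taylorRem, sub_smul, show x - z + (y - x) = y - z by abel]
    rfl
  rw [e, h3]
  exact ⟨h1.sub h2, (integral_sub h1 h2).symm⟩

lemma taylorRem_zero (hN : 1 ≤ N) (f : Rn n → ℝ) (u : Rn n) : taylorRem N 0 f u = 0 := by
  have h : ∀ k, dirD (List.replicate k (0 : Rn n)) f u = 0 ^ k * dirD (List.replicate k 0) f u := by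
    intro k
    have := congrFun (dirD_replicate_smul f 0 (0 : Rn n) k) u
    simpa only [smul_zero] using this
  rw [taylorRem, taylorPoly, Finset.sum_eq_single_of_mem 0 (Finset.mem_range.2 hN)]
  · simp
  · intro k _ hk
    rw [h, zero_pow hk]; simp

end KernelIntegrals

/-! ### From pointwise bounds to `eta` and `calderonN`. -/

section EtaBound

variable {n : ℕ} {𝕜 : Type*} [RCLike 𝕜]

/-- An upper bound for `η_{q,N}` from a pointwise bound on cubes. -/
lemma eta_le_of_bound {q : ℝ} (hq : 1 ≤ q) {N : ℕ} {g : Rn n → 𝕜} {x : Rn n} {C : ℝ} (hC : 0 ≤ C)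
    {S Y : ℝ≥0∞} {F : Rn n → ℝ≥0∞}
    (hg : ∀ ρ : ℝ, 0 < ρ → ∀ y ∈ cube x ρ, ‖g y‖ₑ ≤ ENNReal.ofReal (C * ρ ^ N) * (S + F y))
    (hF : ∀ ρ : ℝ, 0 < ρ → avg (cube x ρ) (fun y => F y ^ q) ≤ Y) :
    eta q N g x ≤ ENNReal.ofReal (2 * C) * (S + Y ^ (1 / q)) := by
  have hq0 : 0 < q := by linarith
  have hq1 : 1 / q ≤ 1 := by rw [div_le_one hq0]; exact hq
  refine iSup_le fun ρ => iSup_le fun hρ => ?_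
  set A : ℝ≥0∞ := ENNReal.ofReal (C * ρ ^ N) with hA
  have hv0 := volume_cube_ne_zero x hρ
  have hvt := volume_cube_ne_top x hρ
  have h1 : avg (cube x ρ) (fun y => ‖g y‖ₑ ^ q) ≤ A ^ q * (2 ^ (q - 1) * (S ^ q + Y)) := by
    have e1 : ∫⁻ y in cube x ρ, ‖g y‖ₑ ^ q ≤
        A ^ q * (2 ^ (q - 1) * (S ^ q * volume (cube x ρ) + ∫⁻ y in cube x ρ, F y ^ q)) := by
      calc ∫⁻ y in cube x ρ, ‖g y‖ₑ ^ q
          ≤ ∫⁻ y in cube x ρ, A ^ q * (2 ^ (q - 1) * (S ^ q + F y ^ q)) := by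
            refine setLIntegral_mono' (measurableSet_cube x ρ) fun y hy => ?_
            refine (ENNReal.rpow_le_rpow (hg ρ hρ y hy) hq0.le).trans ?_
            rw [ENNReal.mul_rpow_of_nonneg _ _ hq0.le]
            gcongr
            exact ENNReal.rpow_add_le_mul_rpow_add_rpow _ _ hq
        _ = _ := by
            rw [lintegral_const_mul' _ _ (ENNReal.rpow_ne_top_of_nonneg hq0.le
              ENNReal.ofReal_ne_top), lintegral_const_mul' _ _ (ENNReal.rpow_ne_top_of_nonneg
              (by linarith) (by simp)), lintegral_add_left measurable_const, setLIntegral_const]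
    calc avg (cube x ρ) (fun y => ‖g y‖ₑ ^ q) ≤ (volume (cube x ρ))⁻¹ *
          (A ^ q * (2 ^ (q - 1) * (S ^ q * volume (cube x ρ) + ∫⁻ y in cube x ρ, F y ^ q))) := by
          rw [avg]; gcongr
      _ = A ^ q * (2 ^ (q - 1) * (S ^ q * ((volume (cube x ρ))⁻¹ * volume (cube x ρ)) +
            avg (cube x ρ) fun y => F y ^ q)) := by
          rw [avg]; ring
      _ ≤ _ := by
          rw [ENNReal.inv_mul_cancel hv0 hvt, mul_one]
          gcongr
          exact hF ρ hρ
  have h2 : (avg (cube x ρ) fun y => ‖g y‖ₑ ^ q) ^ (1 / q) ≤ A * (2 * (S + Y ^ (1 / q))) := by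
    refine (ENNReal.rpow_le_rpow h1 (by positivity)).trans ?_
    rw [ENNReal.mul_rpow_of_nonneg _ _ (by positivity), ENNReal.mul_rpow_of_nonneg _ _
      (by positivity), ← ENNReal.rpow_mul, ← ENNReal.rpow_mul, mul_one_div_cancel hq0.ne',
      ENNReal.rpow_one]
    gcongr
    · calc (2 : ℝ≥0∞) ^ ((q - 1) * (1 / q)) ≤ 2 ^ (1 : ℝ) := by
            refine ENNReal.rpow_le_rpow_of_exponent_le (by norm_num) ?_
            rw [mul_one_div, div_le_one hq0]; linarith
        _ = 2 := ENNReal.rpow_one 2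
    · refine (ENNReal.rpow_add_le_add_rpow _ _ (by positivity) hq1).trans_eq ?_
      rw [← ENNReal.rpow_mul, mul_one_div_cancel hq0.ne', ENNReal.rpow_one]
  calc ENNReal.ofReal (ρ ^ (-(N : ℝ))) * (avg (cube x ρ) fun y => ‖g y‖ₑ ^ q) ^ (1 / q)
      ≤ ENNReal.ofReal (ρ ^ (-(N : ℝ))) * (A * (2 * (S + Y ^ (1 / q)))) := by gcongr
    _ = (ENNReal.ofReal (ρ ^ (-(N : ℝ))) * A * 2) * (S + Y ^ (1 / q)) := by ring
    _ = _ := by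
      congr 1
      rw [hA, ← ENNReal.ofReal_mul (by positivity), ← ENNReal.ofReal_ofNat 2,
        ← ENNReal.ofReal_mul (by positivity), Real.rpow_neg hρ.le, Real.rpow_natCast]
      congr 1
      field_simp

/-- A class in `E^q_k` has Calderón's maximal function bounded by `η` of any representative. -/
lemma calderonN_le_eta_sub {q : ℝ} {γ : ℝ} {k : ℕ} {g : Rn n → 𝕜} (hg : g ∈ LqLoc n 𝕜 q)
    (Q : MvPolynomial (Fin n) 𝕜) (hQ : Q.totalDegree ≤ k) (x : Rn n) :
    calderonN q γ k (toEqk q k g hg) x ≤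
      eta q γ (fun y => g y - MvPolynomial.eval (fun i => ((y i : ℝ) : 𝕜)) Q) x := by
  have hQc : Continuous fun y : Rn n => MvPolynomial.eval (fun i => ((y i : ℝ) : 𝕜)) Q := by
    refine (MvPolynomial.continuous_eval Q).comp (continuous_pi fun i => ?_)
    exact RCLike.continuous_ofReal.comp (by fun_prop)
  have hQm : (fun y : Rn n => MvPolynomial.eval (fun i => ((y i : ℝ) : 𝕜)) Q) ∈ LqLoc n 𝕜 q := by
    intro K hK
    obtain ⟨C, hC⟩ := hK.exists_bound_of_continuousOn hQc.continuousOn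
    have : IsFiniteMeasure (volume.restrict K) := ⟨by simpa using hK.measure_lt_top⟩
    exact MemLp.of_bound hQc.aestronglyMeasurable C
      ((ae_restrict_iff' hK.measurableSet).2 (ae_of_all _ hC))
  set e : LqLoc n 𝕜 q := ⟨_, (LqLoc n 𝕜 q).sub_mem hg hQm⟩ with he
  have hcl : (Submodule.Quotient.mk e : Eqk n 𝕜 q k) = toEqk q k g hg := by
    rw [toEqk, Submodule.Quotient.eq]
    refine ⟨-Q, by rwa [MvPolynomial.totalDegree_neg], ae_of_all _ fun y => ?_⟩
    simp [he]
  rw [calderonN]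
  exact iInf_le_of_le e (iInf_le_of_le hcl le_rfl)

end EtaBound

/-! ### The pointwise estimate by maximal functions and singular integrals. -/

section Inside

open scoped ContDiff

variable {n : ℕ} {𝕜 : Type*} [RCLike 𝕜] {N : ℕ} {Φ P : Rn n → ℝ}

lemma enorm_integral_smul_le {α : Type*} [MeasurableSpace α] {ν : Measure α} {K : α → ℝ}
    {a : α → 𝕜} {B : α → ℝ≥0∞} (h : ∀ᵐ z ∂ν, ENNReal.ofReal |K z| ≤ B z) :
    ‖∫ z, K z • a z ∂ν‖ₑ ≤ ∫⁻ z, B z * ‖a z‖ₑ ∂ν := by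
  refine (enorm_integral_le_lintegral_enorm _).trans (lintegral_mono_ae ?_)
  filter_upwards [h] with z hz
  rw [enorm_real_smul]
  gcongr

/-- The remainder has singularities of order n - 1/2 at z = x and at z = x + h. The ball of radius
3|h| about either point contains the domain, so each gives |h|^(1/2) times the maximal function
there. -/
lemma LogHomogeneous.exists_near_integral_le [NeZero n] (H : LogHomogeneous N Φ P) (hN : 1 ≤ N) :
    ∃ C : ℝ, 0 ≤ C ∧ ∀ a : Rn n → 𝕜, Integrable a volume → ∀ x h : Rn n, h ≠ 0 →
      ‖∫ z in Metric.closedBall x (2 * ‖h‖), taylorRem N h Φ (x - z) • a z‖ₑ ≤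
        ENNReal.ofReal (C * ‖h‖ ^ N) *
          (maximal (fun z => ‖a z‖ₑ) x + maximal (fun z => ‖a z‖ₑ) (x + h)) := by
  have hn : (1 : ℝ) ≤ n := by exact_mod_cast NeZero.one_le
  obtain ⟨C, hC0, hC⟩ := H.exists_taylorRem_near_bound hN
  obtain ⟨C', hC0', hC'⟩ := exists_lintegral_near_le (n := n) (β := (n : ℝ) - 1 / 2)
    (by linarith) (by linarith)
  refine ⟨C * (C' * 3 ^ ((1 : ℝ) / 2)), by positivity, fun a ha x h hh => ?_⟩
  have h0 : 0 < ‖h‖ := norm_pos_iff.2 hh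
  set β : ℝ := (n : ℝ) - 1 / 2 with hβ
  have hexp : (n : ℝ) - β = 1 / 2 := by rw [hβ]; ring
  set A : ℝ := C * ‖h‖ ^ ((N : ℝ) - 1 / 2) with hA
  have hA0 : 0 ≤ A := by positivity
  have b1 := hC' _ ha.aestronglyMeasurable.enorm x (3 * ‖h‖) (by positivity)
  have b2 := hC' _ ha.aestronglyMeasurable.enorm (x + h) (3 * ‖h‖) (by positivity)
  rw [hexp] at b1 b2
  have hs1 : Metric.closedBall x (2 * ‖h‖) ⊆ Metric.closedBall x (3 * ‖h‖) :=
    Metric.closedBall_subset_closedBall (by linarith)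
  have hs2 : Metric.closedBall x (2 * ‖h‖) ⊆ Metric.closedBall (x + h) (3 * ‖h‖) := by
    intro z hz
    rw [mem_closedBall_iff_norm] at hz ⊢
    calc ‖z - (x + h)‖ = ‖(z - x) - h‖ := by rw [sub_sub]
      _ ≤ ‖z - x‖ + ‖h‖ := norm_sub_le _ _
      _ ≤ _ := by linarith
  have hmeas : ∀ w : Rn n, AEMeasurable (fun z : Rn n =>
      ENNReal.ofReal (‖z - w‖ ^ (-β)) * ‖a z‖ₑ) volume := by
    intro w
    refine AEMeasurable.mul ?_ ha.aestronglyMeasurable.enorm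
    exact (ENNReal.measurable_ofReal.comp (by fun_prop)).aemeasurable
  calc _ ≤ ∫⁻ z in Metric.closedBall x (2 * ‖h‖), (ENNReal.ofReal A *
        (ENNReal.ofReal (‖z - x‖ ^ (-β)) + ENNReal.ofReal (‖z - (x + h)‖ ^ (-β)))) * ‖a z‖ₑ := by
        refine enorm_integral_smul_le ?_
        rw [ae_restrict_iff' measurableSet_closedBall]
        filter_upwards [ae_ne x, ae_ne (x + h)] with z hz1 hz2 hz
        rw [← ENNReal.ofReal_add (by positivity) (by positivity), ← ENNReal.ofReal_mul hA0]
        refine ENNReal.ofReal_le_ofReal ?_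
        have e : x - z + h = (x + h) - z := by abel
        have := hC (x - z) h (sub_ne_zero.2 hz1.symm)
          (by rw [e]; exact sub_ne_zero.2 hz2.symm) hh
          (by rw [norm_sub_rev]; exact mem_closedBall_iff_norm.1 hz)
        rw [e, norm_sub_rev x z, norm_sub_rev (x + h) z] at this
        exact this
    _ = ENNReal.ofReal A * ((∫⁻ z in Metric.closedBall x (2 * ‖h‖),
          ENNReal.ofReal (‖z - x‖ ^ (-β)) * ‖a z‖ₑ) + ∫⁻ z in Metric.closedBall x (2 * ‖h‖),
          ENNReal.ofReal (‖z - (x + h)‖ ^ (-β)) * ‖a z‖ₑ) := by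
        rw [← lintegral_add_left' (hmeas x).restrict, ← lintegral_const_mul' _ _
          ENNReal.ofReal_ne_top]
        refine lintegral_congr fun z => ?_
        ring
    _ ≤ ENNReal.ofReal A * (ENNReal.ofReal (C' * (3 * ‖h‖) ^ ((1 : ℝ) / 2)) *
          maximal (fun z => ‖a z‖ₑ) x + ENNReal.ofReal (C' * (3 * ‖h‖) ^ ((1 : ℝ) / 2)) *
          maximal (fun z => ‖a z‖ₑ) (x + h)) := by
        gcongr
        · exact (lintegral_mono_set hs1).trans b1
        · exact (lintegral_mono_set hs2).trans b2
    _ = _ := by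
        rw [← mul_add, ← mul_assoc, ← ENNReal.ofReal_mul hA0]
        congr 2
        have : ‖h‖ ^ ((N : ℝ) - 1 / 2) * ‖h‖ ^ ((1 : ℝ) / 2) = ‖h‖ ^ N := by
          rw [← Real.rpow_add h0, sub_add_cancel, Real.rpow_natCast]
        rw [Real.mul_rpow (by norm_num) h0.le, ← this, hA]
        ring

lemma LogHomogeneous.integrableOn_far (H : LogHomogeneous N Φ P) {a : Rn n → 𝕜}
    (ha : Integrable a volume) (x : Rn n) {R : ℝ} (hR : 0 < R) (l : List (Rn n))
    (hl : l.length = N) :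
    IntegrableOn (fun z => dirD l Φ (x - z) • a z) {z | R < ‖x - z‖} volume := by
  obtain ⟨C, hC0, hC⟩ := H.exists_bound_of_le_length 0
  have hp := prod_map_norm_nonneg l
  have hms : MeasurableSet {z : Rn n | R < ‖x - z‖} :=
    measurableSet_lt measurable_const (by fun_prop)
  refine Integrable.mono' (g := fun z => (C * (l.map norm).prod / R ^ n) * ‖a z‖)
    (ha.norm.const_mul _).restrict (H.aestronglyMeasurable_dirD l x ha).restrict ?_
  rw [ae_restrict_iff' hms]
  refine ae_of_all _ fun z hz => ?_
  have hz' : R < ‖x - z‖ := hz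
  rw [norm_smul, Real.norm_eq_abs]
  gcongr
  refine (hC l hl _ (norm_pos_iff.1 (hR.trans hz'))).trans ?_
  rw [add_zero]
  gcongr

/-- The terms of order exactly N are truncated singular integrals, bounded by `T` only through their
cancellation. The remainder of order N + 1 decays like |x - z|^(-n-1) and can be integrated
absolutely. -/
lemma LogHomogeneous.exists_far_integral_le [NeZero n] (H : LogHomogeneous N Φ P) :
    ∃ C : ℝ, 0 ≤ C ∧ ∀ a : Rn n → 𝕜, Integrable a volume → ∀ x h : Rn n, h ≠ 0 →
      IntegrableOn (fun z => taylorRem N h Φ (x - z) • a z) {z | 2 * ‖h‖ < ‖x - z‖} volume →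
      ∀ T : ℝ≥0∞, (∀ I : Fin N → Fin n, ‖∫ z in {z | 2 * ‖h‖ < ‖x - z‖},
        dirD (List.ofFn fun j => stdVec (I j)) Φ (x - z) • a z‖ₑ ≤ T) →
      ‖∫ z in {z | 2 * ‖h‖ < ‖x - z‖}, taylorRem N h Φ (x - z) • a z‖ₑ ≤
        ENNReal.ofReal (C * ‖h‖ ^ N) * (maximal (fun z => ‖a z‖ₑ) x + T) := by
  obtain ⟨C, hC0, hC⟩ := H.exists_taylorRem_far_bound (M := N + 1) (k := 0) (j := 1)
    (by omega) (by omega)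
  obtain ⟨C', hC0', hC'⟩ := exists_lintegral_far_le (n := n) (β := (n : ℝ) + 1) (by linarith)
  refine ⟨C * C' + Fintype.card (Fin N → Fin n), by positivity, fun a ha x h hh hi T hT => ?_⟩
  have h0 : 0 < ‖h‖ := norm_pos_iff.2 hh
  set S : Set (Rn n) := {z | 2 * ‖h‖ < ‖x - z‖} with hS
  have hms : MeasurableSet S := measurableSet_lt measurable_const (by fun_prop)
  have hne : ∀ z ∈ S, x - z ≠ 0 := fun z hz =>
    norm_pos_iff.1 (lt_trans (by positivity) (show 2 * ‖h‖ < ‖x - z‖ from hz))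
  set c : (Fin N → Fin n) → ℝ := fun I => (N.factorial : ℝ)⁻¹ * ∏ j, h (I j) with hc
  have hcle : ∀ I, |c I| ≤ ‖h‖ ^ N := by
    intro I
    rw [hc]
    simp only
    rw [abs_mul, abs_of_pos (by positivity), Finset.abs_prod]
    refine (mul_le_of_le_one_left (Finset.prod_nonneg fun _ _ => abs_nonneg _)
      (inv_le_one_of_one_le₀ (Nat.one_le_cast.2 (Nat.factorial_pos _)))).trans ?_
    refine (Finset.prod_le_prod (fun _ _ => abs_nonneg _)
      (fun j _ => abs_apply_le_norm h (I j))).trans_eq ?_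
    simp
  set main : Rn n → 𝕜 := fun z => ∑ I : Fin N → Fin n,
    c I • (dirD (List.ofFn fun j => stdVec (I j)) Φ (x - z) • a z) with hmain
  have himain : ∀ I ∈ (Finset.univ : Finset (Fin N → Fin n)), IntegrableOn (fun z =>
      c I • (dirD (List.ofFn fun j => stdVec (I j)) Φ (x - z) • a z)) S volume := fun I _ =>
    (H.integrableOn_far ha x (by positivity) (List.ofFn fun j => stdVec (I j))
      (by rw [List.length_ofFn])).smul (c I)
  have hdec : ∀ z ∈ S, taylorRem N h Φ (x - z) • a z =
      main z + taylorRem (N + 1) h Φ (x - z) • a z := by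
    intro z hz
    rw [taylorRem_eq_add, add_smul, hmain]
    congr 1
    rw [dirD_replicate_eq_sum isOpen_ne_zero H.smooth N h (hne z hz), Finset.mul_sum,
      Finset.sum_smul]
    refine Finset.sum_congr rfl fun I _ => ?_
    rw [smul_smul, hc]
    simp only [mul_assoc]
  have hi' : IntegrableOn main S volume := integrable_finsetSum _ himain
  have hi'' : IntegrableOn (fun z => taylorRem (N + 1) h Φ (x - z) • a z) S volume := by
    refine (hi.sub hi').congr_fun (fun z hz => ?_) hms
    simp only [Pi.sub_apply, hdec z hz, add_sub_cancel_left]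
  rw [setIntegral_congr_fun hms hdec, integral_add hi' hi'']
  refine (enorm_add_le _ _).trans ?_
  have b1 : ‖∫ z in S, main z‖ₑ ≤ ENNReal.ofReal (Fintype.card (Fin N → Fin n) * ‖h‖ ^ N) * T := by
    rw [hmain, integral_finsetSum _ himain]
    refine (enorm_sum_le _ _).trans ?_
    calc _ ≤ ∑ _I : Fin N → Fin n, ENNReal.ofReal (‖h‖ ^ N) * T := by
          refine Finset.sum_le_sum fun I _ => ?_
          rw [integral_smul, enorm_real_smul]
          gcongr
          · exact hcle I
          · exact hT I
      _ = _ := by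
          rw [Finset.sum_const, Finset.card_univ, nsmul_eq_mul, ENNReal.ofReal_mul (by positivity),
            ENNReal.ofReal_natCast, mul_assoc]
  have b2 : ‖∫ z in S, taylorRem (N + 1) h Φ (x - z) • a z‖ₑ ≤
      ENNReal.ofReal (C * C' * ‖h‖ ^ N) * maximal (fun z => ‖a z‖ₑ) x := by
    calc _ ≤ ∫⁻ z in S, ENNReal.ofReal (C * ‖h‖ ^ (N + 1)) *
          ENNReal.ofReal (‖z - x‖ ^ (-((n : ℝ) + 1))) * ‖a z‖ₑ := by
          refine enorm_integral_smul_le ?_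
          rw [ae_restrict_iff' hms]
          refine ae_of_all _ fun z hz => ?_
          rw [← ENNReal.ofReal_mul (by positivity)]
          refine ENNReal.ofReal_le_ofReal ?_
          have := hC [] (x - z) h rfl (hne z hz) (le_of_lt hz)
          rw [dirD_nil, List.map_nil, List.prod_nil, mul_one, norm_sub_rev] at this
          rw [Real.rpow_neg (norm_nonneg _), ← div_eq_mul_inv]
          exact_mod_cast this
      _ = ENNReal.ofReal (C * ‖h‖ ^ (N + 1)) * ∫⁻ z in S,
          ENNReal.ofReal (‖z - x‖ ^ (-((n : ℝ) + 1))) * ‖a z‖ₑ := by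
          rw [← lintegral_const_mul' _ _ ENNReal.ofReal_ne_top]
          simp only [mul_assoc]
      _ ≤ ENNReal.ofReal (C * ‖h‖ ^ (N + 1)) * (ENNReal.ofReal (C' * ‖h‖ ^ ((n : ℝ) - (n + 1))) *
          maximal (fun z => ‖a z‖ₑ) x) := by
          gcongr
          refine (lintegral_mono_set fun z hz => ?_).trans
            (hC' _ ha.aestronglyMeasurable.enorm x ‖h‖ h0)
          have hz' : 2 * ‖h‖ < ‖x - z‖ := hz
          change ‖h‖ ≤ ‖z - x‖
          rw [norm_sub_rev]; linarith
      _ = _ := by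
          rw [← mul_assoc, ← ENNReal.ofReal_mul (by positivity)]
          congr 2
          rw [show (n : ℝ) - (n + 1) = -1 by ring, Real.rpow_neg_one, pow_succ]
          field_simp
  calc _ ≤ ENNReal.ofReal (Fintype.card (Fin N → Fin n) * ‖h‖ ^ N) * T +
        ENNReal.ofReal (C * C' * ‖h‖ ^ N) * maximal (fun z => ‖a z‖ₑ) x := add_le_add b1 b2
    _ ≤ ENNReal.ofReal ((C * C' + Fintype.card (Fin N → Fin n)) * ‖h‖ ^ N) * T +
        ENNReal.ofReal ((C * C' + Fintype.card (Fin N → Fin n)) * ‖h‖ ^ N) *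
          maximal (fun z => ‖a z‖ₑ) x := by
        have : 0 ≤ C * C' := by positivity
        gcongr
        · linarith
        · have : (0 : ℝ) ≤ Fintype.card (Fin N → Fin n) := by positivity
          linarith
    _ = _ := by ring

/-- Pointwise bound for the potential minus its Taylor polynomial. -/
lemma LogHomogeneous.exists_pointwise_bound [NeZero n] (H : LogHomogeneous N Φ P) (hN : 1 ≤ N) :
    ∃ C : ℝ, 0 ≤ C ∧ ∀ (a : Rn n → 𝕜) (x₀ : Rn n) (r : ℝ), Integrable a volume → 0 < r →
      (∀ᵐ y : Rn n, y ∉ cube x₀ r → a y = 0) → ∀ (x y : Rn n) (T : ℝ≥0∞),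
      maximal (fun z => ‖a z‖ₑ) x ≠ ⊤ → maximal (fun z => ‖a z‖ₑ) y ≠ ⊤ →
      (∀ (ε : ℝ), 0 < ε → ∀ I : Fin N → Fin n, ‖∫ z in {z | ε < ‖x - z‖},
        dirD (List.ofFn fun j => stdVec (I j)) Φ (x - z) • a z‖ₑ ≤ T) →
      ‖(∫ z, Φ (y - z) • a z) -
          MvPolynomial.eval (fun i => ((y i : ℝ) : 𝕜)) (potentialPoly N Φ a x)‖ₑ ≤
        ENNReal.ofReal (C * ‖y - x‖ ^ N) *
          (maximal (fun z => ‖a z‖ₑ) x + T + maximal (fun z => ‖a z‖ₑ) y) := by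
  obtain ⟨C₁, h1, near⟩ := H.exists_near_integral_le (𝕜 := 𝕜) hN
  obtain ⟨C₂, h2, far⟩ := H.exists_far_integral_le (𝕜 := 𝕜)
  refine ⟨C₁ + C₂, by positivity, fun a x₀ r ha hr hs x y T hx hy hT => ?_⟩
  obtain ⟨hi, he⟩ := H.integral_sub_eval_potentialPoly hN ha hr hs (x := x) (y := y)
    (rieszInt_ne_top_of_maximal ha hx) (rieszInt_ne_top_of_maximal ha hy)
  rw [he]
  rcases eq_or_ne (y - x) 0 with h0 | h0
  · simp [h0, taylorRem_zero hN]
  set h := y - x with hh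
  have hc : (Metric.closedBall x (2 * ‖h‖))ᶜ = {z | 2 * ‖h‖ < ‖x - z‖} := by
    ext z
    simp [dist_eq_norm, norm_sub_rev]
  rw [← integral_add_compl (measurableSet_closedBall (x := x) (ε := 2 * ‖h‖)) hi, hc]
  have b1 := near a ha x h h0
  have b2 := far a ha x h h0 hi.integrableOn T (hT _ (by positivity))
  rw [show x + h = y by rw [hh]; abel] at b1
  refine (enorm_add_le _ _).trans ((add_le_add b1 b2).trans ?_)
  rw [add_mul, ENNReal.ofReal_add (by positivity) (by positivity), add_mul]
  exact add_le_add (mul_le_mul' le_rfl (add_le_add le_self_add le_rfl))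
    (mul_le_mul' le_rfl le_self_add)

end Inside

/-! ### Decay away from the cube from vanishing moments. -/

section Outside

open scoped ContDiff

variable {n : ℕ} {𝕜 : Type*} [RCLike 𝕜] {N : ℕ} {Φ P : Rn n → ℝ}

/-- An integrable function supported in a cube, all of whose moments of order `< N` vanish. -/
structure HasVanishingMoments (N : ℕ) (x₀ : Rn n) (r : ℝ) (a : Rn n → 𝕜) : Prop where
  pos : 0 < r
  integrable : Integrable a volume
  support : ∀ᵐ y : Rn n, y ∉ cube x₀ r → a y = 0
  moments : ∀ α : Fin n → ℕ, ∑ i, α i < N →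
    ∫ y : Rn n, (∏ i, ((y i : ℝ) : 𝕜) ^ α i) * a y = 0

namespace HasVanishingMoments

variable {x₀ : Rn n} {r : ℝ} {a : Rn n → 𝕜}

lemma integrable_mul (h : HasVanishingMoments N x₀ r a) {g : Rn n → 𝕜} (hg : Continuous g) :
    Integrable (fun z => g z * a z) volume := by
  obtain ⟨C, hC⟩ := (isCompact_cube x₀ h.pos.le).exists_bound_of_continuousOn hg.continuousOn
  refine Integrable.mono' (h.integrable.norm.const_mul C)
    (hg.aestronglyMeasurable.mul h.integrable.aestronglyMeasurable) ?_
  filter_upwards [h.support] with z hz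
  by_cases hzc : z ∈ cube x₀ r
  · rw [norm_mul]
    exact mul_le_mul_of_nonneg_right (hC z hzc) (norm_nonneg _)
  · simp [hz hzc]

lemma integral_eval_mul (h : HasVanishingMoments N x₀ r a) (Q : MvPolynomial (Fin n) 𝕜)
    (hQ : Q.totalDegree < N) :
    ∫ z, MvPolynomial.eval (fun i => ((z i : ℝ) : 𝕜)) Q * a z = 0 := by
  simp only [MvPolynomial.eval_eq', Finset.sum_mul, mul_assoc]
  have hc : ∀ d : Fin n →₀ ℕ, Continuous fun z : Rn n => ∏ i, ((z i : ℝ) : 𝕜) ^ d i := by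
    intro d
    refine continuous_finsetProd _ fun i _ => ?_
    exact (RCLike.continuous_ofReal.comp (by fun_prop)).pow _
  rw [integral_finsetSum _ fun d _ => (h.integrable_mul (hc d)).const_mul _]
  refine Finset.sum_eq_zero fun d hd => ?_
  rw [integral_const_mul, h.moments d, mul_zero]
  refine lt_of_le_of_lt ?_ hQ
  have := MvPolynomial.le_totalDegree hd
  rwa [Finsupp.sum_fintype _ _ (fun _ => rfl)] at this

/-- As a function of z this is a polynomial of degree below N, hence annihilated by the moments. -/
lemma integral_taylorPoly (h : HasVanishingMoments N x₀ r a) (hN : 1 ≤ N) {U : Set (Rn n)}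
    (hU : IsOpen U) {K : Rn n → ℝ} (hK : ContDiffOn ℝ ∞ K U) {u : Rn n} (hu : u ∈ U) :
    Integrable (fun z => taylorPoly N (x₀ - z) K u • a z) volume ∧
      ∫ z, taylorPoly N (x₀ - z) K u • a z = 0 := by
  obtain ⟨c, hc⟩ : ∃ c : (k : ℕ) → (Fin k → Fin n) → ℝ, ∀ k I, c k I =
      ((k.factorial : ℝ))⁻¹ * dirD (List.ofFn fun j => stdVec (I j)) K u := ⟨_, fun _ _ => rfl⟩
  set Q : MvPolynomial (Fin n) 𝕜 := ∑ k ∈ Finset.range N, ∑ I : Fin k → Fin n,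
    MvPolynomial.C ((c k I : ℝ) : 𝕜) * (MvPolynomial.C ((-1) ^ k) *
    ∏ j, (MvPolynomial.X (I j) - MvPolynomial.C ((x₀ (I j) : ℝ) : 𝕜))) with hQ
  have hdeg : Q.totalDegree ≤ N - 1 := by
    refine MvPolynomial.totalDegree_finsetSum_le fun k hk => ?_
    refine MvPolynomial.totalDegree_finsetSum_le fun I _ => ?_
    refine (MvPolynomial.totalDegree_mul _ _).trans ?_
    have h1 := MvPolynomial.totalDegree_mul (MvPolynomial.C ((-1) ^ k))
      (∏ j, (MvPolynomial.X (I j) - MvPolynomial.C ((x₀ (I j) : ℝ) : 𝕜)))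
    have h2 := totalDegree_prod_X_sub_C_le I (fun i => ((x₀ i : ℝ) : 𝕜))
    have hk' := Finset.mem_range.1 hk
    rw [MvPolynomial.totalDegree_C] at h1 ⊢
    omega
  have he : (fun z : Rn n => taylorPoly N (x₀ - z) K u • a z) = fun z =>
      MvPolynomial.eval (fun i => ((z i : ℝ) : 𝕜)) Q * a z := by
    ext z
    rw [RCLike.real_smul_eq_coe_mul]
    congr 1
    rw [hQ, taylorPoly, RCLike.ofReal_sum]
    simp only [map_sum (MvPolynomial.eval _), map_mul (MvPolynomial.eval _), MvPolynomial.eval_C,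
      map_prod (MvPolynomial.eval _), map_sub (MvPolynomial.eval _), MvPolynomial.eval_X]
    refine Finset.sum_congr rfl fun k _ => ?_
    rw [dirD_replicate_eq_sum hU hK k _ hu, Finset.mul_sum, RCLike.ofReal_sum]
    refine Finset.sum_congr rfl fun I _ => ?_
    have : ∏ j, (((z (I j) : ℝ) : 𝕜) - ((x₀ (I j) : ℝ) : 𝕜)) =
        (-1) ^ k * ∏ j, (((x₀ - z) (I j) : ℝ) : 𝕜) := by
      have h1 : ∏ _j : Fin k, (-1 : 𝕜) = (-1) ^ k := by simp
      rw [← h1, ← Finset.prod_mul_distrib]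
      refine Finset.prod_congr rfl fun j _ => ?_
      simp
    rw [this, ← mul_assoc ((-1 : 𝕜) ^ k), ← mul_pow, hc]
    push_cast
    simp only [neg_mul, one_mul, neg_neg, one_pow]
    ring
  rw [he]
  refine ⟨h.integrable_mul ?_, h.integral_eval_mul Q (by omega)⟩
  refine (MvPolynomial.continuous_eval Q).comp (continuous_pi fun i => ?_)
  exact RCLike.continuous_ofReal.comp (by fun_prop)

/-- Vanishing moments allow to replace a kernel by its Taylor remainder at the centre. -/
lemma enorm_integral_le (h : HasVanishingMoments N x₀ r a) (hN : 1 ≤ N) {U : Set (Rn n)}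
    (hU : IsOpen U) {K : Rn n → ℝ} (hK : ContDiffOn ℝ ∞ K U) {y : Rn n} (hy : y - x₀ ∈ U)
    (hi : Integrable (fun z => K (y - z) • a z) volume) {B : ℝ}
    (hB : ∀ w : Rn n, ‖w‖ ≤ Real.sqrt n * r / 2 → |taylorRem N w K (y - x₀)| ≤ B) :
    ‖∫ z, K (y - z) • a z‖ₑ ≤ ENNReal.ofReal B * ∫⁻ z, ‖a z‖ₑ := by
  obtain ⟨h1, h2⟩ := h.integral_taylorPoly hN hU hK hy
  have e : ∫ z, K (y - z) • a z = ∫ z, taylorRem N (x₀ - z) K (y - x₀) • a z := by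
    rw [← sub_zero (∫ z, K (y - z) • a z), ← h2, ← integral_sub hi h1]
    refine integral_congr_ae (ae_of_all _ fun z => ?_)
    simp only [taylorRem, sub_smul]
    rw [show y - x₀ + (x₀ - z) = y - z by abel]
  rw [e, ← lintegral_const_mul' _ _ ENNReal.ofReal_ne_top]
  refine (enorm_integral_le_lintegral_enorm _).trans (lintegral_mono_ae ?_)
  filter_upwards [h.support] with z hz
  by_cases hzc : z ∈ cube x₀ r
  · rw [enorm_real_smul]
    gcongr
    refine hB _ ?_
    rw [norm_sub_rev]
    exact norm_le_of_mem_cube h.pos.le hzc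
  · simp [hz hzc]

lemma sqrt_mul_pos [NeZero n] (h : HasVanishingMoments N x₀ r a) : 0 < Real.sqrt n * r / 2 := by
  have h1 : (0 : ℝ) < n := by exact_mod_cast NeZero.pos n
  have h2 := Real.sqrt_pos.2 h1
  have h3 := h.pos
  positivity

lemma rieszInt_ne_top [NeZero n] (h : HasVanishingMoments N x₀ r a) {y : Rn n}
    (hy : 2 * (Real.sqrt n * r / 2) ≤ ‖y - x₀‖) : rieszInt a y ≠ ⊤ := by
  refine rieszInt_ne_top_of_support h.integrable h.sqrt_mul_pos ?_
  filter_upwards [h.support] with z hz hzy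
  refine hz fun hzc => ?_
  have h1 := norm_le_of_mem_cube h.pos.le hzc
  have h2 : ‖y - x₀‖ ≤ ‖z - y‖ + ‖z - x₀‖ := by
    rw [norm_sub_rev z y]; simpa using norm_add_le (y - z) (z - x₀)
  linarith

end HasVanishingMoments

/-- Decay of the derivatives of the potential far from the support. -/
lemma LogHomogeneous.exists_dirD_integral_le [NeZero n] (H : LogHomogeneous N Φ P) (hN : 1 ≤ N)
    {k : ℕ} (hk : k < N) :
    ∃ C : ℝ, 0 ≤ C ∧ ∀ (a : Rn n → 𝕜) (x₀ : Rn n) (r : ℝ), HasVanishingMoments N x₀ r a →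
      ∀ y : Rn n, 2 * (Real.sqrt n * r / 2) ≤ ‖y - x₀‖ → ∀ l : List (Rn n), l.length = k →
      ‖∫ z, dirD l Φ (y - z) • a z‖ₑ ≤ ENNReal.ofReal
        (C * (l.map norm).prod * (Real.sqrt n * r / 2) ^ N / ‖y - x₀‖ ^ (n + k)) *
        ∫⁻ z, ‖a z‖ₑ := by
  obtain ⟨C, hC0, hC⟩ := H.exists_taylorRem_far_bound (M := N) (k := k) (j := k) hN rfl
  refine ⟨C, hC0, fun a x₀ r h y hy l hl => ?_⟩
  have hs := h.sqrt_mul_pos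
  have hne : y - x₀ ≠ 0 := norm_pos_iff.1 (lt_of_lt_of_le (by linarith) hy)
  refine h.enorm_integral_le hN isOpen_ne_zero (dirD_contDiffOn isOpen_ne_zero H.smooth l) hne
    (H.integrable_dirD_smul h.integrable h.pos h.support (h.rieszInt_ne_top hy) l (by omega)) ?_
  intro w hw
  have hp := prod_map_norm_nonneg l
  refine (hC l (y - x₀) w hl hne (by linarith)).trans ?_
  gcongr

/-- Bound of the potential minus its Taylor polynomial at points far from the support. -/
lemma LogHomogeneous.exists_outside_bound [NeZero n] (H : LogHomogeneous N Φ P) (hN : 1 ≤ N) :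
    ∃ C : ℝ, 0 ≤ C ∧ ∀ (a : Rn n → 𝕜) (x₀ : Rn n) (r : ℝ), HasVanishingMoments N x₀ r a →
      ∀ x : Rn n, 4 * (Real.sqrt n * r / 2) ≤ ‖x - x₀‖ → ∀ y : Rn n,
      ‖(∫ z, Φ (y - z) • a z) -
          MvPolynomial.eval (fun i => ((y i : ℝ) : 𝕜)) (potentialPoly N Φ a x)‖ₑ ≤
        ENNReal.ofReal (C * ‖y - x‖ ^ N) *
          (ENNReal.ofReal ((Real.sqrt n * r / 2) ^ N / ‖x - x₀‖ ^ (n + N)) * (∫⁻ z, ‖a z‖ₑ) +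
            {y | ‖x - x₀‖ < 4 * ‖y - x‖}.indicator (fun y => ENNReal.ofReal ((‖x - x₀‖ ^ N)⁻¹) *
              ‖∫ z, Φ (y - z) • a z‖ₑ) y) := by
  obtain ⟨C₁, hC₁, near⟩ := H.exists_taylorRem_taylorRem_bound hN
  have hk : ∀ k : Fin N, _ := fun k => H.exists_dirD_integral_le (𝕜 := 𝕜) hN k.2
  choose C₂ hC₂ far using hk
  have hsum : 0 ≤ ∑ k, C₂ k := Finset.sum_nonneg fun k _ => hC₂ k
  refine ⟨C₁ + (1 + ∑ k, C₂ k) * 4 ^ N, by positivity, fun a x₀ r h x hx y => ?_⟩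
  set s := Real.sqrt n * r / 2 with hs
  set D := ‖x - x₀‖ with hD
  have hs0 : 0 < s := h.sqrt_mul_pos
  have hD0 : 0 < D := by linarith
  have hx2 : 2 * s ≤ ‖x - x₀‖ := by linarith
  have hrx := h.rieszInt_ne_top hx2
  have hne : x - x₀ ≠ 0 := norm_pos_iff.1 hD0
  -- If y is far from x relative to D, the potential and the polynomial are bounded separately;
  -- otherwise both expansions are combined.
  by_cases hy : D < 4 * ‖y - x‖
  · rw [Set.indicator_of_mem (show y ∈ {y | D < 4 * ‖y - x‖} from hy)]
    have hbase : 1 ≤ 4 * ‖y - x‖ / D := by rw [one_le_div hD0]; exact hy.le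
    -- Since 4|y - x|/D ≥ 1, all lower powers are absorbed into the N-th one.
    have hpow : ∀ k ≤ N, ‖y - x‖ ^ k / D ^ k ≤ 4 ^ N * (‖y - x‖ ^ N / D ^ N) := by
      intro k hkN
      rw [← div_pow, ← div_pow, ← mul_pow]
      calc (‖y - x‖ / D) ^ k ≤ (4 * ‖y - x‖ / D) ^ k := by
            gcongr; linarith [norm_nonneg (y - x)]
        _ ≤ (4 * ‖y - x‖ / D) ^ N := pow_le_pow_right₀ hbase hkN
        _ = _ := by rw [mul_div_assoc]
    have hint : ∀ l : List (Rn n), l.length < N → Integrable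
        (fun z => dirD l Φ (x - z) • a z) volume := fun l hl =>
      H.integrable_dirD_smul h.integrable h.pos h.support hrx l hl
    have b1 : ‖MvPolynomial.eval (fun i => ((y i : ℝ) : 𝕜)) (potentialPoly N Φ a x)‖ₑ ≤
        ENNReal.ofReal ((∑ k, C₂ k) * 4 ^ N * ‖y - x‖ ^ N) * (ENNReal.ofReal (s ^ N / D ^ (n + N)) *
          ∫⁻ z, ‖a z‖ₑ) := by
      rw [(eval_potentialPoly H.smooth hint y).2]
      simp only [taylorPoly, Finset.sum_smul, Finset.sum_range, ← smul_smul]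
      have hterm : ∀ k ∈ (Finset.univ : Finset (Fin N)), Integrable (fun z =>
          ((k : ℕ).factorial : ℝ)⁻¹ • (dirD (List.replicate k (y - x)) Φ (x - z) • a z)) volume :=
        fun k _ => (hint (List.replicate k (y - x))
          (by rw [List.length_replicate]; exact k.2)).smul ((k : ℕ).factorial : ℝ)⁻¹
      rw [integral_finsetSum _ hterm]
      refine (enorm_sum_le _ _).trans ?_
      rw [← mul_assoc, ← ENNReal.ofReal_mul (by positivity), Finset.sum_mul, Finset.sum_mul,
        Finset.sum_mul, ENNReal.ofReal_sum_of_nonneg (fun k _ => by have := hC₂ k; positivity),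
        Finset.sum_mul]
      refine Finset.sum_le_sum fun k _ => ?_
      have hCk := hC₂ k
      rw [integral_smul, enorm_real_smul, abs_of_pos (by positivity)]
      have h1 := far k a x₀ r h x hx2 (List.replicate k (y - x)) (by simp)
      rw [List.map_replicate, List.prod_replicate] at h1
      refine (mul_le_of_le_one_left' ?_).trans (h1.trans ?_)
      · rw [ENNReal.ofReal_le_one]
        exact inv_le_one_of_one_le₀ (Nat.one_le_cast.2 (Nat.factorial_pos _))
      · gcongr ENNReal.ofReal ?_ * _
        calc C₂ k * ‖y - x‖ ^ (k : ℕ) * s ^ N / D ^ (n + k)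
            = C₂ k * s ^ N / D ^ n * (‖y - x‖ ^ (k : ℕ) / D ^ (k : ℕ)) := by
              rw [pow_add]; field_simp
          _ ≤ C₂ k * s ^ N / D ^ n * (4 ^ N * (‖y - x‖ ^ N / D ^ N)) := by
              gcongr; exact hpow k k.2.le
          _ = _ := by rw [pow_add]; field_simp
    have b2 : ‖∫ z, Φ (y - z) • a z‖ₑ ≤ ENNReal.ofReal (4 ^ N * ‖y - x‖ ^ N) *
        (ENNReal.ofReal ((D ^ N)⁻¹) * ‖∫ z, Φ (y - z) • a z‖ₑ) := by
      rw [← mul_assoc, ← ENNReal.ofReal_mul (by positivity)]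
      refine le_mul_of_one_le_left' ?_
      rw [ENNReal.one_le_ofReal]
      have := hpow 0 (Nat.zero_le _)
      simpa [mul_assoc, div_eq_mul_inv] using this
    refine enorm_sub_le.trans ((add_le_add b2 b1).trans ?_)
    rw [mul_add, add_comm]
    refine add_le_add ?_ ?_
    · gcongr
      nlinarith [pow_pos (show (0 : ℝ) < 4 by norm_num) N]
    · gcongr
      nlinarith [pow_pos (show (0 : ℝ) < 4 by norm_num) N,
        mul_nonneg hsum (pow_pos (show (0 : ℝ) < 4 by norm_num) N).le]
  · rw [Set.indicator_of_notMem (show y ∉ {y | D < 4 * ‖y - x‖} from hy), add_zero]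
    rw [not_lt] at hy
    have hry : rieszInt a y ≠ ⊤ := by
      refine h.rieszInt_ne_top ?_
      have : D ≤ ‖y - x‖ + ‖y - x₀‖ := by
        rw [hD, norm_sub_rev y x]; simpa using norm_add_le (x - y) (y - x₀)
      linarith
    obtain ⟨hi, he⟩ := H.integral_sub_eval_potentialPoly hN h.integrable h.pos h.support hrx hry
    rw [he, ← mul_assoc, ← ENNReal.ofReal_mul (by positivity)]
    -- The remainder in the direction y - x is itself a kernel evaluated at x - z, smooth on V.
    -- Expanding it about x - x₀ with the moments leaves the mixed remainder, with |w| ≤ s ≤ D/4.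
    set V : Set (Rn n) := {0}ᶜ ∩ {v | v + (y - x) ∈ ({0}ᶜ : Set (Rn n))} with hV
    have hVo : IsOpen V := isOpen_ne_zero.inter (isOpen_ne_zero.preimage (by fun_prop))
    have hxV : x - x₀ ∈ V := by
      refine ⟨hne, fun h0 => ?_⟩
      have h1 : x - x₀ = -(y - x) := eq_neg_of_add_eq_zero_left (Set.mem_singleton_iff.1 h0)
      have h2 : D = ‖y - x‖ := by rw [hD, h1, norm_neg]
      linarith
    refine h.enorm_integral_le hN hVo (taylorRem_contDiffOn isOpen_ne_zero H.smooth N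
      Set.inter_subset_left fun v hv => hv.2) hxV hi ?_
    intro w hw
    refine (near (x - x₀) (y - x) w hne hy (by linarith)).trans ?_
    calc C₁ * ‖y - x‖ ^ N * ‖w‖ ^ N / ‖x - x₀‖ ^ (n + N)
        ≤ C₁ * ‖y - x‖ ^ N * s ^ N / D ^ (n + N) := by gcongr
      _ ≤ (C₁ + (1 + ∑ k, C₂ k) * 4 ^ N) * ‖y - x‖ ^ N * s ^ N / D ^ (n + N) := by
        gcongr
        have : 0 ≤ (1 + ∑ k, C₂ k) * 4 ^ N := by positivity
        linarith
      _ = _ := by ring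

end Outside

/-! ### The global L^q norm of the potential. -/

section GlobalIntegrability

open scoped ContDiff

variable {n : ℕ} {𝕜 : Type*} [RCLike 𝕜] {N : ℕ} {Φ P : Rn n → ℝ}

lemma avg_eq_ofReal (z : Rn n) {ρ : ℝ} (hρ : 0 < ρ) (f : Rn n → ℝ≥0∞) :
    avg (cube z ρ) f = ENNReal.ofReal ((ρ ^ n)⁻¹) * ∫⁻ y in cube z ρ, f y := by
  rw [avg, volume_cube z hρ.le, ENNReal.ofReal_inv_of_pos (by positivity)]

/-- Bound of `η` at points far from the support. -/
lemma LogHomogeneous.exists_eta_outside_le [NeZero n] (H : LogHomogeneous N Φ P) (hN : 1 ≤ N)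
    {q : ℝ} (hq : 1 ≤ q) :
    ∃ C : ℝ, 0 ≤ C ∧ ∀ (a : Rn n → 𝕜) (x₀ : Rn n) (r : ℝ), HasVanishingMoments N x₀ r a →
      ∀ x : Rn n, 4 * (Real.sqrt n * r / 2) ≤ ‖x - x₀‖ →
      eta q N (fun y => (∫ z, Φ (y - z) • a z) -
          MvPolynomial.eval (fun i => ((y i : ℝ) : 𝕜)) (potentialPoly N Φ a x)) x ≤
        ENNReal.ofReal C *
          (ENNReal.ofReal ((Real.sqrt n * r / 2) ^ N / ‖x - x₀‖ ^ (n + N)) * (∫⁻ z, ‖a z‖ₑ) +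
            ENNReal.ofReal (‖x - x₀‖ ^ (-((N : ℝ) + n / q))) *
              (∫⁻ y, ‖∫ z, Φ (y - z) • a z‖ₑ ^ q) ^ (1 / q)) := by
  have hq0 : 0 < q := by linarith
  obtain ⟨C, hC0, hC⟩ := H.exists_outside_bound (𝕜 := 𝕜) hN
  set c : ℝ := 2 * Real.sqrt n with hc
  have hn0 : (0 : ℝ) < n := by exact_mod_cast NeZero.pos n
  have hc0 : 0 < c := by have := Real.sqrt_pos.2 hn0; positivity
  refine ⟨2 * (C * (Real.sqrt n / 2) ^ N) * (1 + c ^ ((n : ℝ) / q)), by positivity,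
    fun a x₀ r h x hx => ?_⟩
  have hs0 := h.sqrt_mul_pos
  set D := ‖x - x₀‖ with hD
  have hD0 : 0 < D := by linarith
  set S : ℝ≥0∞ := ENNReal.ofReal ((Real.sqrt n * r / 2) ^ N / D ^ (n + N)) * (∫⁻ z, ‖a z‖ₑ) with hS
  set B : ℝ≥0∞ := ∫⁻ y, ‖∫ z, Φ (y - z) • a z‖ₑ ^ q with hB
  have key := eta_le_of_bound hq (N := N) (x := x) (C := C * (Real.sqrt n / 2) ^ N)
    (g := fun y => (∫ z, Φ (y - z) • a z) -
      MvPolynomial.eval (fun i => ((y i : ℝ) : 𝕜)) (potentialPoly N Φ a x))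
    (S := S) (Y := ENNReal.ofReal ((c / D) ^ n) * (ENNReal.ofReal ((D ^ N)⁻¹) ^ q * B))
    (F := {y | D < 4 * ‖y - x‖}.indicator (fun y => ENNReal.ofReal ((D ^ N)⁻¹) *
              ‖∫ z, Φ (y - z) • a z‖ₑ)) (by positivity) (by
      intro ρ hρ y hy
      refine (hC a x₀ r h x hx y).trans ?_
      gcongr ENNReal.ofReal ?_ * _
      rw [mul_assoc, ← mul_pow]
      gcongr
      refine (norm_le_of_mem_cube hρ.le hy).trans_eq ?_
      ring) (by
      intro ρ hρ
      -- Points of the cube satisfy 4|y - x| ≤ cρ, so the indicator vanishes there when cρ ≤ D; for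
      -- larger cubes ρ^(-n) is at most (c/D)^n.
      by_cases hρD : c * ρ ≤ D
      · refine (avg_le_of_le _ 0 x hρ fun y hy => ?_).trans zero_le
        have h1 := norm_le_of_mem_cube hρ.le hy
        rw [Set.indicator_of_notMem, ENNReal.zero_rpow_of_pos hq0]
        change ¬(D < 4 * ‖y - x‖)
        rw [not_lt]
        linarith
      · rw [not_le] at hρD
        rw [avg_eq_ofReal x hρ]
        gcongr ?_ * ?_
        · refine ENNReal.ofReal_le_ofReal ?_
          rw [← inv_pow]
          refine pow_le_pow_left₀ (by positivity) ?_ n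
          rw [inv_eq_one_div, div_le_div_iff₀ hρ hD0]
          linarith
        · rw [hB, ← lintegral_const_mul' _ _ (ENNReal.rpow_ne_top_of_nonneg hq0.le
            ENNReal.ofReal_ne_top)]
          refine (setLIntegral_le_lintegral _ _).trans (lintegral_mono fun y => ?_)
          rw [← ENNReal.mul_rpow_of_nonneg _ _ hq0.le]
          exact ENNReal.rpow_le_rpow (Set.indicator_le_self _ _ _) hq0.le)
  refine key.trans ?_
  have e1 : (ENNReal.ofReal ((c / D) ^ n) * (ENNReal.ofReal ((D ^ N)⁻¹) ^ q * B)) ^ (1 / q) =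
      ENNReal.ofReal (c ^ ((n : ℝ) / q)) * (ENNReal.ofReal (D ^ (-((N : ℝ) + n / q))) *
        B ^ (1 / q)) := by
    rw [ENNReal.mul_rpow_of_nonneg _ _ (by positivity), ENNReal.mul_rpow_of_nonneg _ _
      (by positivity), ← ENNReal.rpow_mul, mul_one_div_cancel hq0.ne', ENNReal.rpow_one,
      ← mul_assoc, ← mul_assoc, ENNReal.ofReal_rpow_of_nonneg (by positivity) (by positivity),
      ← ENNReal.ofReal_mul (by positivity), ← ENNReal.ofReal_mul (by positivity)]
    congr 2
    rw [← Real.rpow_natCast (c / D), ← Real.rpow_mul (by positivity), mul_one_div,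
      Real.div_rpow hc0.le hD0.le, neg_add, Real.rpow_add hD0, Real.rpow_neg hD0.le,
      Real.rpow_neg hD0.le, Real.rpow_natCast]
    field_simp
  rw [e1]
  set Z : ℝ≥0∞ := ENNReal.ofReal (D ^ (-((N : ℝ) + n / q))) * B ^ (1 / q) with hZ
  rw [ENNReal.ofReal_mul (p := 2 * (C * (Real.sqrt n / 2) ^ N)) (by positivity), mul_assoc]
  gcongr
  rw [mul_add]
  gcongr
  · refine le_mul_of_one_le_left' ?_
    rw [ENNReal.one_le_ofReal]
    have : 0 ≤ c ^ ((n : ℝ) / q) := by positivity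
    linarith
  · linarith

/-- The `L^q` norm of the potential away from the support. -/
lemma LogHomogeneous.exists_lintegral_tail_le [NeZero n] (H : LogHomogeneous N Φ P) (hN : 1 ≤ N)
    {q : ℝ} (hq : 1 < q) :
    ∃ C : ℝ, 0 ≤ C ∧ ∀ (a : Rn n → 𝕜) (x₀ : Rn n) (r : ℝ), HasVanishingMoments N x₀ r a →
      ∫⁻ y in {y | 2 * (Real.sqrt n * r / 2) ≤ ‖y - x₀‖}, ‖∫ z, Φ (y - z) • a z‖ₑ ^ q ≤
        (ENNReal.ofReal (C * (Real.sqrt n * r / 2) ^ ((N : ℝ) - n + n / q)) *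
          ∫⁻ z, ‖a z‖ₑ) ^ q := by
  have hq0 : 0 < q := by linarith
  have hn0 : (0 : ℝ) < n := by exact_mod_cast NeZero.pos n
  obtain ⟨C, hC0, hC⟩ := H.exists_dirD_integral_le (𝕜 := 𝕜) hN (k := 0) (by omega)
  -- The q-th power of the decay |y - x₀|^(-n); its exponent exceeds n because q > 1.
  obtain ⟨C', hC0', hC'⟩ := exists_lintegral_far_le (n := n) (β := n * q) (by nlinarith)
  refine ⟨C * (C' * 2 ^ ((n : ℝ) - n * q)) ^ (1 / q), by positivity, fun a x₀ r h => ?_⟩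
  have hs0 := h.sqrt_mul_pos
  set s := Real.sqrt n * r / 2 with hs
  have hms : MeasurableSet {y : Rn n | 2 * s ≤ ‖y - x₀‖} :=
    measurableSet_le measurable_const (by fun_prop)
  have h1 := hC' (fun _ => 1) aemeasurable_const x₀ (2 * s) (by positivity)
  calc _ ≤ ∫⁻ y in {y | 2 * s ≤ ‖y - x₀‖}, (ENNReal.ofReal (C * s ^ N) * ∫⁻ z, ‖a z‖ₑ) ^ q *
        (ENNReal.ofReal (‖y - x₀‖ ^ (-((n : ℝ) * q))) * 1) := by
        refine setLIntegral_mono' hms fun y hy => ?_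
        have h2 := hC a x₀ r h y hy [] rfl
        have hy0 : 0 < ‖y - x₀‖ :=
          lt_of_lt_of_le (by positivity) (show 2 * s ≤ ‖y - x₀‖ from hy)
        rw [List.map_nil, List.prod_nil, mul_one, add_zero, div_eq_mul_inv,
          ENNReal.ofReal_mul (by positivity)] at h2
        refine (ENNReal.rpow_le_rpow h2 hq0.le).trans_eq ?_
        rw [mul_right_comm, ENNReal.mul_rpow_of_nonneg _ _ hq0.le, mul_one,
          ENNReal.ofReal_rpow_of_nonneg (by positivity) hq0.le]
        congr 2
        rw [neg_mul_eq_neg_mul, Real.rpow_mul hy0.le, Real.rpow_neg hy0.le, Real.rpow_natCast]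
    _ = (ENNReal.ofReal (C * s ^ N) * ∫⁻ z, ‖a z‖ₑ) ^ q *
        ∫⁻ y in {y | 2 * s ≤ ‖y - x₀‖}, ENNReal.ofReal (‖y - x₀‖ ^ (-((n : ℝ) * q))) * 1 := by
        rw [lintegral_const_mul' _ _ (ENNReal.rpow_ne_top_of_nonneg hq0.le
          (ENNReal.mul_ne_top ENNReal.ofReal_ne_top h.integrable.2.ne))]
    _ ≤ (ENNReal.ofReal (C * s ^ N) * ∫⁻ z, ‖a z‖ₑ) ^ q *
        (ENNReal.ofReal (C' * (2 * s) ^ ((n : ℝ) - n * q)) * 1) := by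
        gcongr
        refine h1.trans ?_
        gcongr
        exact maximal_le_of_le _ _ (fun _ => le_rfl) _
    _ = _ := by
        have e : ENNReal.ofReal (C' * (2 * s) ^ ((n : ℝ) - n * q)) =
            ENNReal.ofReal ((C' * 2 ^ ((n : ℝ) - n * q)) ^ (1 / q) * s ^ (-(n : ℝ) + n / q)) ^ q := by
          rw [ENNReal.ofReal_rpow_of_nonneg (by positivity) hq0.le,
            Real.mul_rpow (x := (C' * 2 ^ ((n : ℝ) - n * q)) ^ (1 / q)) (by positivity)
              (by positivity), ← Real.rpow_mul (by positivity), one_div_mul_cancel hq0.ne',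
            Real.rpow_one, ← Real.rpow_mul hs0.le, Real.mul_rpow (by norm_num) hs0.le, mul_assoc]
          congr 4
          field_simp
          ring
        rw [mul_one, e, ← ENNReal.mul_rpow_of_nonneg _ _ hq0.le, mul_right_comm,
          ← ENNReal.ofReal_mul (by positivity)]
        congr 3
        rw [show (N : ℝ) - n + n / q = N + (-(n : ℝ) + n / q) by ring,
          Real.rpow_add hs0 N, Real.rpow_natCast]
        ring

/-- Young's inequality for a convolution of non-negative functions. -/
lemma lintegral_conv_rpow_le {q p σ : ℝ} (hp : 1 ≤ p) (hpq : p ≤ q) (hσ : 0 < σ)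
    (hrel : 1 / σ = 1 + 1 / q - 1 / p) {K f : Rn n → ℝ≥0∞} (hK : Measurable K)
    (hf : AEMeasurable f volume) :
    ∫⁻ y, (∫⁻ z, K (y - z) * f z) ^ q ≤
      ((∫⁻ v, K v ^ σ) ^ (1 / σ) * (∫⁻ z, f z ^ p) ^ (1 / p)) ^ q := by
  have hp0 : 0 < p := by linarith
  have hq0 : 0 < q := by linarith
  have hpi : 1 / p ≤ 1 := by rw [div_le_one hp0]; exact hp
  have hqp : 1 / q ≤ 1 / p := one_div_le_one_div_of_le hp0 hpq
  have hqi : 0 < 1 / q := by positivity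
  set A := ∫⁻ v, K v ^ σ with hA
  set B := ∫⁻ z, f z ^ p with hB
  have htrans : ∀ y : Rn n, ∫⁻ z, K (y - z) ^ σ = A := fun y =>
    lintegral_sub_left_eq_self (fun v => K v ^ σ) y
  have hKy : ∀ y : Rn n, AEMeasurable (fun z => K (y - z) ^ σ) volume := fun y =>
    ((hK.comp (measurable_const.sub measurable_id)).pow_const σ).aemeasurable
  have hfp : AEMeasurable (fun z => f z ^ p) volume := hf.pow_const p
  have pt : ∀ y, ∫⁻ z, K (y - z) * f z ≤
      (∫⁻ z, K (y - z) ^ σ * f z ^ p) ^ (1 / q) * A ^ (1 - 1 / p) * B ^ (1 / p - 1 / q) := by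
    intro y
    -- Hölder for three factors with weights 1/q, 1 - 1/p and 1/p - 1/q; only the first factor still
    -- couples K and f.
    have := ENNReal.lintegral_prod_norm_pow_le (μ := (volume : Measure (Rn n))) Finset.univ
      (f := ![fun z => K (y - z) ^ σ * f z ^ p, fun z => K (y - z) ^ σ, fun z => f z ^ p])
      (p := ![1 / q, 1 - 1 / p, 1 / p - 1 / q]) (by
        intro i _
        fin_cases i
        · exact (hKy y).mul hfp
        · exact hKy y
        · exact hfp) (by rw [Fin.sum_univ_three]; simp; ring) (by
        intro i _
        fin_cases i
        · exact hqi.le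
        · exact sub_nonneg.2 hpi
        · exact sub_nonneg.2 hqp)
    simp only [Fin.prod_univ_three, Matrix.cons_val_zero, Matrix.cons_val_one,
      Matrix.cons_val, htrans] at this
    refine le_of_eq_of_le (lintegral_congr fun z => ?_) this
    rw [ENNReal.mul_rpow_of_nonneg _ _ hqi.le, ← ENNReal.rpow_mul, ← ENNReal.rpow_mul,
      ← ENNReal.rpow_mul, ← ENNReal.rpow_mul]
    have e1 : K (y - z) = K (y - z) ^ (σ * (1 / q)) * K (y - z) ^ (σ * (1 - 1 / p)) := by
      rw [← ENNReal.rpow_add_of_nonneg _ _ (by positivity)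
        (mul_nonneg hσ.le (sub_nonneg.2 hpi)), ← mul_add,
        show 1 / q + (1 - 1 / p) = 1 / σ by rw [hrel]; ring, mul_one_div_cancel hσ.ne',
        ENNReal.rpow_one]
    have e2 : f z = f z ^ (p * (1 / q)) * f z ^ (p * (1 / p - 1 / q)) := by
      rw [← ENNReal.rpow_add_of_nonneg _ _ (by positivity)
        (mul_nonneg hp0.le (sub_nonneg.2 hqp)), ← mul_add, add_sub_cancel,
        mul_one_div_cancel hp0.ne', ENNReal.rpow_one]
    conv_lhs => rw [e1, e2]
    ring
  have hprod : AEMeasurable (Function.uncurry fun y z : Rn n => K (y - z) ^ σ * f z ^ p)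
      (volume.prod volume) := by
    refine AEMeasurable.mul ?_ (hfp.comp_snd)
    exact ((hK.comp (measurable_fst.sub measurable_snd)).pow_const σ).aemeasurable
  have hdouble : ∫⁻ y, ∫⁻ z, K (y - z) ^ σ * f z ^ p = A * B := by
    rw [lintegral_lintegral_swap hprod]
    have : ∀ z, ∫⁻ y, K (y - z) ^ σ * f z ^ p = A * f z ^ p := by
      intro z
      have hKz : Measurable fun y => K (y - z) ^ σ :=
        (hK.comp (measurable_id.sub measurable_const)).pow_const σ
      rw [lintegral_mul_const _ hKz]
      congr 1
      exact lintegral_sub_right_eq_self (fun v => K v ^ σ) z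
    simp only [this]
    exact lintegral_const_mul'' _ hfp
  have hin : AEMeasurable (fun y => ∫⁻ z, K (y - z) ^ σ * f z ^ p) volume :=
    hprod.lintegral_prod_right'
  calc _ ≤ ∫⁻ y, (∫⁻ z, K (y - z) ^ σ * f z ^ p) *
        (A ^ (1 - 1 / p) * B ^ (1 / p - 1 / q)) ^ q := by
        refine lintegral_mono fun y => ?_
        refine (ENNReal.rpow_le_rpow (pt y) hq0.le).trans_eq ?_
        rw [mul_assoc, ENNReal.mul_rpow_of_nonneg _ _ hq0.le, ← ENNReal.rpow_mul,
          one_div_mul_cancel hq0.ne', ENNReal.rpow_one]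
    _ = (A * B) * (A ^ (1 - 1 / p) * B ^ (1 / p - 1 / q)) ^ q := by
        rw [lintegral_mul_const'' _ hin, hdouble]
    _ = ((A * B) ^ (1 / q) * (A ^ (1 - 1 / p) * B ^ (1 / p - 1 / q))) ^ q := by
        rw [ENNReal.mul_rpow_of_nonneg ((A * B) ^ (1 / q)) _ hq0.le, ← ENNReal.rpow_mul,
          one_div_mul_cancel hq0.ne', ENNReal.rpow_one]
    _ = _ := by
        congr 1
        rw [ENNReal.mul_rpow_of_nonneg _ _ hqi.le, mul_mul_mul_comm,
          ← ENNReal.rpow_add_of_nonneg _ _ hqi.le (sub_nonneg.2 hpi),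
          ← ENNReal.rpow_add_of_nonneg _ _ hqi.le (sub_nonneg.2 hqp), hrel]
        congr 2 <;> ring

/-- The potential near the support, with the logarithmic part removed by the moments. -/
lemma LogHomogeneous.exists_enorm_potential_le [NeZero n] (H : LogHomogeneous N Φ P) (hN : 1 ≤ N)
    {β : ℝ} (hβ : (n : ℝ) - N < β) :
    ∃ C : ℝ, 0 ≤ C ∧ ∀ (a : Rn n → 𝕜) (x₀ : Rn n) (r : ℝ), HasVanishingMoments N x₀ r a →
      ∀ y : Rn n, ‖y - x₀‖ ≤ 2 * (Real.sqrt n * r / 2) →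
      ‖∫ z, Φ (y - z) • a z‖ₑ ≤
        ENNReal.ofReal (C * (Real.sqrt n * r / 2) ^ ((N : ℝ) - n + β)) *
        ∫⁻ z, (Metric.closedBall 0 (3 * (Real.sqrt n * r / 2))).indicator
          (fun v : Rn n => ENNReal.ofReal (‖v‖ ^ (-β))) (y - z) * ‖a z‖ₑ := by
  obtain ⟨C, hC0, hC⟩ := H.exists_bound_near 0 (β := β) (L := 3)
    (by rw [Nat.cast_zero, add_zero]; exact hβ) (by norm_num)
  refine ⟨C, hC0, fun a x₀ r h y hy => ?_⟩
  have hs0 := h.sqrt_mul_pos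
  set s := Real.sqrt n * r / 2 with hs
  -- Without integrability the integral is 0 by convention, and nothing is to be shown.
  by_cases hi : Integrable (fun z => Φ (y - z) • a z) volume
  swap
  · rw [integral_undef hi]; simp
  -- Rescaling by s isolates a term log s · P((y - z)/s), a polynomial of degree below N in z; the
  -- moments remove it, so no factor log s survives.
  set K : Rn n → ℝ := fun v => P (s⁻¹ • v) with hK
  have hKs : ContDiff ℝ ∞ K := H.smooth_log.comp (contDiff_const_smul _)
  have hPi : Integrable (fun z => K (y - z) • a z) volume := by
    have := h.integrable_mul (g := fun z => ((K (y - z) : ℝ) : 𝕜))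
      (RCLike.continuous_ofReal.comp (hKs.continuous.comp (by fun_prop)))
    simpa only [RCLike.real_smul_eq_coe_mul] using this
  have hP0 : ∫ z, K (y - z) • a z = 0 := by
    have := h.enorm_integral_le hN isOpen_univ hKs.contDiffOn (Set.mem_univ (y - x₀)) hPi (B := 0)
      (fun w _ => by
        refine abs_taylorRem_le isOpen_univ hKs.contDiffOn (fun _ _ => Set.mem_univ _) hN ?_
        intro t _
        rw [hK, dirD_comp_smul, H.vanish _ _ (by simp)]
        simp)
    simpa using this
  have hΦ : ∀ᵐ z : Rn n, (s ^ ((N : ℤ) - n) * Φ (s⁻¹ • (y - z))) • a z =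
      Φ (y - z) • a z - (s ^ ((N : ℤ) - n) * Real.log s) • (K (y - z) • a z) := by
    filter_upwards [ae_ne y] with z hz
    have hne : s⁻¹ • (y - z) ≠ 0 := smul_ne_zero (inv_ne_zero hs0.ne') (sub_ne_zero.2 hz.symm)
    have := H.scale s hs0 _ hne
    rw [smul_smul, mul_inv_cancel₀ hs0.ne', one_smul] at this
    rw [smul_smul, ← sub_smul, this]
    congr 1
    simp only [hK]
    ring
  have e : ∫ z, Φ (y - z) • a z = ∫ z, (s ^ ((N : ℤ) - n) * Φ (s⁻¹ • (y - z))) • a z := by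
    have hPi' : Integrable (fun z => (s ^ ((N : ℤ) - n) * Real.log s) • (K (y - z) • a z))
      volume := hPi.smul (s ^ ((N : ℤ) - n) * Real.log s)
    rw [integral_congr_ae hΦ, integral_sub hi hPi',
      integral_smul, hP0, smul_zero, sub_zero]
  rw [e, ← lintegral_const_mul' _ _ ENNReal.ofReal_ne_top]
  refine (enorm_integral_le_lintegral_enorm _).trans (lintegral_mono_ae ?_)
  filter_upwards [h.support, ae_ne y] with z hz hzy
  by_cases hzc : z ∈ cube x₀ r
  · have h1 := norm_le_of_mem_cube h.pos.le hzc
    have h2 : ‖y - z‖ ≤ 3 * s := by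
      have : ‖y - z‖ ≤ ‖y - x₀‖ + ‖z - x₀‖ := by
        rw [norm_sub_rev z x₀]; simpa using norm_add_le (y - x₀) (x₀ - z)
      linarith
    have hyz : y - z ≠ 0 := sub_ne_zero.2 hzy.symm
    have hyz0 : 0 < ‖y - z‖ := norm_pos_iff.2 hyz
    have hnorm : ‖s⁻¹ • (y - z)‖ = s⁻¹ * ‖y - z‖ := by
      rw [norm_smul, Real.norm_eq_abs, abs_of_pos (by positivity)]
    rw [Set.indicator_of_mem (by simpa using h2), enorm_real_smul, ← mul_assoc,
      ← ENNReal.ofReal_mul (by positivity)]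
    gcongr
    have h3 := hC [] rfl (s⁻¹ • (y - z)) (smul_ne_zero (inv_ne_zero hs0.ne') hyz) (by
      rw [hnorm, inv_mul_le_iff₀ hs0]; linarith)
    rw [dirD_nil, List.map_nil, List.prod_nil, mul_one, hnorm] at h3
    rw [abs_mul, abs_of_pos (zpow_pos hs0 _)]
    refine (mul_le_mul_of_nonneg_left h3 (zpow_pos hs0 _).le).trans_eq ?_
    rw [Real.mul_rpow (by positivity) hyz0.le, Real.inv_rpow hs0.le, ← Real.rpow_neg hs0.le,
      neg_neg, Real.rpow_add hs0, show (N : ℝ) - n = (((N : ℤ) - n : ℤ) : ℝ) by push_cast; ring,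
      Real.rpow_intCast]
    ring
  · simp [hz hzc]

/-- The `L^q` norm of the potential near the support. -/
lemma LogHomogeneous.exists_lintegral_inner_le [NeZero n] (H : LogHomogeneous N Φ P) (hN : 1 ≤ N)
    {q p : ℝ} (hp : 1 < p) (hpq : p ≤ q) (hpN : (n : ℝ) / p - n / q < N) :
    ∃ C : ℝ, 0 ≤ C ∧ ∀ (a : Rn n → 𝕜) (x₀ : Rn n) (r : ℝ), HasVanishingMoments N x₀ r a →
      ∫⁻ y in Metric.closedBall x₀ (2 * (Real.sqrt n * r / 2)), ‖∫ z, Φ (y - z) • a z‖ₑ ^ q ≤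
        (ENNReal.ofReal (C * (Real.sqrt n * r / 2) ^ ((N : ℝ) - n / p + n / q)) *
          (∫⁻ z, ‖a z‖ₑ ^ p) ^ (1 / p)) ^ q := by
  have hp0 : 0 < p := by linarith
  have hq0 : 0 < q := by linarith
  have hn0 : (0 : ℝ) < n := by exact_mod_cast NeZero.pos n
  have hpi : 1 / p < 1 := by rw [div_lt_one hp0]; exact hp
  set τ : ℝ := 1 + 1 / q - 1 / p with hτ
  have hτ0 : 0 < τ := by have : 0 < 1 / q := by positivity
                         rw [hτ]; linarith
  have hnτ : (n : ℝ) * τ = n + n / q - n / p := by rw [hτ]; ring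
  -- β > n - N dominates the kernel with its logarithm, and β < nτ makes |v|^(-β) locally in
  -- L^(1/τ), the space of Young's inequality. Such β exists exactly because n/p - n/q < N.
  obtain ⟨β, hβ1, hβ2⟩ := exists_between (show max 0 ((n : ℝ) - N) < n * τ from
    max_lt (by positivity) (by rw [hnτ]; linarith))
  obtain ⟨hβ0, hβN⟩ := max_lt_iff.1 hβ1
  obtain ⟨C, hC0, hC⟩ := H.exists_enorm_potential_le (𝕜 := 𝕜) hN hβN
  have hβτ : β / τ < n := by rw [div_lt_iff₀ hτ0]; exact hβ2
  obtain ⟨C', hC0', hC'⟩ := exists_lintegral_near_le (n := n) (β := β / τ) (by positivity) hβτ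
  refine ⟨C * (C' * 3 ^ ((n : ℝ) - β / τ)) ^ τ, by positivity, fun a x₀ r h => ?_⟩
  have hs0 := h.sqrt_mul_pos
  set s := Real.sqrt n * r / 2 with hs
  set K : Rn n → ℝ≥0∞ := (Metric.closedBall 0 (3 * s)).indicator
    (fun v : Rn n => ENNReal.ofReal (‖v‖ ^ (-β))) with hK
  have hKm : Measurable K :=
    (ENNReal.measurable_ofReal.comp (by fun_prop)).indicator measurableSet_closedBall
  have young := lintegral_conv_rpow_le hp.le hpq (σ := 1 / τ) (by positivity)
    (by rw [one_div_one_div]) hKm h.integrable.aestronglyMeasurable.enorm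
  rw [one_div_one_div] at young
  have hKσ : (∫⁻ v, K v ^ (1 / τ)) ^ τ ≤
      ENNReal.ofReal ((C' * 3 ^ ((n : ℝ) - β / τ)) ^ τ * s ^ ((n : ℝ) * τ - β)) := by
    have h1 : ∫⁻ v, K v ^ (1 / τ) ≤ ENNReal.ofReal (C' * (3 * s) ^ ((n : ℝ) - β / τ)) := by
      have h2 := hC' (fun _ => 1) aemeasurable_const 0 (3 * s) (by positivity)
      calc ∫⁻ v, K v ^ (1 / τ) = ∫⁻ v in Metric.closedBall (0 : Rn n) (3 * s),
            ENNReal.ofReal (‖v - 0‖ ^ (-(β / τ))) * 1 := by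
            rw [← lintegral_indicator measurableSet_closedBall]
            refine lintegral_congr fun v => ?_
            by_cases hv : v ∈ Metric.closedBall (0 : Rn n) (3 * s)
            · rw [hK, Set.indicator_of_mem hv, Set.indicator_of_mem hv,
                ENNReal.ofReal_rpow_of_nonneg (by positivity) (by positivity),
                ← Real.rpow_mul (norm_nonneg _), sub_zero, mul_one]
              congr 2
              ring
            · rw [hK, Set.indicator_of_notMem hv, Set.indicator_of_notMem hv,
                ENNReal.zero_rpow_of_pos (by positivity)]
        _ ≤ ENNReal.ofReal (C' * (3 * s) ^ ((n : ℝ) - β / τ)) * 1 := by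
            refine h2.trans ?_
            gcongr
            exact maximal_le_of_le _ _ (fun _ => le_rfl) _
        _ = _ := mul_one _
    refine (ENNReal.rpow_le_rpow h1 hτ0.le).trans_eq ?_
    rw [ENNReal.ofReal_rpow_of_nonneg (by positivity) hτ0.le,
      Real.mul_rpow (by norm_num : (0 : ℝ) ≤ 3) hs0.le, ← mul_assoc,
      Real.mul_rpow (by positivity) (by positivity), ← Real.rpow_mul hs0.le]
    congr 3
    field_simp
  have hpt : ∀ y ∈ Metric.closedBall x₀ (2 * s), ‖∫ z, Φ (y - z) • a z‖ₑ ^ q ≤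
      ENNReal.ofReal (C * s ^ ((N : ℝ) - n + β)) ^ q * (∫⁻ z, K (y - z) * ‖a z‖ₑ) ^ q := by
    intro y hy
    rw [← ENNReal.mul_rpow_of_nonneg _ _ hq0.le]
    exact ENNReal.rpow_le_rpow (hC a x₀ r h y (mem_closedBall_iff_norm.1 hy)) hq0.le
  calc _ ≤ ∫⁻ y in Metric.closedBall x₀ (2 * s),
        ENNReal.ofReal (C * s ^ ((N : ℝ) - n + β)) ^ q * (∫⁻ z, K (y - z) * ‖a z‖ₑ) ^ q :=
        setLIntegral_mono' measurableSet_closedBall hpt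
    _ ≤ ENNReal.ofReal (C * s ^ ((N : ℝ) - n + β)) ^ q * ∫⁻ y, (∫⁻ z, K (y - z) * ‖a z‖ₑ) ^ q := by
        rw [lintegral_const_mul' _ _ (ENNReal.rpow_ne_top_of_nonneg hq0.le ENNReal.ofReal_ne_top)]
        gcongr
        exact Measure.restrict_le_self
    _ ≤ ENNReal.ofReal (C * s ^ ((N : ℝ) - n + β)) ^ q *
        (ENNReal.ofReal ((C' * 3 ^ ((n : ℝ) - β / τ)) ^ τ * s ^ ((n : ℝ) * τ - β)) *
          (∫⁻ z, ‖a z‖ₑ ^ p) ^ (1 / p)) ^ q := by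
        gcongr
        refine young.trans (ENNReal.rpow_le_rpow ?_ hq0.le)
        gcongr
    _ = _ := by
        rw [← ENNReal.mul_rpow_of_nonneg _ _ hq0.le, ← mul_assoc,
          ← ENNReal.ofReal_mul (by positivity)]
        congr 3
        rw [show (N : ℝ) - n / p + n / q = (N - n + β) + (n * τ - β) by rw [hnτ]; ring,
          Real.rpow_add hs0 (N - n + β)]
        ring

end GlobalIntegrability

/-! ### Norms and moments of atoms. -/

section Atoms

variable {n : ℕ} {𝕜 : Type*} [RCLike 𝕜]

lemma integrable_of_memLp_of_support {a : Rn n → 𝕜} {p₀ : ℝ≥0∞} (hp₀ : 1 ≤ p₀) {x₀ : Rn n} {r : ℝ}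
    (hr : 0 < r) (ha : MemLp a p₀ volume) (hs : ∀ᵐ y : Rn n, y ∉ cube x₀ r → a y = 0) :
    Integrable a volume := by
  have : IsFiniteMeasure (volume.restrict (cube x₀ r)) :=
    ⟨by simpa using (volume_cube_ne_top x₀ hr).lt_top⟩
  have h1 : IntegrableOn a (cube x₀ r) volume := (ha.restrict _).integrable hp₀
  refine ((integrable_indicator_iff (measurableSet_cube x₀ r)).2 h1).congr ?_
  filter_upwards [hs] with y hy
  by_cases h : y ∈ cube x₀ r
  · rw [Set.indicator_of_mem h]
  · rw [Set.indicator_of_notMem h, hy h]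

variable {w : Rn n → ℝ≥0∞} {p : ℝ} {p₀ : ℝ≥0∞} {d : ℤ} {x₀ : Rn n} {r : ℝ} {a : Rn n → 𝕜}

lemma IsAtom.one_lt (h : IsAtom w p p₀ d x₀ r a) : 1 < p₀ := (le_max_left _ _).trans_lt h.lt_p₀

lemma IsAtom.hasVanishingMoments (h : IsAtom w p p₀ d x₀ r a) {m : ℕ}
    (hd : 2 * (m : ℤ) - 1 ≤ d) : HasVanishingMoments (2 * m) x₀ r a where
  pos := h.r_pos
  integrable := integrable_of_memLp_of_support h.one_lt.le h.r_pos h.memLp h.support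
  support := h.support
  moments α hα := h.moments α (by
    have : ((∑ i, α i : ℕ) : ℤ) < ((2 * m : ℕ) : ℤ) := by exact_mod_cast hα
    push_cast at this ⊢
    omega)

/-- Hölder on Q contributes |Q|^(1/p₁ - 1/p₀), which cancels the factor |Q|^(1/p₀) of the size
condition. -/
lemma IsAtom.lintegral_rpow_le (h : IsAtom w p p₀ d x₀ r a) {p₁ : ℝ} (hp₁ : 1 ≤ p₁)
    (hp₁₀ : ENNReal.ofReal p₁ ≤ p₀) :
    (∫⁻ z, ‖a z‖ₑ ^ p₁) ^ (1 / p₁) ≤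
      ENNReal.ofReal (r ^ ((n : ℝ) / p₁)) * wMeas w (cube x₀ r) ^ (-(1 / p)) := by
  have hp0 : 0 < p₁ := by linarith
  have hv0 := volume_cube_ne_zero x₀ h.r_pos
  have hvt := volume_cube_ne_top x₀ h.r_pos
  have hres : ∀ s : ℝ≥0∞, eLpNorm a s volume = eLpNorm a s (volume.restrict (cube x₀ r)) := by
    intro s
    rw [← eLpNorm_indicator_eq_eLpNorm_restrict (measurableSet_cube x₀ r)]
    refine eLpNorm_congr_ae ?_
    filter_upwards [h.support] with y hy
    by_cases hyc : y ∈ cube x₀ r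
    · rw [Set.indicator_of_mem hyc]
    · rw [Set.indicator_of_notMem hyc, hy hyc]
  have e1 : (∫⁻ z, ‖a z‖ₑ ^ p₁) ^ (1 / p₁) = eLpNorm a (ENNReal.ofReal p₁) volume := by
    rw [eLpNorm_eq_lintegral_rpow_enorm_toReal (by simpa using hp0) ENNReal.ofReal_ne_top,
      ENNReal.toReal_ofReal hp0.le]
  have h1 := eLpNorm_le_eLpNorm_mul_rpow_measure_univ hp₁₀
    (h.memLp.aestronglyMeasurable.restrict (s := cube x₀ r))
  rw [← hres, ← hres, Measure.restrict_apply_univ, ENNReal.toReal_ofReal hp0.le] at h1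
  rw [e1]
  refine h1.trans ((mul_le_mul_left h.size _).trans_eq ?_)
  rw [mul_right_comm, ← ENNReal.rpow_add _ _ hv0 hvt, ENNReal.toReal_div, ENNReal.toReal_one,
    add_sub_cancel, volume_cube x₀ h.r_pos.le, ENNReal.ofReal_rpow_of_nonneg
      (pow_nonneg h.r_pos.le n) (by positivity), ← Real.rpow_natCast,
    ← Real.rpow_mul h.r_pos.le, mul_one_div]

lemma IsAtom.wMeas_ne_top (h : IsAtom w p p₀ d x₀ r a) : wMeas w (cube x₀ r) ≠ ⊤ := by
  obtain ⟨s, -, hw, -⟩ := h.weight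
  exact (hw.locallyIntegrable _ (isCompact_cube x₀ h.r_pos.le)).ne

lemma IsAtom.wMeas_ne_zero (h : IsAtom w p p₀ d x₀ r a) : wMeas w (cube x₀ r) ≠ 0 := by
  obtain ⟨s, -, hw, -⟩ := h.weight
  intro h0
  rw [wMeas, lintegral_eq_zero_iff' hw.aemeasurable.restrict] at h0
  have h1 : ∀ᵐ x ∂(volume.restrict (cube x₀ r)), False := by
    filter_upwards [h0, ae_restrict_of_ae hw.pos] with x hx hx'
    exact hx'.ne' hx
  rw [Filter.eventually_false_iff_eq_bot, ae_eq_bot, Measure.restrict_eq_zero] at h1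
  exact volume_cube_ne_zero x₀ h.r_pos h1

lemma IsAtom.weightFactor_ne_top (h : IsAtom w p p₀ d x₀ r a) :
    wMeas w (cube x₀ r) ^ (-(1 / p)) ≠ ⊤ := by
  intro ht
  rcases ENNReal.rpow_eq_top_iff.1 ht with h1 | h1
  · exact h.wMeas_ne_zero h1.1
  · exact h.wMeas_ne_top h1.1

lemma IsAtom.weightFactor_ne_zero (h : IsAtom w p p₀ d x₀ r a) :
    wMeas w (cube x₀ r) ^ (-(1 / p)) ≠ 0 := by
  intro ht
  rcases ENNReal.rpow_eq_zero_iff.1 ht with h1 | h1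
  · exact h.wMeas_ne_zero h1.1
  · exact h.wMeas_ne_top h1.1

end Atoms

/-! ### The inequality in terms of the L^q norm of the potential. -/

section Conclusion

variable {n : ℕ} {𝕜 : Type*} [RCLike 𝕜]

/-- The pointwise inequality inside the dilated cube. -/
lemma exists_calderonN_le_inside [NeZero n] {m : ℕ} (hm : 1 ≤ m) {q : ℝ} (hq : 1 < q) :
    ∃ C : ℝ, 1 ≤ C ∧ ∀ (a : Rn n → 𝕜) (x₀ : Rn n) (r : ℝ), HasVanishingMoments (2 * m) x₀ r a →
      ∀ hb : potential m a ∈ LqLoc n 𝕜 q, ∀ x : Rn n,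
      calderonN q (2 * m) (2 * m - 1) (toEqk q (2 * m - 1) (potential m a) hb) x ≤
        ENNReal.ofReal C * (maximal (fun y => ‖a y‖ₑ) x +
          maximal (fun y => maximal (fun z => ‖a z‖ₑ) y ^ q) x ^ (1 / q) +
          ∑ α ∈ Finset.piAntidiag (Finset.univ : Finset (Fin n)) (2 * m), maxSingular m α a x) := by
  have hq0 : 0 < q := by linarith
  have hn1 : 1 ≤ n := NeZero.one_le
  have H := fundSol_logHomogeneous n m hn1
  obtain ⟨C, hC0, hC⟩ := H.exists_pointwise_bound (𝕜 := 𝕜) (by omega)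
  have hsq : 0 < Real.sqrt n / 2 := by
    have := Real.sqrt_pos.2 (show (0 : ℝ) < n by exact_mod_cast hn1)
    positivity
  refine ⟨2 * ((C + 1) * (Real.sqrt n / 2) ^ (2 * m)) + 1, by
    have : 0 ≤ 2 * ((C + 1) * (Real.sqrt n / 2) ^ (2 * m)) := by positivity
    linarith, fun a x₀ r h hb x => ?_⟩
  -- Where Ma(x) = ∞ the Taylor polynomial need not converge, but the right-hand side is infinite
  -- since the constant is positive.
  by_cases hx : maximal (fun y => ‖a y‖ₑ) x = ⊤
  · rw [hx, top_add, top_add, ENNReal.mul_top]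
    · exact le_top
    · simp only [ne_eq, ENNReal.ofReal_eq_zero, not_le]; positivity
  set T : ℝ≥0∞ := ∑ α ∈ Finset.piAntidiag (Finset.univ : Finset (Fin n)) (2 * m),
    maxSingular m α a x with hT
  have hTI : ∀ (ε : ℝ), 0 < ε → ∀ I : Fin (2 * m) → Fin n, ‖∫ z in {z | ε < ‖x - z‖},
        dirD (List.ofFn fun j => stdVec (I j)) (fundSol n m) (x - z) • a z‖ₑ ≤ T := by
    intro ε hε I
    refine le_trans ?_ (Finset.single_le_sum (f := fun α => maxSingular m α a x)
      (fun _ _ => zero_le) (multiIndex_mem_piAntidiag I))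
    refine le_iSup_of_le ε (le_iSup_of_le hε (le_of_eq ?_))
    congr 1
    refine setIntegral_congr_fun (measurableSet_lt measurable_const (by fun_prop)) fun z hz => ?_
    have hne : x - z ∈ ({0}ᶜ : Set (Rn n)) :=
      norm_pos_iff.1 (hε.trans (show ε < ‖x - z‖ from hz))
    rw [multiD_multiIndex isOpen_ne_zero H.smooth I hne, RCLike.real_smul_eq_coe_mul]
  have key := eta_le_of_bound hq.le (N := 2 * m) (x := x)
    (C := (C + 1) * (Real.sqrt n / 2) ^ (2 * m))
    (g := fun y => potential m a y -
      MvPolynomial.eval (fun i => ((y i : ℝ) : 𝕜)) (potentialPoly (2 * m) (fundSol n m) a x))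
    (S := maximal (fun y => ‖a y‖ₑ) x + T) (F := maximal fun z => ‖a z‖ₑ)
    (Y := maximal (fun y => maximal (fun z => ‖a z‖ₑ) y ^ q) x) (by positivity) (by
      intro ρ hρ y hy
      -- The constant is built from C + 1 so as to be positive; the bound is then trivial when Ma(y)
      -- = ∞.
      by_cases hMy : maximal (fun z => ‖a z‖ₑ) y = ⊤
      · rw [hMy, add_top, ENNReal.mul_top]
        · exact le_top
        · simp only [ne_eq, ENNReal.ofReal_eq_zero, not_le]; positivity
      · rw [potential_eq]
        refine (hC a x₀ r h.integrable h.pos h.support x y T hx hMy hTI).trans ?_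
        gcongr ENNReal.ofReal ?_ * _
        rw [mul_assoc, ← mul_pow]
        gcongr
        · linarith
        · refine (norm_le_of_mem_cube hρ.le hy).trans_eq ?_
          ring) (fun ρ hρ => avg_le_maximal _ hρ (mem_cube_self x hρ.le))
  have h1 := calderonN_le_eta_sub (γ := 2 * m) hb _
    (totalDegree_potentialPoly_le (2 * m) (fundSol n m) a x) x
  rw [Nat.cast_mul, Nat.cast_ofNat] at key
  refine h1.trans (key.trans ?_)
  rw [add_right_comm]
  gcongr
  linarith

/-- The pointwise inequality outside the dilated cube, given the `L^q` norm of the potential. -/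
lemma exists_calderonN_le_outside [NeZero n] {m : ℕ} (hm : 1 ≤ m) {q : ℝ} (hq : 1 < q) :
    ∃ C : ℝ, 0 ≤ C ∧ ∀ (a : Rn n → 𝕜) (x₀ : Rn n) (r : ℝ), HasVanishingMoments (2 * m) x₀ r a →
      ∀ (hb : potential m a ∈ LqLoc n 𝕜 q) (W β : ℝ≥0∞),
      ∫⁻ z, ‖a z‖ₑ ≤ ENNReal.ofReal (r ^ n) * W →
      ∫⁻ y, ‖potential m a y‖ₑ ^ q ≤ (β * (W * ENNReal.ofReal (r ^ (2 * (m : ℝ) + n / q)))) ^ q →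
      ∀ x : Rn n, 4 * (Real.sqrt n * r / 2) ≤ ‖x - x₀‖ →
      calderonN q (2 * m) (2 * m - 1) (toEqk q (2 * m - 1) (potential m a) hb) x ≤
        ENNReal.ofReal C * (1 + β) *
          (W * ENNReal.ofReal ((r / (3 * ‖x - x₀‖)) ^ (2 * (m : ℝ) + n / q))) := by
  have hq0 : 0 < q := by linarith
  have hn1 : 1 ≤ n := NeZero.one_le
  have hnR : (1 : ℝ) ≤ n := by exact_mod_cast hn1
  have H := fundSol_logHomogeneous n m hn1
  obtain ⟨C, hC0, hC⟩ := H.exists_eta_outside_le (𝕜 := 𝕜) (by omega) hq.le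
  set e : ℝ := 2 * (m : ℝ) + n / q with he
  have he0 : 0 ≤ e := by positivity
  refine ⟨C * ((1 + (Real.sqrt n / 2) ^ (2 * m)) * 3 ^ e), by positivity,
    fun a x₀ r h hb W β hA hB x hx => ?_⟩
  have hr := h.pos
  have hsn : 1 ≤ Real.sqrt n := Real.one_le_sqrt.2 hnR
  set D := ‖x - x₀‖ with hD
  have hrD : r ≤ D := by nlinarith
  have hD0 : 0 < D := hr.trans_le hrD
  have h1 := calderonN_le_eta_sub (γ := 2 * m) hb _
    (totalDegree_potentialPoly_le (2 * m) (fundSol n m) a x) x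
  have h2 := hC a x₀ r h x hx
  simp only [← potential_eq] at h2
  rw [Nat.cast_mul, Nat.cast_ofNat, ← he] at h2
  refine h1.trans (h2.trans ?_)
  have hpow : ENNReal.ofReal (3 ^ e) * ENNReal.ofReal ((r / (3 * D)) ^ e) =
      ENNReal.ofReal ((r / D) ^ e) := by
    rw [← ENNReal.ofReal_mul (by positivity), ← Real.mul_rpow (by norm_num) (by positivity)]
    congr 2
    field_simp
  have b1 : ENNReal.ofReal ((Real.sqrt n * r / 2) ^ (2 * m) / D ^ (n + 2 * m)) * (∫⁻ z, ‖a z‖ₑ) ≤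
      ENNReal.ofReal ((Real.sqrt n / 2) ^ (2 * m)) * (W * ENNReal.ofReal ((r / D) ^ e)) := by
    refine (mul_le_mul_right hA _).trans ?_
    rw [← mul_assoc, ← ENNReal.ofReal_mul (by positivity), mul_comm W, ← mul_assoc,
      ← ENNReal.ofReal_mul (by positivity)]
    gcongr ENNReal.ofReal ?_ * _
    calc (Real.sqrt n * r / 2) ^ (2 * m) / D ^ (n + 2 * m) * r ^ n
        = (Real.sqrt n / 2) ^ (2 * m) * (r / D) ^ (n + 2 * m) := by
          rw [div_pow r D, pow_add r, mul_div_right_comm, mul_pow]; ring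
      _ ≤ (Real.sqrt n / 2) ^ (2 * m) * (r / D) ^ e := by
          gcongr
          -- Since r ≤ D and n/q ≤ n, the decay of order n + 2m is stronger than the required 2m +
          -- n/q.
          rw [← Real.rpow_natCast (r / D)]
          refine Real.rpow_le_rpow_of_exponent_ge (by positivity) ((div_le_one hD0).2 hrD) ?_
          rw [he]
          push_cast
          have : (n : ℝ) / q ≤ n := div_le_self (by linarith) hq.le
          linarith
  have b2 : ENNReal.ofReal (D ^ (-e)) * (∫⁻ y, ‖potential m a y‖ₑ ^ q) ^ (1 / q) ≤
      β * (W * ENNReal.ofReal ((r / D) ^ e)) := by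
    calc _ ≤ ENNReal.ofReal (D ^ (-e)) * ((β * (W * ENNReal.ofReal (r ^ e))) ^ q) ^ (1 / q) := by
          gcongr
      _ = β * (W * (ENNReal.ofReal (r ^ e) * ENNReal.ofReal (D ^ (-e)))) := by
          rw [← ENNReal.rpow_mul, mul_one_div_cancel hq0.ne', ENNReal.rpow_one]; ring
      _ = _ := by
          rw [← ENNReal.ofReal_mul (by positivity), Real.rpow_neg hD0.le, ← div_eq_mul_inv,
            Real.div_rpow hr.le hD0.le]
  calc _ ≤ ENNReal.ofReal C * (ENNReal.ofReal ((Real.sqrt n / 2) ^ (2 * m)) *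
        (W * ENNReal.ofReal ((r / D) ^ e)) + β * (W * ENNReal.ofReal ((r / D) ^ e))) := by
        gcongr
    _ = ENNReal.ofReal C * (ENNReal.ofReal ((Real.sqrt n / 2) ^ (2 * m)) + β) *
        (W * ENNReal.ofReal ((r / D) ^ e)) := by ring
    _ ≤ ENNReal.ofReal C * (ENNReal.ofReal (1 + (Real.sqrt n / 2) ^ (2 * m)) * (1 + β)) *
        (W * ENNReal.ofReal ((r / D) ^ e)) := by
        gcongr
        rw [ENNReal.ofReal_add zero_le_one (by positivity), ENNReal.ofReal_one]
        calc _ ≤ ENNReal.ofReal ((Real.sqrt n / 2) ^ (2 * m)) + β +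
              (1 + ENNReal.ofReal ((Real.sqrt n / 2) ^ (2 * m)) * β) := le_self_add
          _ = _ := by ring
    _ = _ := by
        rw [← hpow, ENNReal.ofReal_mul hC0, ENNReal.ofReal_mul (by positivity)]
        ring

/-- The pointwise inequality, with an explicit dependence on the `L^q` norm of the potential. -/
lemma exists_calderonN_le_rhs [NeZero n] {m : ℕ} (hm : 1 ≤ m) {q μ : ℝ} (hq : 1 < q)
    (hμ : 0 < μ) :
    ∃ C : ℝ≥0, ∀ (w : Rn n → ℝ≥0∞) (p : ℝ) (a : Rn n → 𝕜) (x₀ : Rn n) (r : ℝ),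
      HasVanishingMoments (2 * m) x₀ r a → ∀ (hb : potential m a ∈ LqLoc n 𝕜 q) (β : ℝ≥0∞),
      ∫⁻ z, ‖a z‖ₑ ≤ ENNReal.ofReal (r ^ n) * wMeas w (cube x₀ r) ^ (-(1 / p)) →
      ∫⁻ y, ‖potential m a y‖ₑ ^ q ≤ (β * (wMeas w (cube x₀ r) ^ (-(1 / p)) *
        ENNReal.ofReal (r ^ (2 * (m : ℝ) + n / q)))) ^ q →
      ∀ x : Rn n,
      calderonN q (2 * m) (2 * m - 1) (toEqk q (2 * m - 1) (potential m a) hb) x ≤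
        C * (1 + β) * rhs m q μ p w x₀ r a x := by
  have hq0 : 0 < q := by linarith
  have hn0 : (0 : ℝ) < n := by exact_mod_cast NeZero.pos n
  obtain ⟨C₁, hC₁, inside⟩ := exists_calderonN_le_inside (n := n) (𝕜 := 𝕜) hm hq
  obtain ⟨C₂, hC₂, outside⟩ := exists_calderonN_le_outside (n := n) (𝕜 := 𝕜) hm hq
  refine ⟨Real.toNNReal (C₁ + C₂), fun w p a x₀ r h hb β hA hB x => ?_⟩
  set W := wMeas w (cube x₀ r) ^ (-(1 / p)) with hW
  change _ ≤ ENNReal.ofReal (C₁ + C₂) * (1 + β) * _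
  by_cases hx : x ∈ cube x₀ (4 * Real.sqrt n * r)
  · refine (inside a x₀ r h hb x).trans ?_
    rw [← mul_one (ENNReal.ofReal C₁)]
    gcongr
    · linarith
    · exact le_self_add
    · simp only [rhs, Set.indicator_of_mem hx, Pi.one_apply, one_mul]
      rw [add_assoc, add_assoc]
      exact add_le_add le_add_self le_rfl
  -- The cube 4√n Q contains the ball of radius 2√n r = 4s about x₀.
  · have hD : 4 * (Real.sqrt n * r / 2) ≤ ‖x - x₀‖ := by
      by_contra hlt
      refine hx ?_
      have := mem_cube_of_norm_le (not_le.1 hlt).le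
      convert this using 1
      ring_nf
    have hr := h.pos
    have hsn : 1 ≤ Real.sqrt n := Real.one_le_sqrt.2 (by exact_mod_cast NeZero.one_le)
    have hrD : r ≤ ‖x - x₀‖ := by nlinarith
    have hD0 : 0 < ‖x - x₀‖ := hr.trans_le hrD
    refine (outside a x₀ r h hb W β hA hB x hD).trans ?_
    gcongr
    · linarith
    · simp only [rhs]
      rw [add_assoc, add_assoc]
      refine le_trans ?_ le_self_add
      rw [← hW]
      gcongr W * ?_
      have hM1 := maximal_indicator_le_one (cube x₀ r) x
      have hM2 := le_maximal_indicator_cube hr hrD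
      calc ENNReal.ofReal ((r / (3 * ‖x - x₀‖)) ^ (2 * (m : ℝ) + n / q))
          = ENNReal.ofReal ((r / (3 * ‖x - x₀‖)) ^ n) ^ ((2 * (m : ℝ) + n / q) / n) := by
            rw [ENNReal.ofReal_rpow_of_nonneg (by positivity) (by positivity),
              ← Real.rpow_natCast, ← Real.rpow_mul (by positivity)]
            congr 2
            field_simp
        _ ≤ maximal ((cube x₀ r).indicator 1) x ^ ((2 * (m : ℝ) + n / q) / n) := by
            gcongr
        _ ≤ _ := by
            -- The estimate holds with exponent (2m + n/q)/n; as Mχ_Q ≤ 1, lowering the exponent by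
            -- μ/n only enlarges the power.
            refine ENNReal.rpow_le_rpow_of_exponent_ge hM1 ?_
            gcongr
            linarith

lemma aestronglyMeasurable_potential [NeZero n] (m : ℕ) {a : Rn n → 𝕜} (ha : Integrable a volume) :
    AEStronglyMeasurable (potential m a) volume := by
  have H := fundSol_logHomogeneous n m NeZero.one_le
  have e : potential m a = fun x => ∫ z, fundSol n m (x - z) • a z := funext (potential_eq m a)
  rw [e]
  have hm : AEStronglyMeasurable (fun u : Rn n × Rn n => fundSol n m (u.1 - u.2) • a u.2)
      (volume.prod volume) := by
    refine AEStronglyMeasurable.smul ?_ ha.aestronglyMeasurable.comp_snd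
    exact ((H.measurable_dirD []).comp (measurable_fst.sub measurable_snd)).aestronglyMeasurable
  exact hm.integral_prod_right'

lemma mem_LqLoc_of_lintegral_ne_top {q : ℝ} (hq : 0 < q) {f : Rn n → 𝕜}
    (hf : AEStronglyMeasurable f volume) (h : ∫⁻ y, ‖f y‖ₑ ^ q ≠ ⊤) : f ∈ LqLoc n 𝕜 q := by
  have : MemLp f (ENNReal.ofReal q) volume := by
    refine ⟨hf, ?_⟩
    rw [eLpNorm_lt_top_iff_lintegral_rpow_enorm_lt_top (by simpa using hq) ENNReal.ofReal_ne_top,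
      ENNReal.toReal_ofReal hq.le]
    exact h.lt_top
  exact fun K _ => this.restrict K

lemma lintegral_potential_le {m : ℕ} {a : Rn n → 𝕜} {q : ℝ} (x₀ : Rn n) (R : ℝ) :
    ∫⁻ y, ‖potential m a y‖ₑ ^ q ≤
      (∫⁻ y in Metric.closedBall x₀ R, ‖potential m a y‖ₑ ^ q) +
        ∫⁻ y in {y | R ≤ ‖y - x₀‖}, ‖potential m a y‖ₑ ^ q := by
  rw [← lintegral_add_compl _ (measurableSet_closedBall (x := x₀) (ε := R))]
  gcongr
  intro y hy
  rw [Set.mem_compl_iff, mem_closedBall_iff_norm, not_le] at hy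
  exact hy.le

end Conclusion

end CalderonHardy

end

/-! ### The two cases of the proposition. -/

theorem proposition3 {𝕜 : Type*} [RCLike 𝕜] (n m : ℕ) (hn : 1 ≤ n) (hm : 1 ≤ m)
    (q μ : ℝ) (hq : 1 < q) (hμ : 0 < μ) (hμm : μ < 2 * m) :
    -- a constant independent of the weight, the atom and the cube
    (∀ p₀ : ℝ≥0∞, 1 < p₀ → 1 / p₀ < ENNReal.ofReal (1 / q + 2 * m / n) →
      ∃ C : ℝ≥0, ∀ (w : Rn n → ℝ≥0∞) (p : ℝ) (d : ℤ) (x₀ : Rn n) (r : ℝ) (a : Rn n → 𝕜),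
        IsAtom w p p₀ d x₀ r a → 2 * (m : ℤ) - 1 ≤ d →
          ∃ hb : potential m a ∈ LqLoc n 𝕜 q, ∀ x : Rn n,
            calderonN q (2 * m) (2 * m - 1) (toEqk q (2 * m - 1) (potential m a) hb) x
              ≤ C * rhs m q μ p w x₀ r a x) ∧
    -- all other exponents `p₀` for which the class of the potential exists
    (∀ (p₀ : ℝ≥0∞) (w : Rn n → ℝ≥0∞) (p : ℝ) (d : ℤ) (x₀ : Rn n) (r : ℝ) (a : Rn n → 𝕜),
        IsAtom w p p₀ d x₀ r a → 2 * (m : ℤ) - 1 ≤ d →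
          ∀ hb : potential m a ∈ LqLoc n 𝕜 q, ∃ C : ℝ≥0, ∀ x : Rn n,
            calderonN q (2 * m) (2 * m - 1) (toEqk q (2 * m - 1) (potential m a) hb) x
              ≤ C * rhs m q μ p w x₀ r a x) := by
  have : NeZero n := ⟨by omega⟩
  have hq0 : 0 < q := by linarith
  have hn0 : (0 : ℝ) < n := by exact_mod_cast hn
  have H := fundSol_logHomogeneous n m hn
  obtain ⟨C, hC⟩ := exists_calderonN_le_rhs (n := n) (𝕜 := 𝕜) hm hq hμ
  obtain ⟨Ct, hCt0, tail⟩ := H.exists_lintegral_tail_le (𝕜 := 𝕜) (by omega) hq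
  simp only [← potential_eq] at tail
  have hsize : ∀ {p₀ : ℝ≥0∞} {w : Rn n → ℝ≥0∞} {p : ℝ} {d : ℤ} {x₀ : Rn n} {r : ℝ} {a : Rn n → 𝕜},
      IsAtom w p p₀ d x₀ r a →
      ∫⁻ z, ‖a z‖ₑ ≤ ENNReal.ofReal (r ^ n) * wMeas w (cube x₀ r) ^ (-(1 / p)) := by
    intro p₀ w p d x₀ r a h
    simpa using h.lintegral_rpow_le le_rfl (by simpa using h.one_lt.le)
  constructor
  · intro p₀ hp₀ hp₀q
    -- p₁ = min(p₀, q); the condition on p₀ becomes n/p₁ - n/q < 2m. It depends on p₀ and q alone,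
    -- so the constants taken from it are uniform in the atom.
    obtain ⟨p₁, hp₁, hp₁q, hp₁₀, hp₁m⟩ : ∃ p₁ : ℝ, 1 < p₁ ∧ p₁ ≤ q ∧ ENNReal.ofReal p₁ ≤ p₀ ∧
        (n : ℝ) / p₁ - n / q < (2 * m : ℕ) := by
      by_cases h : p₀ ≤ ENNReal.ofReal q
      · have ht : p₀ ≠ ⊤ := ne_top_of_le_ne_top ENNReal.ofReal_ne_top h
        have h1 : 1 < p₀.toReal := by
          rw [← ENNReal.toReal_one]; exact (ENNReal.toReal_lt_toReal (by simp) ht).2 hp₀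
        refine ⟨p₀.toReal, h1, ?_, (ENNReal.ofReal_toReal ht).le, ?_⟩
        · exact ENNReal.toReal_le_of_le_ofReal hq0.le h
        · rw [← ENNReal.ofReal_toReal ht, ← ENNReal.ofReal_one,
            ← ENNReal.ofReal_div_of_pos (by linarith),
            ENNReal.ofReal_lt_ofReal_iff (by positivity)] at hp₀q
          have h2 := mul_lt_mul_of_pos_left hp₀q hn0
          rw [mul_one_div, mul_add, mul_one_div, mul_div_cancel₀ _ hn0.ne'] at h2
          push_cast
          linarith
      · refine ⟨q, hq, le_rfl, (not_le.1 h).le, ?_⟩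
        rw [sub_self]
        exact_mod_cast (show 0 < 2 * m by omega)
    obtain ⟨Ci, hCi0, inner⟩ := H.exists_lintegral_inner_le (𝕜 := 𝕜) (by omega) hp₁ hp₁q hp₁m
    simp only [← potential_eq] at inner
    set κ : ℝ := Real.sqrt n / 2 with hκ
    have hκ0 : 0 < κ := by have := Real.sqrt_pos.2 hn0; positivity
    set β : ℝ≥0 := Real.toNNReal (Ci * κ ^ (((2 * m : ℕ) : ℝ) - n / p₁ + n / q)) +
      Real.toNNReal (Ct * κ ^ (((2 * m : ℕ) : ℝ) - n + n / q)) with hβ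
    refine ⟨C * (1 + β), fun w p d x₀ r a h hd => ?_⟩
    have hv := h.hasVanishingMoments hd
    have hr := h.r_pos
    set W := wMeas w (cube x₀ r) ^ (-(1 / p)) with hW
    set e : ℝ := 2 * (m : ℝ) + n / q with he
    have hs : Real.sqrt n * r / 2 = κ * r := by rw [hκ]; ring
    -- Applied with t = n/p₁ for the inner ball and t = n for the tail: the powers of r from the
    -- kernel and from the norm of a always combine to 2m + n/q.
    have scal : ∀ c t : ℝ, 0 ≤ c →
        ENNReal.ofReal (c * (κ * r) ^ (((2 * m : ℕ) : ℝ) - t + n / q)) *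
          (ENNReal.ofReal (r ^ t) * W) =
        ENNReal.ofReal (c * κ ^ (((2 * m : ℕ) : ℝ) - t + n / q)) * (W * ENNReal.ofReal (r ^ e)) := by
      intro c t hc
      rw [mul_comm W, ← mul_assoc, ← mul_assoc, ← ENNReal.ofReal_mul (by positivity),
        ← ENNReal.ofReal_mul (by positivity), Real.mul_rpow hκ0.le hr.le, mul_assoc, mul_assoc,
        mul_assoc, ← Real.rpow_add hr]
      congr 5
      rw [he]; push_cast; ring
    have hB : ∫⁻ y, ‖potential m a y‖ₑ ^ q ≤ (β * (W * ENNReal.ofReal (r ^ e))) ^ q := by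
      refine (lintegral_potential_le x₀ (2 * (Real.sqrt n * r / 2))).trans
        ((add_le_add (inner a x₀ r hv) (tail a x₀ r hv)).trans ?_)
      -- Superadditivity of t ↦ t^q merges the two regions.
      refine (ENNReal.add_rpow_le_rpow_add _ _ hq.le).trans (ENNReal.rpow_le_rpow ?_ hq0.le)
      rw [hs]
      have i1 := mul_le_mul_right (h.lintegral_rpow_le hp₁.le hp₁₀)
        (ENNReal.ofReal (Ci * (κ * r) ^ (((2 * m : ℕ) : ℝ) - n / p₁ + n / q)))
      have i2 := mul_le_mul_right (hsize h)
        (ENNReal.ofReal (Ct * (κ * r) ^ (((2 * m : ℕ) : ℝ) - n + n / q)))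
      rw [scal _ _ hCi0] at i1
      rw [← Real.rpow_natCast r n, scal _ _ hCt0] at i2
      refine (add_le_add i1 i2).trans_eq ?_
      rw [← add_mul, hβ, ENNReal.coe_add]
      rfl
    have hWt : W ≠ ⊤ := h.weightFactor_ne_top
    have hb : potential m a ∈ LqLoc n 𝕜 q := by
      refine mem_LqLoc_of_lintegral_ne_top hq0 (aestronglyMeasurable_potential m hv.integrable) ?_
      refine ne_top_of_le_ne_top (ENNReal.rpow_ne_top_of_nonneg hq0.le ?_) hB
      exact ENNReal.mul_ne_top ENNReal.coe_ne_top (ENNReal.mul_ne_top hWt ENNReal.ofReal_ne_top)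
    refine ⟨hb, fun x => ?_⟩
    have := hC w p a x₀ r hv hb β (hsize h) hB x
    simpa using this
  · intro p₀ w p d x₀ r a h hd hb
    have hv := h.hasVanishingMoments hd
    have hr := h.r_pos
    set W := wMeas w (cube x₀ r) ^ (-(1 / p)) with hW
    set e : ℝ := 2 * (m : ℝ) + n / q with he
    set V : ℝ≥0∞ := W * ENNReal.ofReal (r ^ e) with hV
    have hVt : V ≠ ⊤ := ENNReal.mul_ne_top h.weightFactor_ne_top ENNReal.ofReal_ne_top
    have hV0 : V ≠ 0 := mul_ne_zero h.weightFactor_ne_zero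
      (by simp only [ne_eq, ENNReal.ofReal_eq_zero, not_le]; positivity)
    set B := ∫⁻ y, ‖potential m a y‖ₑ ^ q with hB
    have hBt : B ≠ ⊤ := by
      refine ne_top_of_le_ne_top (ENNReal.add_ne_top.2 ⟨?_, ?_⟩)
        (lintegral_potential_le x₀ (2 * (Real.sqrt n * r / 2)))
      · have := (hb _ (isCompact_closedBall x₀ (2 * (Real.sqrt n * r / 2)))).2
        rw [eLpNorm_lt_top_iff_lintegral_rpow_enorm_lt_top (by simpa using hq0)
          ENNReal.ofReal_ne_top, ENNReal.toReal_ofReal hq0.le] at this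
        exact this.ne
      · exact ne_top_of_le_ne_top (ENNReal.rpow_ne_top_of_nonneg hq0.le
          (ENNReal.mul_ne_top ENNReal.ofReal_ne_top hv.integrable.2.ne)) (tail a x₀ r hv)
    -- The ratio of ‖b‖_q to its natural size; it is finite since 0 < w(Q) < ∞ and ‖b‖_q < ∞.
    set β : ℝ≥0∞ := B ^ (1 / q) / V with hβ
    have hβt : β ≠ ⊤ := ENNReal.div_ne_top (ENNReal.rpow_ne_top_of_nonneg (by positivity) hBt) hV0
    have hBβ : B ≤ (β * V) ^ q := by
      rw [hβ, ENNReal.div_mul_cancel hV0 hVt, ← ENNReal.rpow_mul, one_div_mul_cancel hq0.ne',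
        ENNReal.rpow_one]
    refine ⟨C * (1 + β.toNNReal), fun x => ?_⟩
    have := hC w p a x₀ r hv hb β (hsize h) hBβ x
    rw [← ENNReal.coe_toNNReal hβt] at this
    simpa using this
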